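/- **Setting.** Let $L\ge 1$ be an integer, $S>0$, $\sigma>0$. Consider the memoryless Gaussian channel $Y_t=X_t+Z_t$, $Z_t\sim\mathcal N(0,\sigma^2)$ i.i.d., with transition density $P(y|x)$, and codewords on the sphere of radius $\sqrt{nS}$ in $\mathbb R^n$. The optimal list decoder outputs the $L$ messages of highest likelihood; $P_{e|m}(\mathcal C)$ is the probability that the transmitted message $m$ is not in the list. Put $$d(x_0,\dots,x_L)=-\ln\int_{-\infty}^{\infty}\prod_{i=0}^L P(y|x_i)^{1/(L+1)}\,dy .$$ A correlation matrix $\Lambda=(\rho_{ij})_{0\le i,j\le L}$ is a symmetric positive definite matrix with unit diagonal. For such $\Lambda$ let $(X_0,\dots,X_L)$ be a centred Gaussian vector with covariance $S\Lambda$, and let $I_G(\Lambda)$ be its multi-information, i.e. the Kullback–Leibler divergence between its law and the product of its marginals. For $R>0$ the CKM (Csiszár–Körner–Marton) expurgated exponent is $$E(R,L)=\inf\bigl\{\mathbf E\,d(X_0,\dots,X_L)+I_G(\Lambda)-LR:\ I_G(\Lambda)\le LR\bigr\}.$$ Write $\Delta(\Lambda)=\frac{LS}{2\sigma^2(L+1)^2}\bigl(L+1-\frac2L\sum_{i<j}\rho_{ij}\bigr)$,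 and for $-1/L<\rho<1$ $$I(\rho)=-\tfrac12\ln(1+\rho L)-\tfrac L2\ln(1-\rho),\qquad D(\rho)=\frac{SL(1-\rho)}{2\sigma^2(L+1)} .$$ **Statement.** 1. $d(x_0,\dots,x_L)=\frac{L}{2\sigma^2(L+1)^2}\bigl[\sum_i x_i^2-\frac2L\sum_{i<j}x_ix_j\bigr]$. If $\mathbf x_0,\dots,\mathbf x_L\in\mathbb R^n$ ($n\ge1$) lie on the sphere of radius $\sqrt{nS}$, then $\sum_{t=1}^n d(x_{0,t},\dots,x_{L,t})=n\,\Delta(\hat\Lambda)$, where $\hat\Lambda$ has entries $\frac1{nS}\sum_t x_{i,t}x_{j,t}$. 2. For every correlation matrix $\Lambda$: $I_G(\Lambda)=-\frac12\ln|\Lambda|$ and $\mathbf E\,d(X_0,\dots,X_L)=\Delta(\Lambda)$. Moreover, if $L+1$ codewords are independent and uniform on the sphere of radius $\sqrt{nS}$, the probability that their empirical correlations all lie within $\varepsilon$ of the entries of $\Lambda$ is of exponential order $e^{-nI_G(\Lambda)}$: for every $\delta>0$ there is $\varepsilon_0>0$ such that for each $\varepsilon\in(0,\varepsilon_0)$ it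 lies, for all large $n$, between $e^{-n(I_G(\Lambda)+\delta)}$ and $e^{-n(I_G(\Lambda)-\delta)}$. 3. For every $R>0$ there are codes $\mathcal C_n$ of $\lceil e^{nR}\rceil+1$ codewords on the sphere of radius $\sqrt{nS}$ with $\liminf_{n\to\infty}-\frac1n\ln\max_m P_{e|m}(\mathcal C_n)\ge E(R,L)$. 4. For every $R>0$, $$E(R,L)=\inf_{\Lambda:\,-\frac12\ln|\Lambda|\le LR}\Bigl[\Delta(\Lambda)-\tfrac12\ln|\Lambda|-LR\Bigr],$$ the infimum being over correlation matrices. It is attained, and it is attained at a totally symmetric $\Lambda$ ($\rho_{ij}=\rho$ for all $i\ne j$). Such a matrix is a correlation matrix if and only if $-1/L<\rho<1$, its determinant is $(1+\rho L)(1-\rho)^L$, and $$E(R,L)=\min_{-1/L<\rho<1:\ I(\rho)\le LR}\bigl[D(\rho)+I(\rho)-LR\bigr].$$ 5. $D+I$ has a unique minimizer $\rho_0$ over $[0,1)$, and $\rho_0\in(0,1)$. For every $R\ge0$ the equation $I(\rho)=LR$ has a unique solution $\varrho(R)\in[0,1)$, and there is exactly one $R_0\ge 0$ with $\varrho(R_0)=\rho_0$;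 moreover $R_0>0$. For $R>0$, $$E(R,L)=\begin{cases}\dfrac{SL[1-\varrho(R)]}{2\sigma^2(L+1)}, & R<R_0,\\[2mm] D(\rho_0)+I(\rho_0)-LR, & R\ge R_0.\end{cases}$$ The curve $R\mapsto D(\varrho(R))$ is differentiable on $(0,\infty)$, its derivative is strictly increasing, tends to $-\infty$ as $R\downarrow0$, and equals $-L$ exactly at $R=R_0$ (so that the affine part, of slope $-L$, is tangential to the curve at $R_0$). 6. For $L=1$, $$E(R,1)=\min_{|\rho|<1:\ -\frac12\ln(1-\rho^2)\le R}\Bigl[\tfrac{S}{4\sigma^2}(1-\rho)-\tfrac12\ln(1-\rho^2)-R\Bigr]\qquad(R>0),$$ $\varrho(R)=\sqrt{1-e^{-2R}}$, $E(R,1)=\frac{S(1-\sqrt{1-e^{-2R}})}{4\sigma^2}$ for $0<R<R_0$, and $E(R,1)=\frac{S(1-\sqrt{1-e^{-2R_0}})}{4\sigma^2}-(R-R_0)$ for $R\ge R_0$. For $L=2$ and $R\ge 0$, $\varrho(R)=\sqrt{1-e^{-4R}}\,\big/\,\bigl(2\cos\bigl[\tfrac13\arccos(-\sqrt{1-e^{-4R}})\bigr]\bigr)$.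 -/

import Mathlib

open MeasureTheory ProbabilityTheory Filter Topology Set

noncomputable section

namespace GaussianList

/-! ### The Gaussian channel, spherical codes and list decoding -/

/-- Likelihood `P(y|x)` of the memoryless channel `Y_t = X_t + Z_t`, `Z_t ~ N(0, σ²)` i.i.d. -/
def likelihood (σ : ℝ) {n : ℕ} (x y : Fin n → ℝ) : ℝ :=
  ∏ t, gaussianPDFReal (x t) (Real.toNNReal (σ ^ 2)) (y t)

/-- Law of the channel output when the codeword `x` is transmitted. -/
def outputLaw (σ : ℝ) {n : ℕ} (x : Fin n → ℝ) : Measure (Fin n → ℝ) :=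
  Measure.pi fun t => gaussianReal (x t) (Real.toNNReal (σ ^ 2))

open scoped Classical in
/-- The optimal (maximum likelihood) list decoder for the code `C`: given `y`, it outputs the `L`
messages of highest likelihood (all messages if there are at most `L`), ties being broken in favour
of the smaller message. -/
def mlList (σ : ℝ) (L : ℕ) {n M : ℕ} (C : Fin M → Fin n → ℝ) (y : Fin n → ℝ) : Finset (Fin M) :=
  Finset.univ.filter fun m =>
    (Finset.univ.filter fun m' =>
      likelihood σ (C m) y < likelihood σ (C m') y ∨
        (likelihood σ (C m) y = likelihood σ (C m') y ∧ m' < m)).card < L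

/-- Probability of list error given that message `m` is transmitted: `m` is not in the list. -/
def listErrorProb (σ : ℝ) (L : ℕ) {n M : ℕ} (C : Fin M → Fin n → ℝ) (m : Fin M) : ENNReal :=
  outputLaw σ (C m) {y | m ∉ mlList σ L C y}

/-- `x` lies on the sphere of radius `√(nS)` in `ℝⁿ`. -/
def OnSphere (S : ℝ) {n : ℕ} (x : Fin n → ℝ) : Prop := ∑ t, x t ^ 2 = n * S

/-- The uniform distribution on the sphere of radius `√(nS)` in `ℝⁿ` (for `n ≥ 1`): the normalised
surface measure of the Euclidean unit sphere, dilated by `√(nS)`. -/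
def uniformSphere (n : ℕ) (S : ℝ) : Measure (Fin n → ℝ) :=
  (ProbabilityTheory.cond (volume : Measure (EuclideanSpace ℝ (Fin n))).toSphere univ).map
    fun (u : Metric.sphere (0 : EuclideanSpace ℝ (Fin n)) 1) (t : Fin n) => √(n * S) * u.1 t

/-- Empirical correlation `(1/(nS)) ∑_t x_t x'_t` of two words. -/
def empCorr (S : ℝ) {n : ℕ} (x x' : Fin n → ℝ) : ℝ := (∑ t, x t * x' t) / (n * S)

/-- Probability that `L + 1` independent codewords, each uniform on the sphere of radius `√(nS)`,
have empirical correlations equal to the entries of `Λ` within the tolerance `ε`. -/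
def corrProb (L n : ℕ) (S ε : ℝ) (Λ : Matrix (Fin (L + 1)) (Fin (L + 1)) ℝ) : ENNReal :=
  (Measure.pi fun _ : Fin (L + 1) => uniformSphere n S)
    {x | ∀ i j, |empCorr S (x i) (x j) - Λ i j| ≤ ε}

/-! ### The quantities in the expurgated exponent -/

/-- The generalised Bhattacharyya distance
`d(x_0, …, x_L) = -ln ∫ ∏_i P(y|x_i)^{1/(L+1)} dy` of the scalar Gaussian channel. -/
def bhatt (σ : ℝ) {L : ℕ} (x : Fin (L + 1) → ℝ) : ℝ :=
  -Real.log (∫ y : ℝ, ∏ i, gaussianPDFReal (x i) (Real.toNNReal (σ ^ 2)) y ^ ((1 : ℝ) / (L + 1)))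

/-- Multi-information of a random vector with law `μ`: the Kullback–Leibler divergence between the
joint law and the product of its marginals. -/
def multiInfo {L : ℕ} (μ : Measure (Fin (L + 1) → ℝ)) : ENNReal :=
  InformationTheory.klDiv μ (Measure.pi fun i => μ.map fun x => x i)

/-- The law of the centred Gaussian vector `(X_0, …, X_L)` with covariance matrix `S Λ`. -/
def gaussLaw {L : ℕ} (S : ℝ) (Λ : Matrix (Fin (L + 1)) (Fin (L + 1)) ℝ) :
    Measure (Fin (L + 1) → ℝ) :=
  (multivariateGaussian 0 (S • Λ)).map (MeasurableEquiv.toLp 2 (Fin (L + 1) → ℝ)).symm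

/-- `Λ` is a (nonsingular) correlation matrix: symmetric, positive definite, unit diagonal. -/
def IsCorr {L : ℕ} (Λ : Matrix (Fin (L + 1)) (Fin (L + 1)) ℝ) : Prop :=
  Λ.PosDef ∧ ∀ i, Λ i i = 1

/-- The Csiszár–Körner–Marton expurgated exponent for list size `L` and the ensemble of codewords
on the sphere of radius `√(nS)`: the infimum, over the Gaussian laws of `(X_0, …, X_L)` whose
common second moment is `S` and whose multi-information is at most `L R`, of
`E d(X_0, …, X_L) + I(X_0; …; X_L) - L R`. -/
def ckmExponent (S σ : ℝ) (L : ℕ) (R : ℝ) : ℝ :=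
  sInf {e | ∃ Λ : Matrix (Fin (L + 1)) (Fin (L + 1)) ℝ, IsCorr Λ ∧
    multiInfo (gaussLaw S Λ) ≤ ENNReal.ofReal (L * R) ∧
    e = (∫ x, bhatt σ x ∂gaussLaw S Λ) + (multiInfo (gaussLaw S Λ)).toReal - L * R}

/-- `(LS / (2σ²(L+1)²)) (L + 1 - (2/L) ∑_{i<j} ρ_ij)`. -/
def distForm (S σ : ℝ) {L : ℕ} (Λ : Matrix (Fin (L + 1)) (Fin (L + 1)) ℝ) : ℝ :=
  L * S / (2 * σ ^ 2 * (L + 1) ^ 2) * (L + 1 - 2 / L * ∑ i, ∑ j ∈ Finset.Ioi i, Λ i j)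

/-- The totally symmetric matrix: ones on the diagonal, `ρ` off the diagonal. -/
def symMatrix (L : ℕ) (ρ : ℝ) : Matrix (Fin (L + 1)) (Fin (L + 1)) ℝ :=
  Matrix.of fun i j => if i = j then 1 else ρ

/-- `-½ ln(1 + ρL) - (L/2) ln(1 - ρ)`. -/
def symInfo (L : ℕ) (ρ : ℝ) : ℝ :=
  -(1 / 2) * Real.log (1 + ρ * L) - L / 2 * Real.log (1 - ρ)

/-- `SL(1 - ρ) / (2σ²(L+1))`. -/
def symDist (S σ : ℝ) (L : ℕ) (ρ : ℝ) : ℝ := S * L * (1 - ρ) / (2 * σ ^ 2 * (L + 1))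

end GaussianList

end

noncomputable section

namespace GaussianList

/-! ### The one-parameter functions `symInfo` and `symDist` -/

/-! The Gaussian computations reduce to empirical correlation matrices, and convexity then reduces
these to one real parameter.

The geometric mean of Gaussian densities is a Gaussian density times the exponential of minus an
empirical variance over `2σ²`. Hence `bhatt` is an explicit quadratic form, and on the sphere the
distance of `L + 1` words depends only on their mean off-diagonal correlation `offMean`
(`distForm_eq_symDist`). The correlated Gaussian law has density `gaussRatio` relative to its
product of marginals. Its logarithm is `-½ ln |Λ|` plus a quadratic form of mean zero, which gives
the multi-information. Over `n` letters the density becomes `gramRatio`, a function of the empirical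
correlations alone that stays near `e^{nI}` when these are near `Λ`. Chebyshev's inequality under
the correlated law then yields both bounds for independent Gaussian words, and independence of norm
and direction transfers them to the sphere (`corrProb_exponent`).

To reduce to totally symmetric matrices, compare `Λ` with the symmetric matrix `B` of the same mean
correlation: `tr (B⁻¹ Λ) = L + 1`, so `ln x ≤ x - 1` on the eigenvalues of a congruent form gives
`|Λ| ≤ |B|` while the distance is unchanged. What remains is to minimise `D + I`, where `D` is
affine and `I' = symSlope` is strictly increasing on `[0, 1)`. The free minimiser `ρ₀` solves
`symSlope = distSlope`, the constraint reads `ρ ≤ symRho L R`, and the minimum sits at `min (symRho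
L R) ρ₀`. The inverse function rule gives the slope `-L · distSlope / symSlope` of the curve, hence
tangency at `ρ₀`.

Achievability is random coding with expurgation. The union bound over the competing `L`-subsets
bounds the list error by a sum of `exp (-wordDist)`. For `s ≤ 1` the power `x ↦ x ^ s` is
subadditive, so the average of the `s`-th power is controlled by the moment generating function of
`-wordDist`. Comparison with the symmetric correlated law whose `ρ` satisfies `s · distSlope =
symSlope ρ` bounds it by exponent `s D(ρ) + I(ρ)`. Keeping the better half of `2M` words yields
exponent `D(ρ) + (I(ρ) - L R) / s`. At `ρ = min (symRho L R) ρ₀` this is the CKM exponent, because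
either `I(ρ) = L R` or `s = 1`. -/

/-- The derivative of `symInfo`. -/
def symSlope (L : ℕ) (ρ : ℝ) : ℝ := L * (L + 1) * ρ / (2 * ((1 + ρ * L) * (1 - ρ)))

lemma symInfo_zero (L : ℕ) : symInfo L 0 = 0 := by simp [symInfo]

lemma hasDerivAt_symInfo {L : ℕ} {ρ : ℝ} (h0 : 0 < 1 + ρ * L) (h1 : ρ < 1) :
    HasDerivAt (symInfo L) (symSlope L ρ) ρ := by
  have h1' : 0 < 1 - ρ := by linarith
  have e1 : HasDerivAt (fun ρ : ℝ => 1 + ρ * L) (L : ℝ) ρ := by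
    simpa using ((hasDerivAt_id ρ).mul_const (L : ℝ)).const_add 1
  have e2 : HasDerivAt (fun ρ : ℝ => 1 - ρ) (-1) ρ := by
    simpa using (hasDerivAt_id ρ).const_sub 1
  have := ((e1.log h0.ne').const_mul (-(1 / 2) : ℝ)).sub ((e2.log h1'.ne').const_mul ((L : ℝ) / 2))
  refine this.congr_deriv ?_
  have h0' := h0.ne'
  have h1'' := h1'.ne'
  unfold symSlope
  rw [mul_div_assoc', div_mul_div_comm, div_sub_div _ _ h0' (by positivity),
    div_eq_div_iff (by positivity) (by positivity)]
  ring

lemma one_add_mul_pos {L : ℕ} {ρ : ℝ} (h0 : 0 ≤ ρ) : 0 < 1 + ρ * L := by positivity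

/-- Apply `ln x ≤ x - 1` to both logarithms: the linear terms `ρL` and `-Lρ` cancel. -/
lemma symInfo_nonneg {L : ℕ} (hL : 1 ≤ L) {ρ : ℝ} (h0 : -1 / (L : ℝ) < ρ) (h1 : ρ < 1) :
    0 ≤ symInfo L ρ := by
  have hL' : (0 : ℝ) < L := by exact_mod_cast hL
  have h2 : 0 < 1 + ρ * L := by
    rw [div_lt_iff₀ hL'] at h0; linarith
  have e1 := Real.log_le_sub_one_of_pos h2
  have e2 := Real.log_le_sub_one_of_pos (show 0 < 1 - ρ by linarith)
  unfold symInfo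
  nlinarith

lemma strictMonoOn_symInfo {L : ℕ} (hL : 1 ≤ L) : StrictMonoOn (symInfo L) (Ico 0 1) := by
  have hL' : (0 : ℝ) < L := by exact_mod_cast hL
  refine strictMonoOn_of_deriv_pos (convex_Ico 0 1) (fun x hx => ?_) (fun x hx => ?_)
  · exact (hasDerivAt_symInfo (one_add_mul_pos hx.1) hx.2).continuousAt.continuousWithinAt
  · rw [interior_Ico] at hx
    rw [(hasDerivAt_symInfo (one_add_mul_pos hx.1.le) hx.2).deriv]
    have := one_add_mul_pos (L := L) hx.1.le
    have := hx.1
    have : 0 < 1 - x := by linarith [hx.2]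
    unfold symSlope
    positivity

lemma symSlope_lt_symSlope {L : ℕ} (hL : 1 ≤ L) {a b : ℝ} (ha : 0 ≤ a) (hab : a < b) (hb : b < 1) :
    symSlope L a < symSlope L b := by
  have hL' : (0 : ℝ) < L := by exact_mod_cast hL
  have h1 := one_add_mul_pos (L := L) ha
  have h2 := one_add_mul_pos (L := L) (ha.trans hab.le)
  have h3 : 0 < 1 - a := by linarith
  have h4 : 0 < 1 - b := by linarith
  unfold symSlope
  rw [div_lt_div_iff₀ (by positivity) (by positivity)]
  -- After cross-multiplication, `b(1 + aL)(1 - a) - a(1 + bL)(1 - b)` factors as `(b - a)(1 +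
  -- abL)`.
  have : 0 < (L : ℝ) * (L + 1) * (b - a) * (1 + a * b * L) := by
    have : 0 < b - a := by linarith
    have : 0 ≤ a * b * L := mul_nonneg (mul_nonneg ha (ha.trans hab.le)) hL'.le
    positivity
  nlinarith

lemma strictMonoOn_symSlope {L : ℕ} (hL : 1 ≤ L) : StrictMonoOn (symSlope L) (Ico 0 1) :=
  fun _ ha _ hb hab => symSlope_lt_symSlope hL ha.1 hab hb.2

/-- Minus the derivative of `symDist`. -/
def distSlope (S σ : ℝ) (L : ℕ) : ℝ := S * L / (2 * σ ^ 2 * (L + 1))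

lemma distSlope_pos {S σ : ℝ} (hS : 0 < S) (hσ : 0 < σ) {L : ℕ} (hL : 1 ≤ L) :
    0 < distSlope S σ L := by
  have hL' : (0 : ℝ) < L := by exact_mod_cast hL
  unfold distSlope; positivity

lemma symDist_eq (S σ : ℝ) (L : ℕ) (ρ : ℝ) : symDist S σ L ρ = distSlope S σ L * (1 - ρ) := by
  unfold symDist distSlope; ring

lemma exists_symSlope_eq {L : ℕ} (hL : 1 ≤ L) {k : ℝ} (hk : 0 < k) :
    ∃ ρ, 0 < ρ ∧ ρ < 1 ∧ symSlope L ρ = k := by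
  have hL' : (0 : ℝ) < L := by exact_mod_cast hL
  -- Clearing denominators removes the pole at `1`, so the intermediate value theorem applies on the
  -- closed interval.
  set f : ℝ → ℝ := fun ρ => L * (L + 1) * ρ - k * (2 * ((1 + ρ * L) * (1 - ρ))) with hf
  have hc : ContinuousOn f (Icc 0 1) := by fun_prop
  obtain ⟨ρ, hρ, h⟩ := intermediate_value_Ioo zero_le_one hc
    (show (0 : ℝ) ∈ Ioo (f 0) (f 1) by
      constructor
      · simp [hf]; positivity
      · simp [hf]; positivity)
  refine ⟨ρ, hρ.1, hρ.2, ?_⟩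
  have h1 := one_add_mul_pos (L := L) hρ.1.le
  have h2 : 0 < 1 - ρ := by linarith [hρ.2]
  unfold symSlope
  rw [div_eq_iff (by positivity)]
  simp only [hf] at h
  linarith

lemma exists_symInfo_eq {L : ℕ} (hL : 1 ≤ L) {y : ℝ} (hy : 0 ≤ y) :
    ∃ ρ, 0 ≤ ρ ∧ ρ < 1 ∧ symInfo L ρ = y := by
  have hL' : (1 : ℝ) ≤ L := by exact_mod_cast hL
  -- At `r = 1 - e^{-c}` the second term of `symInfo` is `L c / 2 ≥ y + ½ ln (1 + L)`, which
  -- outweighs the loss `½ ln (1 + r L)`.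
  set c : ℝ := 2 * y + Real.log (1 + L) with hc
  have hlog : 0 ≤ Real.log (1 + (L : ℝ)) := Real.log_nonneg (by linarith)
  have hc0 : 0 ≤ c := by positivity
  set r : ℝ := 1 - Real.exp (-c) with hr
  have hr0 : 0 ≤ r := by
    have : Real.exp (-c) ≤ 1 := Real.exp_le_one_iff.2 (by linarith)
    linarith
  have hr1 : r < 1 := by have := Real.exp_pos (-c); linarith
  have hle : y ≤ symInfo L r := by
    have h1 : Real.log (1 + r * L) ≤ Real.log (1 + L) := by
      apply Real.log_le_log (one_add_mul_pos hr0); nlinarith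
    have h2 : Real.log (1 - r) = -c := by rw [hr]; simp
    unfold symInfo
    rw [h2]
    nlinarith
  have hcont : ContinuousOn (symInfo L) (Icc 0 r) := fun x hx =>
    (hasDerivAt_symInfo (one_add_mul_pos hx.1)
      (hx.2.trans_lt hr1)).continuousAt.continuousWithinAt
  obtain ⟨ρ, hρ, h⟩ := intermediate_value_Icc hr0 hcont
    (show y ∈ Icc (symInfo L 0) (symInfo L r) from ⟨by rwa [symInfo_zero], hle⟩)
  exact ⟨ρ, hρ.1, hρ.2.trans_lt hr1, h⟩

/-- The solution `ρ ∈ [0, 1)` of `symInfo L ρ = L R`. -/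
def symRho (L : ℕ) (R : ℝ) : ℝ := Classical.epsilon fun ρ => 0 ≤ ρ ∧ ρ < 1 ∧ symInfo L ρ = L * R

lemma symRho_spec {L : ℕ} (hL : 1 ≤ L) {R : ℝ} (hR : 0 ≤ R) :
    0 ≤ symRho L R ∧ symRho L R < 1 ∧ symInfo L (symRho L R) = L * R :=
  Classical.epsilon_spec (exists_symInfo_eq hL (by positivity : 0 ≤ L * R))

lemma symInfo_eq_iff {L : ℕ} (hL : 1 ≤ L) {R : ℝ} (hR : 0 ≤ R) {ρ : ℝ} (h0 : 0 ≤ ρ) (h1 : ρ < 1) :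
    symInfo L ρ = L * R ↔ ρ = symRho L R := by
  obtain ⟨a, b, c⟩ := symRho_spec hL hR
  rw [← c]
  exact (strictMonoOn_symInfo hL).injOn.eq_iff ⟨h0, h1⟩ ⟨a, b⟩

lemma symInfo_le_iff {L : ℕ} (hL : 1 ≤ L) {R : ℝ} (hR : 0 ≤ R) {ρ : ℝ} (h0 : 0 ≤ ρ) (h1 : ρ < 1) :
    symInfo L ρ ≤ L * R ↔ ρ ≤ symRho L R := by
  obtain ⟨a, b, c⟩ := symRho_spec hL hR
  rw [← c]
  exact (strictMonoOn_symInfo hL).le_iff_le ⟨h0, h1⟩ ⟨a, b⟩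

lemma strictMonoOn_symRho {L : ℕ} (hL : 1 ≤ L) : StrictMonoOn (symRho L) (Ici 0) := by
  intro a ha b hb hab
  obtain ⟨a1, a2, a3⟩ := symRho_spec hL ha
  obtain ⟨b1, b2, b3⟩ := symRho_spec hL hb
  rw [← (strictMonoOn_symInfo hL).lt_iff_lt ⟨a1, a2⟩ ⟨b1, b2⟩, a3, b3]
  have hL' : (0 : ℝ) < L := by exact_mod_cast hL
  nlinarith

lemma symRho_zero {L : ℕ} (hL : 1 ≤ L) : symRho L 0 = 0 :=
  ((symInfo_eq_iff hL le_rfl le_rfl one_pos).1 (by simp [symInfo_zero])).symm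

lemma symRho_pos {L : ℕ} (hL : 1 ≤ L) {R : ℝ} (hR : 0 < R) : 0 < symRho L R := by
  have := strictMonoOn_symRho hL (mem_Ici.2 le_rfl) (mem_Ici.2 hR.le) hR
  rwa [symRho_zero hL] at this

lemma symRho_image {L : ℕ} (hL : 1 ≤ L) {ρ : ℝ} (h0 : 0 ≤ ρ) (h1 : ρ < 1) :
    0 ≤ symInfo L ρ / L ∧ symRho L (symInfo L ρ / L) = ρ := by
  have hL' : (0 : ℝ) < L := by exact_mod_cast hL
  have h : 0 ≤ symInfo L ρ := by
    rw [← symInfo_zero L]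
    exact (strictMonoOn_symInfo hL).monotoneOn ⟨le_rfl, one_pos⟩ ⟨h0, h1⟩ h0
  have h' : 0 ≤ symInfo L ρ / L := by positivity
  exact ⟨h', ((symInfo_eq_iff hL h' h0 h1).1 (by field_simp)).symm⟩

/-- A monotone function is continuous where its image is a neighbourhood of the value; by
`symRho_image` the image covers `(0, 1)`. -/
lemma continuousAt_symRho {L : ℕ} (hL : 1 ≤ L) {R : ℝ} (hR : 0 < R) :
    ContinuousAt (symRho L) R := by
  refine (strictMonoOn_symRho hL).continuousAt_of_image_mem_nhds (Ici_mem_nhds hR) ?_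
  have hsub : Ioo (0 : ℝ) 1 ⊆ symRho L '' Ici 0 := fun ρ hρ =>
    ⟨symInfo L ρ / L, (symRho_image hL hρ.1.le hρ.2).1, (symRho_image hL hρ.1.le hρ.2).2⟩
  exact mem_of_superset (Ioo_mem_nhds (symRho_pos hL hR) (symRho_spec hL hR.le).2.1) hsub

lemma symSlope_pos {L : ℕ} (hL : 1 ≤ L) {ρ : ℝ} (h0 : 0 < ρ) (h1 : ρ < 1) : 0 < symSlope L ρ := by
  have := symSlope_lt_symSlope hL le_rfl h0 h1
  simpa [symSlope] using this

lemma hasDerivAt_symRho {L : ℕ} (hL : 1 ≤ L) {R : ℝ} (hR : 0 < R) :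
    HasDerivAt (symRho L) (L / symSlope L (symRho L R)) R := by
  have hL' : (0 : ℝ) < L := by exact_mod_cast hL
  obtain ⟨a, b, c⟩ := symRho_spec hL hR.le
  have hpos := symSlope_pos hL (symRho_pos hL hR) b
  have h := (hasDerivAt_symInfo (L := L) (one_add_mul_pos a) b).div_const (L : ℝ)
  have := HasDerivAt.of_local_left_inverse (continuousAt_symRho hL hR) h (by positivity)
    (by
      filter_upwards [Ioi_mem_nhds hR] with r hr
      rw [(symRho_spec hL (le_of_lt hr)).2.2]
      field_simp)
  simpa using this

lemma hasDerivAt_symDist_symRho (S σ : ℝ) {L : ℕ} (hL : 1 ≤ L) {R : ℝ} (hR : 0 < R) :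
    HasDerivAt (fun r => symDist S σ L (symRho L r))
      (-(distSlope S σ L * L / symSlope L (symRho L R))) R := by
  simp only [symDist_eq]
  refine (((hasDerivAt_symRho hL hR).const_sub 1).const_mul (distSlope S σ L)).congr_deriv ?_
  ring

/-- The slope is `-L` exactly when `symSlope` equals `distSlope`, which is the stationarity equation
defining `ρ₀`; injectivity of `symSlope` finishes. -/
lemma deriv_symDist_symRho_eq_iff {S σ : ℝ} {L : ℕ} (hL : 1 ≤ L)
    {ρ₀ : ℝ} (h0 : 0 < ρ₀) (h1 : ρ₀ < 1) (h : symSlope L ρ₀ = distSlope S σ L)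
    {R : ℝ} (hR : 0 < R) :
    deriv (fun r => symDist S σ L (symRho L r)) R = -L ↔ symRho L R = ρ₀ := by
  have hL' : (0 : ℝ) < L := by exact_mod_cast hL
  obtain ⟨a, b, c⟩ := symRho_spec hL hR.le
  have hpos := symSlope_pos hL (symRho_pos hL hR) b
  rw [(hasDerivAt_symDist_symRho S σ hL hR).deriv, neg_inj, div_eq_iff hpos.ne',
    ← (strictMonoOn_symSlope hL).injOn.eq_iff ⟨a, b⟩ ⟨h0.le, h1⟩, h, mul_comm]
  constructor
  · intro e; exact (mul_left_cancel₀ hL'.ne' e).symm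
  · intro e; rw [e]

lemma strictMonoOn_deriv_symDist_symRho {S σ : ℝ} (hS : 0 < S) (hσ : 0 < σ) {L : ℕ} (hL : 1 ≤ L) :
    StrictMonoOn (deriv fun r => symDist S σ L (symRho L r)) (Ioi 0) := by
  intro a ha b hb hab
  rw [mem_Ioi] at ha hb
  have hL' : (0 : ℝ) < L := by exact_mod_cast hL
  have hk := distSlope_pos hS hσ hL
  rw [(hasDerivAt_symDist_symRho S σ hL ha).deriv, (hasDerivAt_symDist_symRho S σ hL hb).deriv,
    neg_lt_neg_iff]
  have h1 := strictMonoOn_symRho hL (mem_Ici.2 ha.le) (mem_Ici.2 hb.le) hab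
  have h2 := symSlope_lt_symSlope hL (symRho_spec hL ha.le).1 h1 (symRho_spec hL hb.le).2.1
  have h3 := symSlope_pos hL (symRho_pos hL ha) (symRho_spec hL ha.le).2.1
  gcongr

lemma tendsto_symRho_zero {L : ℕ} (hL : 1 ≤ L) : Tendsto (symRho L) (𝓝[>] 0) (𝓝 0) := by
  rw [tendsto_order]
  refine ⟨fun a ha => ?_, fun a ha => ?_⟩
  · filter_upwards [self_mem_nhdsWithin] with r hr using ha.trans (symRho_pos hL hr)
  · set a' := min a (1 / 2) with ha'
    have h0 : 0 < a' := lt_min ha (by norm_num)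
    have h1 : a' < 1 := (min_le_right _ _).trans_lt (by norm_num)
    obtain ⟨e1, e2⟩ := symRho_image hL h0.le h1
    have hpos : 0 < symInfo L a' / L := by
      refine lt_of_le_of_ne e1 fun h => ?_
      rw [← h, symRho_zero hL] at e2
      exact h0.ne e2
    filter_upwards [Ioo_mem_nhdsGT hpos] with r hr
    have := strictMonoOn_symRho hL (mem_Ici.2 hr.1.le) (mem_Ici.2 hpos.le) hr.2
    rw [e2] at this
    exact this.trans_le (min_le_left _ _)

/-- As `R ↓ 0`, `symRho L R` tends to `0`, where the denominator `symSlope` of the derivative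
vanishes from above. -/
lemma tendsto_deriv_symDist_symRho {S σ : ℝ} (hS : 0 < S) (hσ : 0 < σ) {L : ℕ} (hL : 1 ≤ L) :
    Tendsto (deriv fun r => symDist S σ L (symRho L r)) (𝓝[>] 0) atBot := by
  have hL' : (0 : ℝ) < L := by exact_mod_cast hL
  have hk := distSlope_pos hS hσ hL
  have h1 : Tendsto (fun r => symSlope L (symRho L r)) (𝓝[>] 0) (𝓝[>] 0) := by
    rw [tendsto_nhdsWithin_iff]
    constructor
    · have : ContinuousAt (symSlope L) 0 := by
        unfold symSlope
        refine ContinuousAt.div (by fun_prop) (by fun_prop) (by simp)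
      have h := this.tendsto.comp (tendsto_symRho_zero hL)
      have h0 : symSlope L 0 = 0 := by simp [symSlope]
      rwa [h0] at h
    · filter_upwards [self_mem_nhdsWithin] with r hr
      exact symSlope_pos hL (symRho_pos hL hr) (symRho_spec hL (le_of_lt hr)).2.1
  have h2 := (h1.inv_tendsto_nhdsGT_zero.const_mul_atTop (mul_pos hk hL'))
  refine (tendsto_neg_atTop_atBot.comp h2).congr' ?_
  filter_upwards [self_mem_nhdsWithin] with r hr
  rw [(hasDerivAt_symDist_symRho S σ hL hr).deriv]
  simp [div_eq_mul_inv]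

/-! ### Minimisation of `symDist + symInfo` -/

lemma hasDerivAt_symDist_add_symInfo (S σ : ℝ) {L : ℕ} {ρ : ℝ} (h0 : 0 ≤ ρ) (h1 : ρ < 1) :
    HasDerivAt (fun ρ => symDist S σ L ρ + symInfo L ρ) (symSlope L ρ - distSlope S σ L) ρ := by
  simp only [symDist_eq]
  refine ((((hasDerivAt_id ρ).const_sub 1).const_mul (distSlope S σ L)).add
    (hasDerivAt_symInfo (one_add_mul_pos h0) h1)).congr_deriv ?_
  ring

lemma strictAntiOn_symDist_add_symInfo {S σ : ℝ} {L : ℕ} (hL : 1 ≤ L)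
    {ρ₀ : ℝ} (h1 : ρ₀ < 1) (h : symSlope L ρ₀ = distSlope S σ L) :
    StrictAntiOn (fun ρ => symDist S σ L ρ + symInfo L ρ) (Icc 0 ρ₀) := by
  refine strictAntiOn_of_deriv_neg (convex_Icc 0 ρ₀) (fun x hx => ?_) (fun x hx => ?_)
  · exact (hasDerivAt_symDist_add_symInfo S σ hx.1
      (hx.2.trans_lt h1)).continuousAt.continuousWithinAt
  · rw [interior_Icc] at hx
    rw [(hasDerivAt_symDist_add_symInfo S σ hx.1.le (hx.2.trans h1)).deriv, ← h]
    linarith [symSlope_lt_symSlope hL hx.1.le hx.2 h1]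

lemma strictMonoOn_symDist_add_symInfo {S σ : ℝ} {L : ℕ} (hL : 1 ≤ L)
    {ρ₀ : ℝ} (h0 : 0 ≤ ρ₀) (h : symSlope L ρ₀ = distSlope S σ L) :
    StrictMonoOn (fun ρ => symDist S σ L ρ + symInfo L ρ) (Ico ρ₀ 1) := by
  refine strictMonoOn_of_deriv_pos (convex_Ico ρ₀ 1) (fun x hx => ?_) (fun x hx => ?_)
  · exact (hasDerivAt_symDist_add_symInfo S σ (h0.trans hx.1)
      hx.2).continuousAt.continuousWithinAt
  · rw [interior_Ico] at hx
    rw [(hasDerivAt_symDist_add_symInfo S σ (h0.trans hx.1.le) hx.2).deriv, ← h]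
    linarith [symSlope_lt_symSlope hL h0 hx.1 hx.2]

lemma symDist_add_symInfo_lt {S σ : ℝ} {L : ℕ} (hL : 1 ≤ L)
    {ρ₀ : ℝ} (h0 : 0 ≤ ρ₀) (h1 : ρ₀ < 1) (h : symSlope L ρ₀ = distSlope S σ L)
    {ρ : ℝ} (hρ0 : 0 ≤ ρ) (hρ1 : ρ < 1) (hne : ρ ≠ ρ₀) :
    symDist S σ L ρ₀ + symInfo L ρ₀ < symDist S σ L ρ + symInfo L ρ := by
  rcases lt_or_gt_of_ne hne with hlt | hgt
  · exact strictAntiOn_symDist_add_symInfo hL h1 h ⟨hρ0, hlt.le⟩ ⟨h0, le_rfl⟩ hlt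
  · exact strictMonoOn_symDist_add_symInfo hL h0 h ⟨le_rfl, h1⟩ ⟨hgt.le, hρ1⟩ hgt

/-- The constrained minimum of `symDist + symInfo` is attained at `min (symRho L R) ρ₀`. -/
lemma isLeast_symmetric {S σ : ℝ} (hS : 0 < S) (hσ : 0 < σ) {L : ℕ} (hL : 1 ≤ L)
    {ρ₀ : ℝ} (h0 : 0 < ρ₀) (h1 : ρ₀ < 1) (h : symSlope L ρ₀ = distSlope S σ L)
    {R : ℝ} (hR : 0 < R) :
    IsLeast {e | ∃ ρ : ℝ, -1 / (L : ℝ) < ρ ∧ ρ < 1 ∧ symInfo L ρ ≤ L * R ∧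
        e = symDist S σ L ρ + symInfo L ρ - L * R}
      (symDist S σ L (min (symRho L R) ρ₀) + symInfo L (min (symRho L R) ρ₀) - L * R) := by
  have hL' : (0 : ℝ) < L := by exact_mod_cast hL
  obtain ⟨a, b, c⟩ := symRho_spec hL hR.le
  set m := min (symRho L R) ρ₀ with hm
  have hm0 : 0 ≤ m := le_min a h0.le
  have hm1 : m < 1 := (min_le_left _ _).trans_lt b
  have hneg : -1 / (L : ℝ) < 0 := div_neg_of_neg_of_pos (by norm_num) hL'
  constructor
  · exact ⟨m, hneg.trans_le hm0, hm1, (symInfo_le_iff hL hR.le hm0 hm1).2 (min_le_left _ _), rfl⟩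
  · have key : ∀ ρ, 0 ≤ ρ → ρ ≤ symRho L R →
        symDist S σ L m + symInfo L m ≤ symDist S σ L ρ + symInfo L ρ := by
      intro ρ hρ hρR
      rcases le_total (symRho L R) ρ₀ with hle | hle
      · have hmeq : m = symRho L R := min_eq_left hle
        rw [hmeq]
        exact (strictAntiOn_symDist_add_symInfo hL h1 h).antitoneOn ⟨hρ, hρR.trans hle⟩ ⟨a, hle⟩ hρR
      · have hmeq : m = ρ₀ := min_eq_right hle
        rw [hmeq]
        by_cases hne : ρ = ρ₀
        · rw [hne]
        · exact (symDist_add_symInfo_lt hL h0.le h1 h hρ (hρR.trans_lt b) hne).le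
    rintro e ⟨ρ, hρ0, hρ1, hI, rfl⟩
    rcases le_total 0 ρ with hρ | hρ
    · linarith [key ρ hρ ((symInfo_le_iff hL hR.le hρ hρ1).1 hI)]
    -- A negative `ρ` is no better than `0`: there `symInfo` is at least `symInfo L 0 = 0` and
    -- `symDist` is at least its value at `0`.
    · have e1 := key 0 le_rfl a
      have e2 := symInfo_nonneg hL hρ0 hρ1
      rw [symInfo_zero] at e1
      have e3 : symDist S σ L 0 ≤ symDist S σ L ρ := by
        rw [symDist_eq, symDist_eq]
        have := distSlope_pos hS hσ hL
        nlinarith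
      linarith

/-! ### Closed forms for `L = 1` and `L = 2` -/

lemma symInfo_one {ρ : ℝ} (h : |ρ| < 1) : symInfo 1 ρ = -(1 / 2) * Real.log (1 - ρ ^ 2) := by
  obtain ⟨h1, h2⟩ := abs_lt.1 h
  have e : 1 - ρ ^ 2 = (1 + ρ) * (1 - ρ) := by ring
  rw [e, Real.log_mul (by linarith) (by linarith)]
  simp [symInfo]; ring

lemma symRho_one {R : ℝ} (hR : 0 ≤ R) : symRho 1 R = √(1 - Real.exp (-2 * R)) := by
  have h1 : 0 ≤ 1 - Real.exp (-2 * R) := by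
    have : Real.exp (-2 * R) ≤ 1 := Real.exp_le_one_iff.2 (by linarith)
    linarith
  have h2 : √(1 - Real.exp (-2 * R)) < 1 := by
    rw [Real.sqrt_lt' one_pos]; linarith [Real.exp_pos (-2 * R)]
  refine ((symInfo_eq_iff le_rfl hR (Real.sqrt_nonneg _) h2).1 ?_).symm
  rw [symInfo_one (by rwa [abs_of_nonneg (Real.sqrt_nonneg _)]), Real.sq_sqrt h1]
  simp

/-- For `L = 2` the equation is the cubic `(1 + 2ρ)(1 - ρ)² = e^{-4R}`, solved trigonometrically by
the triple-angle formula. -/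
lemma symRho_two {R : ℝ} (hR : 0 ≤ R) : symRho 2 R = √(1 - Real.exp (-4 * R)) /
    (2 * Real.cos (1 / 3 * Real.arccos (-√(1 - Real.exp (-4 * R))))) := by
  have h1 : 0 ≤ 1 - Real.exp (-4 * R) := by
    have : Real.exp (-4 * R) ≤ 1 := Real.exp_le_one_iff.2 (by linarith)
    linarith
  have hw2 : √(1 - Real.exp (-4 * R)) ^ 2 = 1 - Real.exp (-4 * R) := Real.sq_sqrt h1
  have hw0 : 0 ≤ √(1 - Real.exp (-4 * R)) := Real.sqrt_nonneg _
  have hw1 : √(1 - Real.exp (-4 * R)) < 1 := by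
    rw [Real.sqrt_lt' one_pos]; linarith [Real.exp_pos (-4 * R)]
  set w := √(1 - Real.exp (-4 * R))
  set θ := 1 / 3 * Real.arccos (-w) with hθ
  have hθ0 : 0 ≤ θ := by have := Real.arccos_nonneg (-w); positivity
  have hθ1 : θ < Real.pi / 3 := by
    have : Real.arccos (-w) < Real.pi := by
      refine lt_of_le_of_ne (Real.arccos_le_pi _) fun h => ?_
      rw [Real.arccos_eq_pi] at h; linarith
    linarith
  -- The strict bound `w < 1` keeps `θ` below `π/3`; then `2 cos θ > 1 > w`, so the proposed root is
  -- less than `1`.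
  have hc : 1 / 2 < Real.cos θ := by
    rw [← Real.cos_pi_div_three]
    exact Real.cos_lt_cos_of_nonneg_of_le_pi_div_two hθ0 (by linarith [Real.pi_pos]) hθ1
  have h3 : 4 * Real.cos θ ^ 3 - 3 * Real.cos θ = -w := by
    rw [← Real.cos_three_mul, hθ, ← mul_assoc]
    norm_num
    rw [Real.arccos_neg, Real.cos_pi_sub, Real.cos_arccos (by linarith) hw1.le]
  set c := Real.cos θ
  have hc0 : 0 < c := by linarith
  have hr0 : 0 ≤ w / (2 * c) := by positivity
  have hr1 : w / (2 * c) < 1 := by rw [div_lt_one (by positivity)]; linarith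
  refine ((symInfo_eq_iff (by norm_num) hR hr0 hr1).1 ?_).symm
  set r := w / (2 * c) with hr
  have hcub : (1 + r * 2) * (1 - r) ^ 2 = Real.exp (-4 * R) := by
    have hw : w = 3 * c - 4 * c ^ 3 := by linarith
    have hexp : Real.exp (-4 * R) = 1 - w ^ 2 := by linarith
    -- Since `w = 3c - 4c³`, the quotient `w / (2c)` is a polynomial in `c`, and the cubic becomes a
    -- polynomial identity.
    have hr' : r = (3 - 4 * c ^ 2) / 2 := by
      rw [hr, hw]; field_simp
    rw [hexp, hr', hw]; ring
  have hlog := congrArg Real.log hcub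
  rw [Real.log_exp, Real.log_mul (by positivity) (by nlinarith), Real.log_pow] at hlog
  simp only [symInfo]
  push_cast at hlog ⊢
  linarith

/-! ### Correlation matrices -/

open scoped MatrixOrder Matrix in
/-- `det A ≤ det B` for positive definite `A`, `B` such that `tr (B⁻¹ A)` is at most the size. -/
lemma log_det_le_log_det {n : Type*} [Fintype n] [DecidableEq n] {A B : Matrix n n ℝ}
    (hA : A.PosDef) (hB : B.PosDef) (h : (B⁻¹ * A).trace ≤ Fintype.card n) :
    Real.log A.det ≤ Real.log B.det := by
  obtain ⟨C, hC⟩ := CStarAlgebra.nonneg_iff_eq_star_mul_self.mp hB.inv.posSemidef.nonneg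
  have hCdet : C.det ≠ 0 := by
    intro h0
    have := hB.inv.det_pos
    rw [hC, Matrix.det_mul, h0, mul_zero] at this
    exact lt_irrefl _ this
  have hunit : IsUnit C := (Matrix.isUnit_iff_isUnit_det _).2 (isUnit_iff_ne_zero.2 hCdet)
  have hP : (C * A * Cᴴ).PosDef :=
    hA.mul_mul_conjTranspose_same (Matrix.vecMul_injective_of_isUnit hunit)
  have htr : (C * A * Cᴴ).trace = (B⁻¹ * A).trace := by
    rw [Matrix.trace_mul_comm, ← Matrix.mul_assoc, hC, Matrix.star_eq_conjTranspose]
  have hdet : (C * A * Cᴴ).det = B.det⁻¹ * A.det := by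
    have : (B⁻¹).det = B.det⁻¹ := by simp
    rw [← this, hC, Matrix.star_eq_conjTranspose]
    simp only [Matrix.det_mul]; ring
  -- Sum `ln λ ≤ λ - 1` over the eigenvalues.
  have key : Real.log (C * A * Cᴴ).det ≤ (C * A * Cᴴ).trace - Fintype.card n := by
    rw [hP.1.det_eq_prod_eigenvalues, hP.1.trace_eq_sum_eigenvalues]
    simp only [RCLike.ofReal_real_eq_id, id]
    rw [Real.log_prod (fun i _ => (hP.eigenvalues_pos i).ne')]
    calc _ ≤ ∑ i, (hP.1.eigenvalues i - 1) :=
          Finset.sum_le_sum fun i _ => Real.log_le_sub_one_of_pos (hP.eigenvalues_pos i)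
      _ = _ := by simp
  rw [hdet, Real.log_mul (inv_ne_zero hB.det_pos.ne') hA.det_pos.ne', Real.log_inv, htr] at key
  linarith

lemma sum_symMatrix_mul (L : ℕ) (ρ : ℝ) (x : Fin (L + 1) → ℝ) (i : Fin (L + 1)) :
    ∑ j, symMatrix L ρ i j * x j = (1 - ρ) * x i + ρ * ∑ j, x j := by
  have : ∀ j, symMatrix L ρ i j * x j = (if i = j then (1 - ρ) * x j else 0) + ρ * x j := by
    intro j
    simp only [symMatrix, Matrix.of_apply]
    split_ifs <;> ring
  simp [this, Finset.sum_add_distrib, Finset.mul_sum]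

lemma symMatrix_isHermitian (L : ℕ) (ρ : ℝ) : (symMatrix L ρ).IsHermitian := by
  ext i j
  simp [symMatrix, eq_comm]

lemma symMatrix_quadratic (L : ℕ) (ρ : ℝ) (x : Fin (L + 1) → ℝ) :
    star x ⬝ᵥ (symMatrix L ρ).mulVec x = (1 - ρ) * ∑ i, x i ^ 2 + ρ * (∑ i, x i) ^ 2 := by
  have : ∀ i, (symMatrix L ρ).mulVec x i = (1 - ρ) * x i + ρ * ∑ j, x j := fun i =>
    sum_symMatrix_mul L ρ x i
  simp only [dotProduct, this, Pi.star_apply, star_trivial, mul_add, Finset.sum_add_distrib]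
  rw [← Finset.sum_mul]
  congr 1
  · rw [Finset.mul_sum]
    exact Finset.sum_congr rfl fun i _ => by ring
  · ring

/-- The quadratic form is `(1 - ρ) ∑ xᵢ² + ρ (∑ xᵢ)²`. The all-ones vector and the difference of the
first and last basis vectors force the two inequalities. Conversely, Cauchy–Schwarz handles `ρ ≤ 0`.
-/
lemma isCorr_symMatrix_iff {L : ℕ} (hL : 1 ≤ L) (ρ : ℝ) :
    IsCorr (symMatrix L ρ) ↔ -1 / (L : ℝ) < ρ ∧ ρ < 1 := by
  have hL' : (0 : ℝ) < L := by exact_mod_cast hL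
  have hiff : -1 / (L : ℝ) < ρ ↔ 0 < 1 + ρ * L := by
    rw [div_lt_iff₀ hL']; constructor <;> intro h <;> linarith
  rw [hiff]
  constructor
  · rintro ⟨hP, -⟩
    constructor
    · have h := hP.dotProduct_mulVec_pos (x := fun _ => 1) (by
        intro h; simpa using congrFun h 0)
      rw [symMatrix_quadratic] at h
      simp at h
      have : 0 < ((L : ℝ) + 1) * (1 + ρ * L) := by linarith
      exact pos_of_mul_pos_right this (by positivity)
    · have h01 : (0 : Fin (L + 1)) ≠ Fin.last L := by
        intro h; have := congrArg Fin.val h; simp at this; omega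
      have h := hP.dotProduct_mulVec_pos (x := Pi.single 0 1 - Pi.single (Fin.last L) 1) (by
        intro h; simpa [h01] using congrFun h 0)
      rw [symMatrix_quadratic] at h
      have e1 : ∑ i, (Pi.single 0 1 - Pi.single (Fin.last L) 1 : Fin (L + 1) → ℝ) i = 0 := by
        simp
      have e2 : 0 < ∑ i, (Pi.single 0 1 - Pi.single (Fin.last L) 1 : Fin (L + 1) → ℝ) i ^ 2 := by
        refine Finset.sum_pos' (fun i _ => sq_nonneg _) ⟨0, Finset.mem_univ _, ?_⟩
        simp [h01]
      rw [e1] at h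
      have := pos_of_mul_pos_left (by simpa using h) e2.le
      linarith
  · rintro ⟨h0, h1⟩
    refine ⟨Matrix.PosDef.of_dotProduct_mulVec_pos (symMatrix_isHermitian L ρ) fun x hx => ?_,
      fun i => by simp [symMatrix]⟩
    rw [symMatrix_quadratic]
    have hpos : 0 < ∑ i, x i ^ 2 := by
      obtain ⟨i, hi⟩ := Function.ne_iff.1 hx
      exact Finset.sum_pos' (fun i _ => sq_nonneg _) ⟨i, Finset.mem_univ _, by
        have : x i ≠ 0 := hi
        positivity⟩
    have hcs : (∑ i, x i) ^ 2 ≤ (L + 1) * ∑ i, x i ^ 2 := by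
      simpa using sq_sum_le_card_mul_sum_sq (s := Finset.univ) (f := x)
    rcases le_total 0 ρ with h | h
    · have : 0 < (1 - ρ) * ∑ i, x i ^ 2 := mul_pos (by linarith) hpos
      have : 0 ≤ ρ * (∑ i, x i) ^ 2 := by positivity
      linarith
    · have : 0 < (1 + ρ * L) * ∑ i, x i ^ 2 := mul_pos h0 hpos
      nlinarith [mul_le_mul_of_nonpos_left hcs h]

/-- For `ρ ≠ 1` the matrix is `1 - ρ` times a rank-one perturbation of the identity; for `ρ = 1` two
rows coincide. -/
lemma det_symMatrix {L : ℕ} (hL : 1 ≤ L) (ρ : ℝ) :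
    (symMatrix L ρ).det = (1 + ρ * L) * (1 - ρ) ^ L := by
  by_cases h : ρ = 1
  · have h01 : (0 : Fin (L + 1)) ≠ Fin.last L := by
      intro h; have := congrArg Fin.val h; simp at this; omega
    rw [Matrix.det_zero_of_row_eq h01 (by ext j; simp [symMatrix, h]), h, sub_self,
      zero_pow (by omega), mul_zero]
  · have h' : 1 - ρ ≠ 0 := sub_ne_zero.2 (Ne.symm h)
    have e : symMatrix L ρ = (1 - ρ) • ((1 : Matrix (Fin (L + 1)) (Fin (L + 1)) ℝ) +
        Matrix.replicateCol Unit (fun _ : Fin (L + 1) => ρ / (1 - ρ)) *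
          Matrix.replicateRow Unit fun _ : Fin (L + 1) => (1 : ℝ)) := by
      ext i j
      simp only [symMatrix, Matrix.of_apply, Matrix.smul_apply, Matrix.add_apply, Matrix.one_apply,
        Matrix.mul_apply, Matrix.replicateCol_apply, Matrix.replicateRow_apply, smul_eq_mul]
      split_ifs <;> simp <;> field_simp
      ring
    rw [e, Matrix.det_smul, Matrix.det_one_add_replicateCol_mul_replicateRow]
    simp [dotProduct]
    rw [pow_succ]
    field_simp
    ring

/-- Minus the off-diagonal entry of the inverse of `symMatrix L ρ`. -/
def invCoeff (L : ℕ) (ρ : ℝ) : ℝ := ρ / ((1 - ρ) * (1 + ρ * L))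

lemma inv_symMatrix {L : ℕ} {ρ : ℝ} (h0 : 0 < 1 + ρ * L) (h1 : ρ < 1) :
    (symMatrix L ρ)⁻¹ = Matrix.of fun i j =>
      if i = j then 1 + L * ρ * invCoeff L ρ else -invCoeff L ρ := by
  refine Matrix.inv_eq_right_inv ?_
  ext i k
  have h1' : 1 - ρ ≠ 0 := by linarith
  have e : ∑ j : Fin (L + 1), (if j = k then 1 + L * ρ * invCoeff L ρ else -invCoeff L ρ) =
      1 + L * ρ * invCoeff L ρ - L * invCoeff L ρ := by
    rw [Fin.sum_univ_succAbove _ k]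
    simp [Fin.succAbove_ne]
    ring
  simp only [Matrix.mul_apply, Matrix.of_apply]
  rw [sum_symMatrix_mul L ρ (fun j => if j = k then 1 + L * ρ * invCoeff L ρ else -invCoeff L ρ), e,
    Matrix.one_apply]
  unfold invCoeff
  have := h0.ne'
  split_ifs <;> field_simp <;> ring

lemma sum_sum_eq_diag_add_two_mul {n : ℕ} (f : Fin n → Fin n → ℝ) (hf : ∀ i j, f i j = f j i) :
    ∑ i, ∑ j, f i j = ∑ i, f i i + 2 * ∑ i, ∑ j ∈ Finset.Ioi i, f i j := by
  have h := Finset.sum_sum_Ioi_add_eq_sum_sum_off_diag f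
  have e1 : ∀ i, ∑ j, f i j = f i i + ∑ j ∈ {i}ᶜ, f j i := by
    intro i
    rw [Fintype.sum_eq_add_sum_compl i (fun j => f i j)]
    congr 1
    exact Finset.sum_congr rfl fun j _ => hf i j
  rw [Finset.sum_congr rfl fun i _ => e1 i, Finset.sum_add_distrib, ← h]
  simp only [Finset.mul_sum]
  congr 1
  exact Finset.sum_congr rfl fun i _ => Finset.sum_congr rfl fun j _ => by rw [hf j i]; ring

lemma two_mul_sum_Ioi_one (L : ℕ) :
    2 * ∑ i : Fin (L + 1), ∑ _j ∈ Finset.Ioi i, (1 : ℝ) = (L + 1) * L := by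
  have h := sum_sum_eq_diag_add_two_mul (n := L + 1) (fun _ _ => 1) fun _ _ => rfl
  simp only [Finset.sum_const, Finset.card_univ, Fintype.card_fin, nsmul_eq_mul] at h ⊢
  push_cast at h
  linarith

/-- The mean of the off-diagonal entries. -/
def offMean {L : ℕ} (Λ : Matrix (Fin (L + 1)) (Fin (L + 1)) ℝ) : ℝ :=
  2 * (∑ i, ∑ j ∈ Finset.Ioi i, Λ i j) / (L * (L + 1))

lemma two_mul_sum_Ioi_eq {L : ℕ} (hL : 1 ≤ L) (Λ : Matrix (Fin (L + 1)) (Fin (L + 1)) ℝ) :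
    2 * ∑ i, ∑ j ∈ Finset.Ioi i, Λ i j = L * (L + 1) * offMean Λ := by
  have hL' : (0 : ℝ) < L := by exact_mod_cast hL
  unfold offMean
  field_simp

lemma offMean_symMatrix {L : ℕ} (hL : 1 ≤ L) (ρ : ℝ) : offMean (symMatrix L ρ) = ρ := by
  have hL' : (0 : ℝ) < L := by exact_mod_cast hL
  have e : ∑ i, ∑ j ∈ Finset.Ioi i, symMatrix L ρ i j =
      ρ * ∑ i : Fin (L + 1), ∑ _j ∈ Finset.Ioi i, (1 : ℝ) := by
    simp only [Finset.mul_sum]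
    refine Finset.sum_congr rfl fun i _ => Finset.sum_congr rfl fun j hj => ?_
    simp [symMatrix, (Finset.mem_Ioi.1 hj).ne]
  have h := two_mul_sum_Ioi_one L
  unfold offMean
  rw [e, mul_left_comm, h]
  field_simp

/-- Only the mean correlation enters the distance, so averaging the off-diagonal entries leaves it
unchanged. -/
lemma distForm_eq_symDist (S σ : ℝ) {L : ℕ} (hL : 1 ≤ L)
    (Λ : Matrix (Fin (L + 1)) (Fin (L + 1)) ℝ) :
    distForm S σ Λ = symDist S σ L (offMean Λ) := by
  have hL' : (0 : ℝ) < L := by exact_mod_cast hL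
  have h := two_mul_sum_Ioi_eq hL Λ
  have e : 2 / (L : ℝ) * ∑ i, ∑ j ∈ Finset.Ioi i, Λ i j = (L + 1) * offMean Λ := by
    rw [div_mul_eq_mul_div, h]; field_simp
  unfold distForm symDist
  rw [e]
  field_simp

lemma IsCorr.symm {L : ℕ} {Λ : Matrix (Fin (L + 1)) (Fin (L + 1)) ℝ} (h : IsCorr Λ)
    (i j : Fin (L + 1)) : Λ i j = Λ j i := by
  have := h.1.1.apply j i
  simpa using this

lemma IsCorr.sum_eq {L : ℕ} (hL : 1 ≤ L) {Λ : Matrix (Fin (L + 1)) (Fin (L + 1)) ℝ}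
    (h : IsCorr Λ) : ∑ i, ∑ j, Λ i j = (L + 1) * (1 + offMean Λ * L) := by
  rw [sum_sum_eq_diag_add_two_mul _ h.symm, two_mul_sum_Ioi_eq hL Λ]
  simp [h.2]
  ring

lemma IsCorr.lt_one {L : ℕ} {Λ : Matrix (Fin (L + 1)) (Fin (L + 1)) ℝ} (h : IsCorr Λ)
    {i j : Fin (L + 1)} (hij : i ≠ j) : Λ i j < 1 := by
  have hx := h.1.dotProduct_mulVec_pos (x := Pi.single i 1 - Pi.single j 1) (by
    intro h0; simpa [hij] using congrFun h0 i)
  simp [Matrix.mulVec_sub, sub_dotProduct, dotProduct_sub, h.2, h.symm j i] at hx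
  linarith

lemma IsCorr.neg_one_lt {L : ℕ} {Λ : Matrix (Fin (L + 1)) (Fin (L + 1)) ℝ} (h : IsCorr Λ)
    {i j : Fin (L + 1)} (hij : i ≠ j) : -1 < Λ i j := by
  have hx := h.1.dotProduct_mulVec_pos (x := Pi.single i 1 + Pi.single j 1) (by
    intro h0; simpa [hij] using congrFun h0 i)
  simp [Matrix.mulVec_add, add_dotProduct, dotProduct_add, h.2, h.symm j i] at hx
  linarith

lemma IsCorr.abs_le_one {L : ℕ} {Λ : Matrix (Fin (L + 1)) (Fin (L + 1)) ℝ} (h : IsCorr Λ)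
    (i j : Fin (L + 1)) : |Λ i j| ≤ 1 := by
  by_cases hij : i = j
  · rw [hij, h.2, abs_one]
  · exact abs_le.2 ⟨(h.neg_one_lt hij).le, (h.lt_one hij).le⟩

lemma IsCorr.offMean_mem {L : ℕ} (hL : 1 ≤ L) {Λ : Matrix (Fin (L + 1)) (Fin (L + 1)) ℝ}
    (h : IsCorr Λ) : -1 / (L : ℝ) < offMean Λ ∧ offMean Λ < 1 := by
  have hL' : (0 : ℝ) < L := by exact_mod_cast hL
  constructor
  · have hx := h.1.dotProduct_mulVec_pos (x := fun _ => 1) (by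
      intro h0; simpa using congrFun h0 0)
    simp [dotProduct, Matrix.mulVec] at hx
    rw [h.sum_eq hL] at hx
    have := pos_of_mul_pos_right hx (by positivity)
    rw [div_lt_iff₀ hL']
    linarith
  · have hlt : ∑ i, ∑ j ∈ Finset.Ioi i, Λ i j <
        ∑ i : Fin (L + 1), ∑ _j ∈ Finset.Ioi i, (1 : ℝ) := by
      have hle : ∀ i : Fin (L + 1), ∀ j ∈ Finset.Ioi i, Λ i j < 1 := fun i j hj =>
        h.lt_one (Finset.mem_Ioi.1 hj).ne
      refine Finset.sum_lt_sum (fun i _ => Finset.sum_le_sum fun j hj => (hle i j hj).le)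
        ⟨0, Finset.mem_univ _, Finset.sum_lt_sum_of_nonempty ⟨Fin.last L, ?_⟩ (hle 0)⟩
      rw [Finset.mem_Ioi, Fin.lt_def]
      simpa using Nat.pos_of_ne_zero (by omega)
    have e := two_mul_sum_Ioi_one L
    unfold offMean
    rw [div_lt_one (by positivity)]
    linarith

lemma symInfo_eq_log_det {L : ℕ} (hL : 1 ≤ L) {ρ : ℝ} (h0 : -1 / (L : ℝ) < ρ) (h1 : ρ < 1) :
    symInfo L ρ = -(1 / 2) * Real.log (symMatrix L ρ).det := by
  have hL' : (0 : ℝ) < L := by exact_mod_cast hL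
  rw [div_lt_iff₀ hL'] at h0
  have e1 : 1 + ρ * L ≠ 0 := by linarith
  have e2 : (1 - ρ) ^ L ≠ 0 := pow_ne_zero _ (by linarith)
  rw [det_symMatrix hL, Real.log_mul e1 e2, Real.log_pow]
  unfold symInfo
  ring

/-- Hadamard's inequality, as the comparison of determinants with `B = 1`. -/
lemma IsCorr.log_det_nonpos {L : ℕ} {Λ : Matrix (Fin (L + 1)) (Fin (L + 1)) ℝ} (h : IsCorr Λ) :
    Real.log Λ.det ≤ 0 := by
  have := log_det_le_log_det h.1 Matrix.PosDef.one (by simp [Matrix.trace, h.2])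
  simpa using this

/-- Symmetrisation decreases the multi-information. -/
lemma IsCorr.symInfo_offMean_le {L : ℕ} (hL : 1 ≤ L) {Λ : Matrix (Fin (L + 1)) (Fin (L + 1)) ℝ}
    (h : IsCorr Λ) : symInfo L (offMean Λ) ≤ -(1 / 2) * Real.log Λ.det := by
  have hL' : (0 : ℝ) < L := by exact_mod_cast hL
  obtain ⟨h0, h1⟩ := h.offMean_mem hL
  have hpos : 0 < 1 + offMean Λ * L := by
    rw [div_lt_iff₀ hL'] at h0; linarith
  rw [symInfo_eq_log_det hL h0 h1]
  -- The inverse of the symmetric matrix is constant on and off the diagonal, so its trace against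
  -- `Λ` sees only the unit diagonal and the mean correlation, and equals `L + 1`.
  have := log_det_le_log_det h.1 ((isCorr_symMatrix_iff hL _).2 ⟨h0, h1⟩).1 (by
    rw [inv_symMatrix hpos h1]
    set ρ := offMean Λ
    set a := invCoeff L ρ
    have e : ∀ i, (∑ j, (if i = j then 1 + L * ρ * a else -a) * Λ j i) =
        (1 + L * ρ * a + a) - a * ∑ j, Λ j i := by
      intro i
      have : ∀ j, (if i = j then 1 + L * ρ * a else -a) * Λ j i =
          (if i = j then (1 + L * ρ * a + a) * Λ j i else 0) - a * Λ j i := by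
        intro j; split_ifs <;> ring
      simp [this, Finset.sum_sub_distrib, Finset.mul_sum, h.2]
    simp only [Matrix.trace, Matrix.diag, Matrix.mul_apply, Matrix.of_apply, e,
      Finset.sum_sub_distrib, ← Finset.mul_sum]
    rw [Finset.sum_comm, h.sum_eq hL]
    simp
    apply le_of_eq
    ring)
  linarith

/-- The infimum over correlation matrices reduces to the totally symmetric ones. -/
lemma isLeast_corr_of_isLeast_symmetric {S σ : ℝ} {L : ℕ} (hL : 1 ≤ L) {R e₀ : ℝ}
    (h : IsLeast {e | ∃ ρ : ℝ, -1 / (L : ℝ) < ρ ∧ ρ < 1 ∧ symInfo L ρ ≤ L * R ∧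
        e = symDist S σ L ρ + symInfo L ρ - L * R} e₀) :
    IsLeast {e | ∃ Λ : Matrix (Fin (L + 1)) (Fin (L + 1)) ℝ, IsCorr Λ ∧
        -(1 / 2) * Real.log Λ.det ≤ L * R ∧
        e = distForm S σ Λ - 1 / 2 * Real.log Λ.det - L * R} e₀ := by
  constructor
  · obtain ⟨ρ, h0, h1, hI, rfl⟩ := h.1
    refine ⟨symMatrix L ρ, (isCorr_symMatrix_iff hL ρ).2 ⟨h0, h1⟩, ?_, ?_⟩
    · rwa [← symInfo_eq_log_det hL h0 h1]
    · rw [distForm_eq_symDist S σ hL, offMean_symMatrix hL, symInfo_eq_log_det hL h0 h1]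
      ring
  · rintro e ⟨Λ, hΛ, hI, rfl⟩
    obtain ⟨h0, h1⟩ := hΛ.offMean_mem hL
    have hle := hΛ.symInfo_offMean_le hL
    refine (h.2 ⟨offMean Λ, h0, h1, hle.trans hI, rfl⟩).trans ?_
    rw [distForm_eq_symDist S σ hL]
    linarith

/-! ### The distance of the Gaussian channel -/

lemma toNNReal_ne_zero {v : ℝ} (hv : 0 < v) : v.toNNReal ≠ 0 := by
  simpa [Real.toNNReal_eq_zero] using hv

lemma gaussianPDFReal_toNNReal {v : ℝ} (hv : 0 < v) (m y : ℝ) :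
    gaussianPDFReal m v.toNNReal y =
      (√(2 * Real.pi * v))⁻¹ * Real.exp (-(y - m) ^ 2 / (2 * v)) := by
  rw [gaussianPDFReal, Real.coe_toNNReal _ hv.le]

lemma sum_sq_sub_sq_mean {L : ℕ} (hL : 1 ≤ L) (x : Fin (L + 1) → ℝ) :
    (∑ i, x i ^ 2) / (L + 1) - ((∑ i, x i) / (L + 1)) ^ 2 =
      L / (L + 1) ^ 2 * (∑ i, x i ^ 2 - 2 / L * ∑ i, ∑ j ∈ Finset.Ioi i, x i * x j) := by
  have hL' : (0 : ℝ) < L := by exact_mod_cast hL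
  have h := sum_sum_eq_diag_add_two_mul (fun i j => x i * x j) fun i j => mul_comm _ _
  rw [← Finset.sum_mul_sum] at h
  have e : (∑ i, x i) ^ 2 = ∑ i, x i ^ 2 + 2 * ∑ i, ∑ j ∈ Finset.Ioi i, x i * x j := by
    rw [sq, h]; simp [sq]
  rw [div_pow, e]
  field_simp
  ring

/-- The geometric mean of Gaussian densities is a multiple of a Gaussian density. -/
lemma prod_gaussianPDFReal_rpow {v : ℝ} (hv : 0 < v) {L : ℕ} (x : Fin (L + 1) → ℝ) (y : ℝ) :
    ∏ i, gaussianPDFReal (x i) v.toNNReal y ^ ((1 : ℝ) / (L + 1)) =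
      Real.exp (-((∑ i, x i ^ 2) / (L + 1) - ((∑ i, x i) / (L + 1)) ^ 2) / (2 * v)) *
        gaussianPDFReal ((∑ i, x i) / (L + 1)) v.toNNReal y := by
  have hL : (0 : ℝ) < L + 1 := by positivity
  have hc : 0 < (√(2 * Real.pi * v))⁻¹ := by positivity
  have e : ∀ i, gaussianPDFReal (x i) v.toNNReal y ^ ((1 : ℝ) / (L + 1)) =
      ((√(2 * Real.pi * v))⁻¹) ^ ((1 : ℝ) / (L + 1)) *
        Real.exp (-(y - x i) ^ 2 / (2 * v) * (1 / (L + 1))) := by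
    intro i
    rw [gaussianPDFReal_toNNReal hv, Real.mul_rpow hc.le (Real.exp_nonneg _), ← Real.exp_mul]
  rw [Finset.prod_congr rfl fun i _ => e i, Finset.prod_mul_distrib, ← Real.exp_sum,
    Finset.prod_const, Finset.card_univ, Fintype.card_fin, ← Real.rpow_mul_natCast hc.le,
    gaussianPDFReal_toNNReal hv]
  have e1 : (1 : ℝ) / (L + 1) * ((L + 1 : ℕ) : ℝ) = 1 := by push_cast; field_simp
  rw [e1, Real.rpow_one, mul_left_comm, ← Real.exp_add]
  congr 2
  have e2 : ∑ i, -(y - x i) ^ 2 / (2 * v) * (1 / (L + 1)) =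
      -((L + 1) * y ^ 2 - 2 * y * ∑ i, x i + ∑ i, x i ^ 2) / (2 * v) * (1 / (L + 1)) := by
    rw [← Finset.sum_mul, ← Finset.sum_div]
    congr 2
    have : ∀ i, -(y - x i) ^ 2 = -y ^ 2 + 2 * y * x i - x i ^ 2 := fun i => by ring
    simp only [this, Finset.sum_sub_distrib, Finset.sum_add_distrib, ← Finset.mul_sum]
    simp
    ring
  rw [e2]
  field_simp
  ring

lemma integral_prod_gaussianPDFReal_rpow {v : ℝ} (hv : 0 < v) {L : ℕ} (x : Fin (L + 1) → ℝ) :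
    ∫ y, ∏ i, gaussianPDFReal (x i) v.toNNReal y ^ ((1 : ℝ) / (L + 1)) =
      Real.exp (-((∑ i, x i ^ 2) / (L + 1) - ((∑ i, x i) / (L + 1)) ^ 2) / (2 * v)) := by
  simp only [prod_gaussianPDFReal_rpow hv]
  rw [integral_const_mul, integral_gaussianPDFReal_eq_one _ (toNNReal_ne_zero hv), mul_one]

lemma bhatt_eq_variance {σ : ℝ} (hσ : 0 < σ) {L : ℕ} (x : Fin (L + 1) → ℝ) :
    bhatt σ x = ((∑ i, x i ^ 2) / (L + 1) - ((∑ i, x i) / (L + 1)) ^ 2) / (2 * σ ^ 2) := by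
  unfold bhatt
  rw [integral_prod_gaussianPDFReal_rpow (by positivity), Real.log_exp]
  ring

lemma bhatt_eq {σ : ℝ} (hσ : 0 < σ) {L : ℕ} (hL : 1 ≤ L) (x : Fin (L + 1) → ℝ) :
    bhatt σ x = L / (2 * σ ^ 2 * (L + 1) ^ 2) *
      (∑ i, x i ^ 2 - 2 / L * ∑ i, ∑ j ∈ Finset.Ioi i, x i * x j) := by
  rw [bhatt_eq_variance hσ, sum_sq_sub_sq_mean hL]
  field_simp

lemma integral_prod_gaussianPDFReal_rpow_eq_exp_bhatt {σ : ℝ} (hσ : 0 < σ) {L : ℕ}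
    (x : Fin (L + 1) → ℝ) :
    ∫ y, ∏ i, gaussianPDFReal (x i) (σ ^ 2).toNNReal y ^ ((1 : ℝ) / (L + 1)) =
      Real.exp (-bhatt σ x) := by
  rw [bhatt_eq_variance hσ, integral_prod_gaussianPDFReal_rpow (by positivity)]
  congr 1
  ring

lemma sum_bhatt_eq {S σ : ℝ} (hS : 0 < S) (hσ : 0 < σ) {L : ℕ} (hL : 1 ≤ L) {n : ℕ} (hn : 1 ≤ n)
    (x : Fin (L + 1) → Fin n → ℝ) (hx : ∀ i, OnSphere S (x i)) :
    ∑ t, bhatt σ (fun i => x i t) =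
      n * distForm S σ (Matrix.of fun i j => empCorr S (x i) (x j)) := by
  have hL' : (0 : ℝ) < L := by exact_mod_cast hL
  have hn' : (0 : ℝ) < n := by exact_mod_cast hn
  have e1 : ∑ t, ∑ i, x i t ^ 2 = (L + 1) * (n * S) := by
    rw [Finset.sum_comm, Finset.sum_congr rfl fun i _ => hx i]
    simp
  have e2 : ∑ t, ∑ i, ∑ j ∈ Finset.Ioi i, x i t * x j t =
      n * S * ∑ i, ∑ j ∈ Finset.Ioi i, empCorr S (x i) (x j) := by
    rw [Finset.sum_comm, Finset.mul_sum]
    refine Finset.sum_congr rfl fun i _ => ?_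
    rw [Finset.sum_comm, Finset.mul_sum]
    refine Finset.sum_congr rfl fun j _ => ?_
    unfold empCorr
    field_simp
  rw [Finset.sum_congr rfl fun t _ => bhatt_eq hσ hL _, ← Finset.mul_sum, Finset.sum_sub_distrib,
    ← Finset.mul_sum, e1, e2, distForm]
  simp only [Matrix.of_apply]
  field_simp

/-! ### Products of measures with densities -/

lemma lintegral_fin_prod_eq_prod {n : ℕ} {E : Type*} [MeasurableSpace E]
    {μ : Fin n → Measure E} [∀ i, SigmaFinite (μ i)] {f : Fin n → E → ENNReal}
    (hf : ∀ i, Measurable (f i)) :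
    ∫⁻ x, ∏ i, f i (x i) ∂Measure.pi μ = ∏ i, ∫⁻ x, f i x ∂μ i := by
  induction n with
  | zero => simp
  | succ n ih =>
    rw [← ((measurePreserving_piFinSuccAbove μ 0).symm).lintegral_comp_emb
      (MeasurableEquiv.measurableEmbedding _)]
    simp_rw [MeasurableEquiv.piFinSuccAbove_symm_apply, Fin.insertNthEquiv,
      Fin.prod_univ_succ, Fin.insertNth_zero, Equiv.coe_fn_mk, Fin.cons_succ,
      Fin.zero_succAbove, cast_eq, Fin.cons_zero]
    rw [lintegral_prod_mul (f := f 0) (g := fun y : Fin n → E => ∏ i, f i.succ (y i))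
      (hf 0).aemeasurable (Measurable.aemeasurable (by fun_prop)), ih fun i => hf i.succ]

lemma pi_withDensity {n : ℕ} {E : Type*} [MeasurableSpace E]
    {μ : Fin n → Measure E} [∀ i, SigmaFinite (μ i)] {f : Fin n → E → ENNReal}
    (hf : ∀ i, Measurable (f i)) [∀ i, SigmaFinite ((μ i).withDensity (f i))] :
    Measure.pi (fun i => (μ i).withDensity (f i)) =
      (Measure.pi μ).withDensity fun x => ∏ i, f i (x i) := by
  refine Measure.pi_eq fun s hs => ?_
  rw [withDensity_apply _ (MeasurableSet.univ_pi hs), Measure.restrict_pi_pi,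
    lintegral_fin_prod_eq_prod hf]
  exact Finset.prod_congr rfl fun i _ => (withDensity_apply _ (hs i)).symm

lemma pi_gaussianReal {n : ℕ} {v : ℝ} (hv : 0 < v) (m : Fin n → ℝ) :
    Measure.pi (fun i => gaussianReal (m i) v.toNNReal) =
      (volume : Measure (Fin n → ℝ)).withDensity fun x =>
        ENNReal.ofReal (∏ i, gaussianPDFReal (m i) v.toNNReal (x i)) := by
  have : ∀ i, gaussianReal (m i) v.toNNReal =
      (volume : Measure ℝ).withDensity (gaussianPDF (m i) v.toNNReal) := fun i =>
    gaussianReal_of_var_ne_zero _ (toNNReal_ne_zero hv)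
  have hsf : ∀ i, SigmaFinite ((volume : Measure ℝ).withDensity (gaussianPDF (m i) v.toNNReal)) := by
    intro i; rw [← this i]; infer_instance
  simp only [this]
  rw [pi_withDensity fun i => measurable_gaussianPDF _ _, ← volume_pi]
  congr 1
  ext x
  rw [ENNReal.ofReal_prod_of_nonneg fun i _ => gaussianPDFReal_nonneg _ _ _]
  rfl

/-! ### The density of the Gaussian law -/

/-- The density of the centred Gaussian law with covariance `S Λ` relative to the product of its
marginals. -/
def gaussRatio {L : ℕ} (S : ℝ) (Λ : Matrix (Fin (L + 1)) (Fin (L + 1)) ℝ) (x : Fin (L + 1) → ℝ) :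
    ℝ :=
  (√Λ.det)⁻¹ * Real.exp ((∑ i, x i ^ 2 - ∑ i, ∑ j, Λ⁻¹ i j * (x i * x j)) / (2 * S))

lemma gaussRatio_pos {L : ℕ} (S : ℝ) {Λ : Matrix (Fin (L + 1)) (Fin (L + 1)) ℝ} (hΛ : Λ.PosDef)
    (x : Fin (L + 1) → ℝ) : 0 < gaussRatio S Λ x := by
  have := hΛ.det_pos
  unfold gaussRatio; positivity

@[fun_prop]
lemma measurable_gaussRatio {L : ℕ} (S : ℝ) (Λ : Matrix (Fin (L + 1)) (Fin (L + 1)) ℝ) :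
    Measurable (gaussRatio S Λ) := by
  unfold gaussRatio; fun_prop

open scoped MatrixOrder in
lemma gaussLaw_eq_map {L : ℕ} (S : ℝ) (Λ : Matrix (Fin (L + 1)) (Fin (L + 1)) ℝ) :
    gaussLaw S Λ = (Measure.pi fun _ : Fin (L + 1) => gaussianReal 0 1).map
      (Matrix.toLin' (CFC.sqrt (S • Λ))) := by
  unfold gaussLaw multivariateGaussian
  rw [← map_pi_eq_stdGaussian, Measure.map_map (by fun_prop) (by fun_prop),
    Measure.map_map (by fun_prop) (by fun_prop)]
  congr 1
  ext x i
  simp [Matrix.toLin'_apply]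

-- Linear change of variables `A = √(SΛ)` in the standard Gaussian density: the Jacobian produces
-- `|Λ|^{-1/2}`, and `|A⁻¹ x|² = xᵀ Λ⁻¹ x / S` since `A⁻¹` is symmetric with square `(SΛ)⁻¹`.
open scoped MatrixOrder in
lemma gaussLaw_eq_withDensity {L : ℕ} {S : ℝ} (hS : 0 < S)
    {Λ : Matrix (Fin (L + 1)) (Fin (L + 1)) ℝ} (hΛ : Λ.PosDef) :
    gaussLaw S Λ = (Measure.pi fun _ : Fin (L + 1) => gaussianReal 0 S.toNNReal).withDensity
      fun x => ENNReal.ofReal (gaussRatio S Λ x) := by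
  have hSΛ : (S • Λ).PosDef := hΛ.smul hS
  set A := CFC.sqrt (S • Λ) with hA
  have hdet : A.det = √(S ^ (L + 1) * Λ.det) := by
    rw [hA, hSΛ.posSemidef.det_sqrt, RCLike.sqrt_of_nonneg hSΛ.posSemidef.det_nonneg,
      Matrix.det_smul]
    simp
  have hΛd := hΛ.det_pos
  have hdpos : 0 < A.det := by rw [hdet]; positivity
  have hunit : IsUnit A.det := isUnit_iff_ne_zero.2 hdpos.ne'
  have hpdf1 : ∀ x : Fin (L + 1) → ℝ, ∏ i, gaussianPDFReal 0 (1 : ℝ).toNNReal (x i) =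
      ((√(2 * Real.pi))⁻¹) ^ (L + 1) * Real.exp (-(∑ i, x i ^ 2) / 2) := by
    intro x
    simp only [gaussianPDFReal_toNNReal one_pos, Finset.prod_mul_distrib, ← Real.exp_sum]
    simp [Finset.sum_div, neg_div]
  have hpdfS : ∀ x : Fin (L + 1) → ℝ, ∏ i, gaussianPDFReal 0 S.toNNReal (x i) =
      ((√(2 * Real.pi * S))⁻¹) ^ (L + 1) * Real.exp (-(∑ i, x i ^ 2) / (2 * S)) := by
    intro x
    simp only [gaussianPDFReal_toNNReal hS, Finset.prod_mul_distrib, ← Real.exp_sum]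
    simp [Finset.sum_div, neg_div]
  have hq : ∀ x : Fin (L + 1) → ℝ, ∑ i, (A⁻¹.mulVec x) i ^ 2 =
      (∑ i, ∑ j, Λ⁻¹ i j * (x i * x j)) / S := by
    intro x
    have hAinv : A⁻¹ = CFC.sqrt (S • Λ)⁻¹ := by rw [hA, hSΛ.posSemidef.inv_sqrt]
    have hsymm : A⁻¹.transpose = A⁻¹ := by
      have h := (Matrix.nonneg_iff_posSemidef.1 (CFC.sqrt_nonneg (S • Λ)⁻¹)).1
      rw [← hAinv] at h
      simpa [Matrix.IsHermitian, Matrix.conjTranspose_eq_transpose_of_trivial] using h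
    have hsq : A⁻¹ * A⁻¹ = S⁻¹ • Λ⁻¹ := by
      rw [hAinv, CFC.sqrt_mul_sqrt_self _ hSΛ.inv.posSemidef.nonneg]
      refine Matrix.inv_eq_right_inv ?_
      rw [Matrix.smul_mul, Matrix.mul_smul, Matrix.mul_nonsing_inv _ (isUnit_iff_ne_zero.2 hΛd.ne'),
        smul_smul, mul_inv_cancel₀ hS.ne', one_smul]
    calc ∑ i, (A⁻¹.mulVec x) i ^ 2 = A⁻¹.mulVec x ⬝ᵥ A⁻¹.mulVec x := by
          simp [dotProduct, sq]
      _ = x ⬝ᵥ (A⁻¹ * A⁻¹).mulVec x := by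
          rw [← Matrix.mulVec_mulVec, Matrix.dotProduct_mulVec x, ← Matrix.mulVec_transpose, hsymm]
      _ = _ := by
          rw [hsq]
          simp only [dotProduct, Matrix.mulVec, Matrix.smul_apply, smul_eq_mul, Finset.mul_sum,
            Finset.sum_div]
          exact Finset.sum_congr rfl fun i _ => Finset.sum_congr rfl fun j _ => by
            field_simp
  rw [gaussLaw_eq_map, ← hA, pi_gaussianReal hS,
    ← withDensity_mul _ (by fun_prop) (measurable_gaussRatio S Λ).ennreal_ofReal]
  have h1 := pi_gaussianReal (n := L + 1) one_pos fun _ => 0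
  rw [Real.toNNReal_one] at h1 hpdf1
  rw [h1]
  have hTm : Measurable (Matrix.toLin' A) := by
    exact (LinearMap.continuous_of_finiteDimensional _).measurable
  set G : (Fin (L + 1) → ℝ) → ENNReal := fun x =>
    ENNReal.ofReal (∏ i, gaussianPDFReal 0 1 ((A⁻¹.mulVec x) i)) with hG
  have hGm : Measurable G := by
    have : Measurable fun x : Fin (L + 1) → ℝ => A⁻¹.mulVec x :=
      (LinearMap.continuous_of_finiteDimensional (Matrix.toLin' A⁻¹)).measurable
    fun_prop
  ext s hs
  rw [Measure.map_apply hTm hs, withDensity_apply _ (hTm hs), withDensity_apply _ hs]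
  have hcomp : ∀ x, ENNReal.ofReal (∏ i, gaussianPDFReal 0 1 (x i)) = G (Matrix.toLin' A x) := by
    intro x
    simp only [hG, Matrix.toLin'_apply, Matrix.mulVec_mulVec, Matrix.nonsing_inv_mul _ hunit,
      Matrix.one_mulVec]
  simp only [hcomp]
  rw [← setLIntegral_map hs hGm hTm, Real.map_matrix_volume_pi_eq_smul_volume_pi hdpos.ne',
    Measure.restrict_smul, lintegral_smul_measure, smul_eq_mul, ← lintegral_const_mul _ hGm]
  refine lintegral_congr fun x => ?_
  simp only [Pi.mul_apply, hG]
  rw [← ENNReal.ofReal_mul (abs_nonneg _), ← ENNReal.ofReal_mul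
    (Finset.prod_nonneg fun i _ => gaussianPDFReal_nonneg _ _ _), hpdf1, hpdfS, hq]
  congr 1
  have e1 : |A.det⁻¹| = ((√S)⁻¹) ^ (L + 1) * (√Λ.det)⁻¹ := by
    rw [abs_of_pos (by positivity), hdet, Real.sqrt_mul (by positivity), mul_inv, inv_pow]
    congr 2
    rw [Real.sqrt_eq_iff_eq_sq (by positivity) (by positivity), ← pow_mul, mul_comm, pow_mul,
      Real.sq_sqrt hS.le]
  have e2 : (√(2 * Real.pi * S))⁻¹ = (√(2 * Real.pi))⁻¹ * (√S)⁻¹ := by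
    rw [Real.sqrt_mul (by positivity), mul_inv]
  rw [e1, e2, mul_pow, gaussRatio]
  have e3 : Real.exp (-((∑ i, ∑ j, Λ⁻¹ i j * (x i * x j)) / S) / 2) =
      Real.exp (-(∑ i, x i ^ 2) / (2 * S)) *
      Real.exp ((∑ i, x i ^ 2 - ∑ i, ∑ j, Λ⁻¹ i j * (x i * x j)) / (2 * S)) := by
    rw [← Real.exp_add]
    congr 1
    field_simp
    ring
  rw [e3]
  ring

/-! ### Moments of the Gaussian law and the multi-information -/

instance {L : ℕ} (S : ℝ) (Λ : Matrix (Fin (L + 1)) (Fin (L + 1)) ℝ) :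
    IsProbabilityMeasure (gaussLaw S Λ) :=
  Measure.isProbabilityMeasure_map (MeasurableEquiv.measurable _).aemeasurable

lemma gaussLaw_measurePreserving_eval {L : ℕ} {S : ℝ} (hS : 0 < S)
    {Λ : Matrix (Fin (L + 1)) (Fin (L + 1)) ℝ} (hΛ : IsCorr Λ) (i : Fin (L + 1)) :
    MeasurePreserving (fun x => x i) (gaussLaw S Λ) (gaussianReal 0 S.toNNReal) := by
  have h := measurePreserving_eval_multivariateGaussian (μ := 0) (hΛ.1.smul hS).posSemidef (i := i)
  refine ⟨by fun_prop, ?_⟩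
  unfold gaussLaw
  rw [Measure.map_map (by fun_prop) (MeasurableEquiv.measurable _)]
  have e := h.map_eq
  simp only [Matrix.smul_apply, hΛ.2, smul_eq_mul, mul_one, PiLp.zero_apply] at e
  exact e

lemma gaussLaw_memLp_eval {L : ℕ} {S : ℝ} (hS : 0 < S)
    {Λ : Matrix (Fin (L + 1)) (Fin (L + 1)) ℝ} (hΛ : IsCorr Λ) (i : Fin (L + 1)) (p : NNReal) :
    MemLp (fun x : Fin (L + 1) → ℝ => x i) p (gaussLaw S Λ) :=
  (memLp_id_gaussianReal p).comp_measurePreserving (gaussLaw_measurePreserving_eval hS hΛ i)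

lemma gaussLaw_memLp_mul {L : ℕ} {S : ℝ} (hS : 0 < S)
    {Λ : Matrix (Fin (L + 1)) (Fin (L + 1)) ℝ} (hΛ : IsCorr Λ) (i j : Fin (L + 1)) :
    MemLp (fun x : Fin (L + 1) → ℝ => x i * x j) 2 (gaussLaw S Λ) := by
  -- Finite fourth moments place the product in `L²`, as needed for Chebyshev's inequality.
  have : ENNReal.HolderTriple (4 : NNReal) (4 : NNReal) 2 := ⟨by
    rw [← two_mul]
    have : ((4 : NNReal) : ENNReal) = 2 * 2 := by norm_num
    rw [this, ENNReal.mul_inv (by simp) (by simp), ← mul_assoc,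
      ENNReal.mul_inv_cancel (by simp) (by simp), one_mul]⟩
  exact (gaussLaw_memLp_eval hS hΛ j 4).mul (gaussLaw_memLp_eval hS hΛ i 4)

lemma gaussLaw_integrable_mul {L : ℕ} {S : ℝ} (hS : 0 < S)
    {Λ : Matrix (Fin (L + 1)) (Fin (L + 1)) ℝ} (hΛ : IsCorr Λ) (i j : Fin (L + 1)) :
    Integrable (fun x : Fin (L + 1) → ℝ => x i * x j) (gaussLaw S Λ) :=
  (gaussLaw_memLp_mul hS hΛ i j).integrable (by norm_num)

lemma gaussLaw_integral_mul {L : ℕ} {S : ℝ} (hS : 0 < S)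
    {Λ : Matrix (Fin (L + 1)) (Fin (L + 1)) ℝ} (hΛ : IsCorr Λ) (i j : Fin (L + 1)) :
    ∫ x, x i * x j ∂gaussLaw S Λ = S * Λ i j := by
  have hSΛ := (hΛ.1.smul hS).posSemidef
  have h := covariance_eval_multivariateGaussian (μ := 0) hSΛ i j
  have hm : ∀ k, MemLp (fun x : EuclideanSpace ℝ (Fin (L + 1)) => x k) 2
      (multivariateGaussian 0 (S • Λ)) := fun k =>
    (memLp_id_gaussianReal 2).comp_measurePreserving
      (measurePreserving_eval_multivariateGaussian hSΛ (i := k))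
  have h0 : ∫ x, x i ∂(multivariateGaussian 0 (S • Λ)) = 0 := by
    have e := measurePreserving_eval_multivariateGaussian (μ := 0) hSΛ (i := i)
    have e2 : ∫ y, y ∂(Measure.map (fun x : EuclideanSpace ℝ (Fin (L + 1)) => x i)
        (multivariateGaussian 0 (S • Λ))) = 0 := by
      rw [e.map_eq]; simp
    rwa [integral_map e.measurable.aemeasurable (by fun_prop)] at e2
  rw [covariance_eq_sub (hm i) (hm j), h0, zero_mul, sub_zero] at h
  unfold gaussLaw
  rw [integral_map_equiv]
  exact h

/-- Both sums have mean `S (L + 1)`: the first because the diagonal is one, the second because it is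
`S tr (Λ⁻¹ Λ)`. -/
lemma integral_quadratic_gaussLaw {L : ℕ} {S : ℝ} (hS : 0 < S)
    {Λ : Matrix (Fin (L + 1)) (Fin (L + 1)) ℝ} (hΛ : IsCorr Λ) :
    Integrable (fun x : Fin (L + 1) → ℝ => ∑ i, x i ^ 2 - ∑ i, ∑ j, Λ⁻¹ i j * (x i * x j))
      (gaussLaw S Λ) ∧
    ∫ x, (∑ i, x i ^ 2 - ∑ i, ∑ j, Λ⁻¹ i j * (x i * x j)) ∂gaussLaw S Λ = 0 := by
  have hi1 : ∀ i, Integrable (fun x : Fin (L + 1) → ℝ => x i ^ 2) (gaussLaw S Λ) := fun i => by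
    simpa only [sq] using gaussLaw_integrable_mul hS hΛ i i
  have hi2 : ∀ i j, Integrable (fun x : Fin (L + 1) → ℝ => Λ⁻¹ i j * (x i * x j)) (gaussLaw S Λ) :=
    fun i j => (gaussLaw_integrable_mul hS hΛ i j).const_mul _
  have hI1 : Integrable (fun x : Fin (L + 1) → ℝ => ∑ i, x i ^ 2) (gaussLaw S Λ) :=
    integrable_finsetSum _ fun i _ => hi1 i
  have hI2 : Integrable (fun x : Fin (L + 1) → ℝ => ∑ i, ∑ j, Λ⁻¹ i j * (x i * x j))
      (gaussLaw S Λ) := integrable_finsetSum _ fun i _ => integrable_finsetSum _ fun j _ => hi2 i j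
  refine ⟨hI1.sub hI2, ?_⟩
  rw [integral_sub hI1 hI2, integral_finsetSum _ fun i _ => hi1 i,
    integral_finsetSum _ fun i _ => integrable_finsetSum _ fun j _ => hi2 i j]
  have e1 : ∀ i, ∫ x : Fin (L + 1) → ℝ, x i ^ 2 ∂gaussLaw S Λ = S := fun i => by
    simp only [sq]; rw [gaussLaw_integral_mul hS hΛ, hΛ.2, mul_one]
  have e2 : ∀ i, ∫ x : Fin (L + 1) → ℝ, ∑ j, Λ⁻¹ i j * (x i * x j) ∂gaussLaw S Λ = S := fun i => by
    rw [integral_finsetSum _ fun j _ => hi2 i j]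
    simp only [integral_const_mul, gaussLaw_integral_mul hS hΛ]
    have h := congrFun (congrFun (Matrix.nonsing_inv_mul Λ
      (isUnit_iff_ne_zero.2 hΛ.1.det_pos.ne')) i) i
    rw [Matrix.mul_apply, Matrix.one_apply_eq] at h
    calc _ = S * ∑ j, Λ⁻¹ i j * Λ j i := by
          rw [Finset.mul_sum]
          exact Finset.sum_congr rfl fun j _ => by rw [hΛ.symm i j]; ring
      _ = S := by rw [h, mul_one]
  simp [e1, e2]

/-- The log-likelihood ratio is the constant `-½ ln |Λ|` plus a quadratic form that integrates to
zero. -/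
lemma multiInfo_gaussLaw {L : ℕ} {S : ℝ} (hS : 0 < S)
    {Λ : Matrix (Fin (L + 1)) (Fin (L + 1)) ℝ} (hΛ : IsCorr Λ) :
    multiInfo (gaussLaw S Λ) = ENNReal.ofReal (-(1 / 2) * Real.log Λ.det) := by
  unfold multiInfo
  simp only [(gaussLaw_measurePreserving_eval hS hΛ _).map_eq]
  set γ := Measure.pi fun _ : Fin (L + 1) => gaussianReal 0 S.toNNReal with hγ
  have hd := gaussLaw_eq_withDensity hS hΛ.1
  have hac : gaussLaw S Λ ≪ γ := by rw [hd]; exact withDensity_absolutelyContinuous _ _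
  have hllr : llr (gaussLaw S Λ) γ =ᵐ[gaussLaw S Λ] fun x =>
      -(1 / 2) * Real.log Λ.det +
        (∑ i, x i ^ 2 - ∑ i, ∑ j, Λ⁻¹ i j * (x i * x j)) / (2 * S) := by
    have h := hac.ae_le (Measure.rnDeriv_withDensity γ (measurable_gaussRatio S Λ).ennreal_ofReal)
    rw [← hd] at h
    filter_upwards [h] with x hx
    have hpos := hΛ.1.det_pos
    rw [llr, hx, ENNReal.toReal_ofReal (gaussRatio_pos S hΛ.1 x).le, gaussRatio,
      Real.log_mul (by positivity) (by positivity), Real.log_exp, Real.log_inv,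
      Real.log_sqrt hpos.le]
    ring
  obtain ⟨hint, hval⟩ := integral_quadratic_gaussLaw hS hΛ
  have hI : Integrable (fun x : Fin (L + 1) → ℝ => -(1 / 2) * Real.log Λ.det +
        (∑ i, x i ^ 2 - ∑ i, ∑ j, Λ⁻¹ i j * (x i * x j)) / (2 * S)) (gaussLaw S Λ) :=
    (integrable_const _).add (hint.div_const _)
  rw [InformationTheory.klDiv_of_ac_of_integrable hac (hI.congr hllr.symm), integral_congr_ae hllr,
    integral_add (integrable_const _) (hint.div_const _), integral_div, hval]
  simp

lemma integral_bhatt_gaussLaw {S σ : ℝ} (hS : 0 < S) (hσ : 0 < σ) {L : ℕ} (hL : 1 ≤ L)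
    {Λ : Matrix (Fin (L + 1)) (Fin (L + 1)) ℝ} (hΛ : IsCorr Λ) :
    ∫ x, bhatt σ x ∂gaussLaw S Λ = distForm S σ Λ := by
  have hL' : (0 : ℝ) < L := by exact_mod_cast hL
  have hi1 : ∀ i, Integrable (fun x : Fin (L + 1) → ℝ => x i ^ 2) (gaussLaw S Λ) := fun i => by
    simpa only [sq] using gaussLaw_integrable_mul hS hΛ i i
  have e1 : ∀ i, ∫ x : Fin (L + 1) → ℝ, x i ^ 2 ∂gaussLaw S Λ = S := fun i => by
    simp only [sq]; rw [gaussLaw_integral_mul hS hΛ, hΛ.2, mul_one]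
  have hi2 := gaussLaw_integrable_mul hS hΛ
  simp only [bhatt_eq hσ hL]
  rw [integral_const_mul, integral_sub (integrable_finsetSum _ fun i _ => hi1 i)
    ((integrable_finsetSum _ fun i _ => integrable_finsetSum _ fun j _ => hi2 i j).const_mul _),
    integral_finsetSum _ fun i _ => hi1 i, integral_const_mul,
    integral_finsetSum _ fun i _ => integrable_finsetSum _ fun j _ => hi2 i j]
  have e2 : ∑ i, ∫ x : Fin (L + 1) → ℝ, ∑ j ∈ Finset.Ioi i, x i * x j ∂gaussLaw S Λ =
      S * ∑ i, ∑ j ∈ Finset.Ioi i, Λ i j := by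
    rw [Finset.mul_sum]
    refine Finset.sum_congr rfl fun i _ => ?_
    rw [integral_finsetSum _ fun j _ => hi2 i j, Finset.mul_sum]
    exact Finset.sum_congr rfl fun j _ => gaussLaw_integral_mul hS hΛ i j
  rw [e2, distForm]
  simp only [e1]
  simp
  field_simp

lemma ckmExponent_eq_sInf {S σ : ℝ} (hS : 0 < S) (hσ : 0 < σ) {L : ℕ} (hL : 1 ≤ L) {R : ℝ}
    (hR : 0 ≤ R) :
    ckmExponent S σ L R = sInf {e | ∃ Λ : Matrix (Fin (L + 1)) (Fin (L + 1)) ℝ, IsCorr Λ ∧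
        -(1 / 2) * Real.log Λ.det ≤ L * R ∧
        e = distForm S σ Λ - 1 / 2 * Real.log Λ.det - L * R} := by
  unfold ckmExponent
  congr 1
  ext e
  refine exists_congr fun Λ => and_congr_right fun hΛ => ?_
  have h0 : 0 ≤ -(1 / 2) * Real.log Λ.det := by linarith [hΛ.log_det_nonpos]
  rw [multiInfo_gaussLaw hS hΛ, integral_bhatt_gaussLaw hS hσ hL hΛ,
    ENNReal.ofReal_le_ofReal_iff (by positivity), ENNReal.toReal_ofReal h0]
  refine and_congr_right fun _ => ?_
  rw [show distForm S σ Λ - 1 / 2 * Real.log Λ.det - L * R =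
    distForm S σ Λ + -(1 / 2) * Real.log Λ.det - L * R by ring]

lemma ckmExponent_eq {S σ : ℝ} (hS : 0 < S) (hσ : 0 < σ) {L : ℕ} (hL : 1 ≤ L)
    {ρ₀ : ℝ} (h0 : 0 < ρ₀) (h1 : ρ₀ < 1) (h : symSlope L ρ₀ = distSlope S σ L)
    {R : ℝ} (hR : 0 < R) :
    ckmExponent S σ L R =
      symDist S σ L (min (symRho L R) ρ₀) + symInfo L (min (symRho L R) ρ₀) - L * R := by
  rw [ckmExponent_eq_sInf hS hσ hL hR.le]
  exact (isLeast_corr_of_isLeast_symmetric hL (isLeast_symmetric hS hσ hL h0 h1 h hR)).csInf_eq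

/-! ### The uniform law on the sphere as the direction of a Gaussian vector -/

/-- The radial projection to the sphere of radius `√(nS)`. -/
def toSph (S : ℝ) {n : ℕ} (x : Fin n → ℝ) : Fin n → ℝ := fun t => √(n * S) * (x t / √(∑ s, x s ^ 2))

lemma measurable_toSph (S : ℝ) {n : ℕ} : Measurable (toSph S (n := n)) := by
  unfold toSph; fun_prop

/-- The law of a vector of `n` independent centred Gaussian letters of variance `S`. -/
def gaussVec (S : ℝ) (n : ℕ) : Measure (Fin n → ℝ) :=
  Measure.pi fun _ => gaussianReal 0 S.toNNReal

instance (S : ℝ) (n : ℕ) : IsProbabilityMeasure (gaussVec S n) := by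
  unfold gaussVec; infer_instance

/-- Integration in polar coordinates. -/
lemma lintegral_polar {E : Type*} [NormedAddCommGroup E] [NormedSpace ℝ E] [FiniteDimensional ℝ E]
    [MeasurableSpace E] [BorelSpace E] [Nontrivial E] (μ : Measure E) [μ.IsAddHaarMeasure]
    {F : E → ENNReal} {f : Metric.sphere (0 : E) 1 → ENNReal} {g : Ioi (0 : ℝ) → ENNReal}
    (hf : Measurable f) (hg : Measurable g)
    (hF : ∀ x : ({0}ᶜ : Set E),
      F x = f (homeomorphUnitSphereProd E x).1 * g (homeomorphUnitSphereProd E x).2) :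
    ∫⁻ x, F x ∂μ =
      (∫⁻ u, f u ∂μ.toSphere) * ∫⁻ r, g r ∂Measure.volumeIoiPow (Module.finrank ℝ E - 1) := by
  have h := lintegral_subtype_comap (μ := μ) (measurableSet_singleton (0 : E)).compl F
  rw [restrict_compl_singleton] at h
  rw [← h]
  simp only [hF]
  rw [μ.measurePreserving_homeomorphUnitSphereProd.lintegral_comp_emb
    (Homeomorph.measurableEmbedding _) (fun p => f p.1 * g p.2),
    lintegral_prod_mul hf.aemeasurable hg.aemeasurable]

lemma isProbabilityMeasure_uniformSphere {n : ℕ} (hn : 1 ≤ n) (S : ℝ) :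
    IsProbabilityMeasure (uniformSphere n S) := by
  have : NeZero n := ⟨by omega⟩
  have : IsProbabilityMeasure (ProbabilityTheory.cond
      (volume : Measure (EuclideanSpace ℝ (Fin n))).toSphere univ) :=
    cond_isProbabilityMeasure (Measure.measure_univ_ne_zero.2 (Measure.toSphere_ne_zero _))
  exact Measure.isProbabilityMeasure_map (Measurable.aemeasurable (by fun_prop))

lemma ae_onSphere_uniformSphere {n : ℕ} {S : ℝ} (hS : 0 < S) :
    ∀ᵐ x ∂uniformSphere n S, OnSphere S x := by
  unfold uniformSphere
  have hm : MeasurableSet {x : Fin n → ℝ | OnSphere S x} := by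
    unfold OnSphere
    exact measurableSet_eq_fun (by fun_prop) (by fun_prop)
  rw [ae_map_iff (Measurable.aemeasurable (by fun_prop)) hm]
  refine ae_of_all _ fun u => ?_
  have hu : ∑ t, u.1 t ^ 2 = 1 := by
    have := u.2
    rw [mem_sphere_zero_iff_norm] at this
    rw [← EuclideanSpace.real_norm_sq_eq, this, one_pow]
  simp only [OnSphere, mul_pow, ← Finset.mul_sum, hu]
  rw [Real.sq_sqrt (by positivity), mul_one]

lemma gaussVec_eq_withDensity {S : ℝ} (hS : 0 < S) (n : ℕ) :
    gaussVec S n = (volume : Measure (Fin n → ℝ)).withDensity fun x =>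
      ENNReal.ofReal (((√(2 * Real.pi * S))⁻¹) ^ n * Real.exp (-(∑ t, x t ^ 2) / (2 * S))) := by
  unfold gaussVec
  rw [pi_gaussianReal hS]
  congr 1
  ext x
  congr 1
  simp only [gaussianPDFReal_toNNReal hS, Finset.prod_mul_distrib, ← Real.exp_sum]
  simp [Finset.sum_div, neg_div]

/-- Norm and direction of a Gaussian vector are independent. -/
lemma gaussVec_inter_toSph {S : ℝ} (hS : 0 < S) {n : ℕ} (hn : 1 ≤ n) {B : Set ℝ}
    (hB : MeasurableSet B) {A : Set (Fin n → ℝ)} (hA : MeasurableSet A) :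
    gaussVec S n ({x | ∑ t, x t ^ 2 ∈ B} ∩ toSph S ⁻¹' A) =
      gaussVec S n {x | ∑ t, x t ^ 2 ∈ B} * uniformSphere n S A := by
  have : NeZero n := ⟨by omega⟩
  set w : ℝ → ENNReal := fun r =>
    ENNReal.ofReal (((√(2 * Real.pi * S))⁻¹) ^ n * Real.exp (-r / (2 * S))) with hw
  have hwm : Measurable w := by fun_prop
  set ι : Metric.sphere (0 : EuclideanSpace ℝ (Fin n)) 1 → Fin n → ℝ := fun u t => √(n * S) * u.1 t with hι
  have hιm : Measurable ι := by fun_prop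
  have hTm : MeasurableSet {x : Fin n → ℝ | ∑ t, x t ^ 2 ∈ B} :=
    (show Measurable fun x : Fin n → ℝ => ∑ t, x t ^ 2 by fun_prop) hB
  have key : ∀ A : Set (Fin n → ℝ), MeasurableSet A →
      gaussVec S n ({x | ∑ t, x t ^ 2 ∈ B} ∩ toSph S ⁻¹' A) =
        (volume : Measure (EuclideanSpace ℝ (Fin n))).toSphere (ι ⁻¹' A) *
          ∫⁻ r, B.indicator w (r.1 ^ 2) ∂Measure.volumeIoiPow (Module.finrank ℝ (EuclideanSpace ℝ (Fin n)) - 1) := by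
    intro A hA
    have hM := hTm.inter (measurable_toSph S hA)
    rw [gaussVec_eq_withDensity hS, withDensity_apply _ hM, ← lintegral_indicator hM,
      ← (PiLp.volume_preserving_ofLp (Fin n)).lintegral_comp_emb
        (MeasurableEquiv.toLp 2 (Fin n → ℝ)).symm.measurableEmbedding,
      lintegral_polar (volume : Measure (EuclideanSpace ℝ (Fin n))) (f := (ι ⁻¹' A).indicator 1)
        (g := fun r => B.indicator w (r.1 ^ 2)) ((measurable_one).indicator (hιm hA))
        ((hwm.indicator hB).comp (by fun_prop)), lintegral_indicator_one (hιm hA)]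
    intro x
    have hn2 : ∑ t, x.1.ofLp t ^ 2 = ‖x.1‖ ^ 2 := (EuclideanSpace.real_norm_sq_eq _).symm
    have e1 : ((homeomorphUnitSphereProd (EuclideanSpace ℝ (Fin n)) x).2 : ℝ) = ‖x.1‖ := by simp
    have e2 : ι (homeomorphUnitSphereProd (EuclideanSpace ℝ (Fin n)) x).1 = toSph S x.1.ofLp := by
      ext t
      have e : √(‖x.1‖ ^ 2) = ‖x.1‖ := Real.sqrt_sq (norm_nonneg _)
      simp only [hι, toSph, hn2, e]
      simp [div_eq_inv_mul]
    rw [e1]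
    by_cases hx1 : ‖x.1‖ ^ 2 ∈ B <;> by_cases hx2 : toSph S x.1.ofLp ∈ A <;>
      simp [Set.indicator, hx1, hx2, e2, hn2, hw]
  have hU : uniformSphere n S A =
      ((volume : Measure (EuclideanSpace ℝ (Fin n))).toSphere univ)⁻¹ * (volume : Measure (EuclideanSpace ℝ (Fin n))).toSphere (ι ⁻¹' A) := by
    unfold uniformSphere
    rw [Measure.map_apply hιm hA, cond_apply MeasurableSet.univ, univ_inter]
  -- Taking `A = univ` expresses the probability of the norm event by the same radial integral,
  -- which can then be eliminated.
  have h1 := key univ MeasurableSet.univ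
  rw [preimage_univ, inter_univ, preimage_univ] at h1
  have hne : (volume : Measure (EuclideanSpace ℝ (Fin n))).toSphere univ ≠ 0 := 
    Measure.measure_univ_ne_zero.2 (Measure.toSphere_ne_zero (volume : Measure (EuclideanSpace ℝ (Fin n))))
  rw [key A hA, h1, hU, mul_mul_mul_comm, ENNReal.mul_inv_cancel hne (measure_ne_top _ _), one_mul,
    mul_comm]

/-! ### Tuples of Gaussian vectors -/

/-- Words whose normalised energy is within `η` of `1`. -/
def shell (S η : ℝ) (n : ℕ) : Set (Fin n → ℝ) := {x | |empCorr S x x - 1| ≤ η}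

lemma shell_eq (S η : ℝ) (n : ℕ) :
    shell S η n = {x | ∑ t, x t ^ 2 ∈ {r : ℝ | |r / (n * S) - 1| ≤ η}} := by
  ext x; simp [shell, empCorr, sq]

lemma measurableSet_shell (S η : ℝ) (n : ℕ) : MeasurableSet (shell S η n) := by
  unfold shell empCorr
  exact measurableSet_le (by fun_prop) (by fun_prop)

/-- The directions of a tuple of Gaussian vectors are independent of the norms and uniform. -/
lemma map_toSph_restrict_shell {S : ℝ} (hS : 0 < S) {n : ℕ} (hn : 1 ≤ n) (k : ℕ) {T : Set (Fin n → ℝ)}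
    {B : Set ℝ} (hB : MeasurableSet B) (hT : T = {x | ∑ t, x t ^ 2 ∈ B}) :
    ((Measure.pi fun _ : Fin k => gaussVec S n).restrict (univ.pi fun _ => T)).map
        (fun x i => toSph S (x i)) =
      (gaussVec S n T) ^ k • Measure.pi fun _ : Fin k => uniformSphere n S := by
  have := isProbabilityMeasure_uniformSphere hn S
  have hTm : MeasurableSet T := by
    rw [hT]; exact (show Measurable fun x : Fin n → ℝ => ∑ t, x t ^ 2 by fun_prop) hB
  have h1 : ((gaussVec S n).restrict T).map (toSph S) = gaussVec S n T • uniformSphere n S := by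
    ext A hA
    rw [Measure.map_apply (measurable_toSph S) hA, Measure.restrict_apply (measurable_toSph S hA),
      inter_comm, hT, gaussVec_inter_toSph hS hn hB hA]
    rfl
  rw [Measure.restrict_pi_pi, Measure.pi_map_pi fun _ => (measurable_toSph S).aemeasurable]
  refine Measure.pi_eq fun s hs => ?_
  rw [h1]
  simp [Measure.pi_pi, Finset.prod_mul_distrib]

/-- This turns spherical averages into Gaussian ones over words of nearly nominal energy, where the
density `gramRatio` can be controlled. The price is the factor for the probability of the shell. -/
lemma lintegral_toSph_shell {S : ℝ} (hS : 0 < S) {n : ℕ} (hn : 1 ≤ n) (k : ℕ) (η : ℝ)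
    {f : (Fin k → Fin n → ℝ) → ENNReal} (hf : Measurable f) :
    ∫⁻ x in univ.pi fun _ => shell S η n, f (fun i => toSph S (x i))
        ∂(Measure.pi fun _ : Fin k => gaussVec S n) =
      (gaussVec S n (shell S η n)) ^ k * ∫⁻ u, f u ∂(Measure.pi fun _ : Fin k => uniformSphere n S) := by
  have hm : Measurable fun (x : Fin k → Fin n → ℝ) i => toSph S (x i) :=
    measurable_pi_lambda _ fun i => (measurable_toSph S).comp (measurable_pi_apply i)
  rw [← lintegral_map hf hm, map_toSph_restrict_shell hS hn k
    (B := {r : ℝ | |r / (n * S) - 1| ≤ η}) (measurableSet_le (by fun_prop) (by fun_prop))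
    (shell_eq S η n), lintegral_smul_measure, smul_eq_mul]

lemma map_toSph_pi_gaussVec {S : ℝ} (hS : 0 < S) {n : ℕ} (hn : 1 ≤ n) (k : ℕ) :
    (Measure.pi fun _ : Fin k => gaussVec S n).map (fun x i => toSph S (x i)) =
      Measure.pi fun _ : Fin k => uniformSphere n S := by
  have h := map_toSph_restrict_shell hS hn k (T := univ) (B := univ) MeasurableSet.univ (by simp)
  simpa using h

/-! ### Change of measure -/

/-- Both measures are curried forms of one product over pairs. This switches between words indexed
by user and letters indexed by time. -/
lemma pi_pi_map_swap {ι κ X : Type*} [Fintype ι] [Fintype κ] [MeasurableSpace X] (μ : Measure X)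
    [IsProbabilityMeasure μ] :
    (Measure.pi fun _ : ι => Measure.pi fun _ : κ => μ).map Function.swap =
      Measure.pi fun _ : κ => Measure.pi fun _ : ι => μ := by
  have h1 := Measure.infinitePi_map_curry (fun (_ : ι) (_ : κ) => μ)
  have h2 := Measure.infinitePi_map_curry (fun (_ : κ) (_ : ι) => μ)
  have h3 := Measure.infinitePi_map_piCongrLeft (fun _ : κ × ι => μ) (Equiv.prodComm ι κ)
  simp only [Measure.infinitePi_eq_pi] at h1 h2 h3
  rw [← h1, ← h2, ← h3, Measure.map_map (by fun_prop) (by fun_prop),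
    Measure.map_map (by fun_prop) (by fun_prop)]
  congr 1

/-- The density of `n` independent copies of the Gaussian law with covariance `S Λ` relative to
the product of the marginals. -/
def gramRatio {L : ℕ} (S : ℝ) (Λ : Matrix (Fin (L + 1)) (Fin (L + 1)) ℝ) {n : ℕ}
    (x : Fin (L + 1) → Fin n → ℝ) : ℝ :=
  Real.exp (n * (-(1 / 2) * Real.log Λ.det) +
    n / 2 * (∑ i, empCorr S (x i) (x i) - ∑ i, ∑ j, Λ⁻¹ i j * empCorr S (x i) (x j)))

@[fun_prop]
lemma measurable_gramRatio {L : ℕ} (S : ℝ) (Λ : Matrix (Fin (L + 1)) (Fin (L + 1)) ℝ) (n : ℕ) :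
    Measurable (gramRatio S Λ (n := n)) := by
  unfold gramRatio empCorr; fun_prop

/-- The log-density is quadratic in each letter, so its sum over time depends on the words only
through their Gram matrix. -/
lemma prod_gaussRatio {L : ℕ} {S : ℝ} (hS : 0 < S) {Λ : Matrix (Fin (L + 1)) (Fin (L + 1)) ℝ}
    (hΛ : Λ.PosDef) {n : ℕ} (hn : 1 ≤ n) (x : Fin (L + 1) → Fin n → ℝ) :
    ∏ t, gaussRatio S Λ (fun i => x i t) = gramRatio S Λ x := by
  have hn' : (0 : ℝ) < n := by exact_mod_cast hn
  have hd := hΛ.det_pos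
  have e0 : (√Λ.det)⁻¹ = Real.exp (-(1 / 2) * Real.log Λ.det) := by
    rw [← Real.exp_log (show 0 < (√Λ.det)⁻¹ by positivity), Real.log_inv, Real.log_sqrt hd.le]
    congr 1; ring
  simp only [gaussRatio, gramRatio, e0, ← Real.exp_add, ← Real.exp_sum]
  congr 1
  rw [Finset.sum_add_distrib, ← Finset.sum_div, Finset.sum_sub_distrib]
  congr 1
  · simp
  have e1 : ∑ t, ∑ i, x i t ^ 2 = n * S * ∑ i, empCorr S (x i) (x i) := by
    rw [Finset.sum_comm, Finset.mul_sum]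
    refine Finset.sum_congr rfl fun i _ => ?_
    unfold empCorr
    field_simp
  have e2 : ∑ t, ∑ i, ∑ j, Λ⁻¹ i j * (x i t * x j t) =
      n * S * ∑ i, ∑ j, Λ⁻¹ i j * empCorr S (x i) (x j) := by
    rw [Finset.sum_comm, Finset.mul_sum]
    refine Finset.sum_congr rfl fun i _ => ?_
    rw [Finset.sum_comm, Finset.mul_sum]
    refine Finset.sum_congr rfl fun j _ => ?_
    rw [← Finset.mul_sum]
    unfold empCorr
    field_simp
  rw [e1, e2]
  field_simp

/-- Change of measure from independent words to words with the joint law of covariance `S Λ`. -/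
lemma lintegral_gramRatio {L : ℕ} {S : ℝ} (hS : 0 < S)
    {Λ : Matrix (Fin (L + 1)) (Fin (L + 1)) ℝ} (hΛ : Λ.PosDef) {n : ℕ} (hn : 1 ≤ n)
    {f : (Fin (L + 1) → Fin n → ℝ) → ENNReal} (hf : Measurable f) :
    ∫⁻ y, f (Function.swap y) ∂(Measure.pi fun _ : Fin n => gaussLaw S Λ) =
      ∫⁻ x, ENNReal.ofReal (gramRatio S Λ x) * f x
        ∂(Measure.pi fun _ : Fin (L + 1) => gaussVec S n) := by
  have hd := gaussLaw_eq_withDensity hS hΛ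
  set γ := Measure.pi fun _ : Fin (L + 1) => gaussianReal 0 S.toNNReal with hγ
  have hmh := (measurable_gaussRatio S Λ).ennreal_ofReal
  have hsf : IsProbabilityMeasure (γ.withDensity fun x => ENNReal.ofReal (gaussRatio S Λ x)) := by
    rw [← hd]; infer_instance
  rw [hd, pi_withDensity (μ := fun _ => γ) (f := fun _ x => ENNReal.ofReal (gaussRatio S Λ x))
    fun _ => hmh, lintegral_withDensity_eq_lintegral_mul _ (by fun_prop) (by fun_prop)]
  have hswap := pi_pi_map_swap (ι := Fin (L + 1)) (κ := Fin n) (gaussianReal 0 S.toNNReal)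
  have hmr : Measurable fun y : Fin n → Fin (L + 1) → ℝ =>
      ∏ t, ENNReal.ofReal (gaussRatio S Λ (y t)) := by
    fun_prop
  rw [hγ, ← hswap, lintegral_map (by fun_prop) (by fun_prop)]
  refine lintegral_congr fun x => ?_
  simp only [Pi.mul_apply]
  rw [← prod_gaussRatio hS hΛ hn, ENNReal.ofReal_prod_of_nonneg fun t _ => (gaussRatio_pos S hΛ _).le]

/-! ### The law of large numbers for empirical correlations -/

/-- Tuples of words with empirical correlations within `η` of the entries of `Λ`. -/
def corrSet {L : ℕ} (S η : ℝ) (Λ : Matrix (Fin (L + 1)) (Fin (L + 1)) ℝ) (n : ℕ) :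
    Set (Fin (L + 1) → Fin n → ℝ) := {x | ∀ i j, |empCorr S (x i) (x j) - Λ i j| ≤ η}

lemma measurableSet_corrSet {L : ℕ} (S η : ℝ) (Λ : Matrix (Fin (L + 1)) (Fin (L + 1)) ℝ) (n : ℕ) :
    MeasurableSet (corrSet S η Λ n) := by
  have : corrSet S η Λ n = ⋂ i, ⋂ j, {x | |empCorr S (x i) (x j) - Λ i j| ≤ η} := by
    ext x; simp [corrSet]
  rw [this]
  unfold empCorr
  exact MeasurableSet.iInter fun i => MeasurableSet.iInter fun j =>
    measurableSet_le (by fun_prop) (by fun_prop)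

lemma gaussLaw_chebyshev {L : ℕ} {S : ℝ} (hS : 0 < S)
    {Λ : Matrix (Fin (L + 1)) (Fin (L + 1)) ℝ} (hΛ : IsCorr Λ) {η : ℝ} (hη : 0 < η)
    (i j : Fin (L + 1)) {n : ℕ} (hn : 1 ≤ n) :
    (Measure.pi fun _ : Fin n => gaussLaw S Λ)
        {y | ¬ |empCorr S (Function.swap y i) (Function.swap y j) - Λ i j| ≤ η} ≤
      ENNReal.ofReal (Var[fun x : Fin (L + 1) → ℝ => x i * x j; gaussLaw S Λ] / (S * η) ^ 2 / n) := by
  have hn' : (0 : ℝ) < n := by exact_mod_cast hn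
  set P := Measure.pi fun _ : Fin n => gaussLaw S Λ with hP
  set g : (Fin (L + 1) → ℝ) → ℝ := fun x => x i * x j with hg
  have hm := gaussLaw_memLp_mul hS hΛ i j
  have hmt : ∀ t : Fin n, MemLp (fun y : Fin n → Fin (L + 1) → ℝ => g (y t)) 2 P := fun t =>
    hm.comp_measurePreserving (measurePreserving_eval (fun _ : Fin n => gaussLaw S Λ) t)
  set X : (Fin n → Fin (L + 1) → ℝ) → ℝ := ∑ t, fun y => g (y t) with hX
  have hXm : MemLp X 2 P := memLp_finsetSum' _ fun t _ => hmt t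
  have hvar : Var[X; P] = n * Var[g; gaussLaw S Λ] := by
    rw [hX, hP, variance_sum_pi (X := fun _ : Fin n => g) fun _ => hm]; simp
  have hmean : ∫ y, X y ∂P = n * (S * Λ i j) := by
    have : ∀ t : Fin n, ∫ y, g (y t) ∂P = S * Λ i j := fun t => by
      rw [← gaussLaw_integral_mul hS hΛ i j,
        ← (measurePreserving_eval (fun _ : Fin n => gaussLaw S Λ) t).map_eq]
      rw [integral_map (measurable_pi_apply t).aemeasurable (by fun_prop)]
    simp only [hX, Finset.sum_apply]
    rw [integral_finsetSum _ fun t _ => (hmt t).integrable (by norm_num)]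
    simp [this]
  have hc := meas_ge_le_variance_div_sq hXm (c := n * S * η) (by positivity)
  refine (measure_mono fun y hy => ?_).trans (hc.trans (ENNReal.ofReal_le_ofReal (le_of_eq ?_)))
  · simp only [mem_ofPred_eq, not_le] at hy ⊢
    rw [hmean]
    have : X y - n * (S * Λ i j) =
        n * S * (empCorr S (Function.swap y i) (Function.swap y j) - Λ i j) := by
      simp only [hX, hg, empCorr, Finset.sum_apply, Function.swap]
      field_simp
    rw [this, abs_mul, abs_of_pos (by positivity)]
    exact mul_le_mul_of_nonneg_left hy.le (by positivity)
  · rw [hvar]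
    field_simp

/-- Weak law of large numbers: Chebyshev for each pair, then a union bound of order `1/n` over the
finitely many pairs. -/
lemma eventually_half_le_corrSet {L : ℕ} {S : ℝ} (hS : 0 < S)
    {Λ : Matrix (Fin (L + 1)) (Fin (L + 1)) ℝ} (hΛ : IsCorr Λ) {η : ℝ} (hη : 0 < η) :
    ∀ᶠ n : ℕ in atTop, ENNReal.ofReal (1 / 2) ≤
      (Measure.pi fun _ : Fin n => gaussLaw S Λ) {y | Function.swap y ∈ corrSet S η Λ n} := by
  set V := ∑ i, ∑ j, Var[fun x : Fin (L + 1) → ℝ => x i * x j; gaussLaw S Λ] / (S * η) ^ 2 with hV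
  have ht : Tendsto (fun n : ℕ => V / n) atTop (𝓝 0) := tendsto_const_div_atTop_nhds_zero_nat V
  filter_upwards [ht.eventually_le_const (show (0 : ℝ) < 1 / 2 by norm_num), eventually_ge_atTop 1]
    with n hVn hn
  set P := Measure.pi fun _ : Fin n => gaussLaw S Λ
  have hM : MeasurableSet {y : Fin n → Fin (L + 1) → ℝ | Function.swap y ∈ corrSet S η Λ n} :=
    (show Measurable (Function.swap : (Fin n → Fin (L + 1) → ℝ) → _) by fun_prop)
      (measurableSet_corrSet S η Λ n)
  have hbad : P {y | Function.swap y ∈ corrSet S η Λ n}ᶜ ≤ ENNReal.ofReal (1 / 2) := by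
    calc P {y | Function.swap y ∈ corrSet S η Λ n}ᶜ
        ≤ P (⋃ i, ⋃ j, {y | ¬ |empCorr S (Function.swap y i) (Function.swap y j) - Λ i j| ≤ η}) := by
          refine measure_mono fun y hy => ?_
          simp only [mem_compl_iff, mem_ofPred_eq, corrSet, not_forall] at hy
          simpa using hy
      _ ≤ ∑ i, ∑ j, ENNReal.ofReal
            (Var[fun x : Fin (L + 1) → ℝ => x i * x j; gaussLaw S Λ] / (S * η) ^ 2 / n) :=
          (measure_iUnion_fintype_le _ _).trans (Finset.sum_le_sum fun i _ =>
            (measure_iUnion_fintype_le _ _).trans (Finset.sum_le_sum fun j _ =>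
              gaussLaw_chebyshev hS hΛ hη i j hn))
      _ = ENNReal.ofReal (V / n) := by
          have h0 : ∀ i j : Fin (L + 1),
              0 ≤ Var[fun x : Fin (L + 1) → ℝ => x i * x j; gaussLaw S Λ] / (S * η) ^ 2 / n :=
            fun i j => div_nonneg (div_nonneg (variance_nonneg _ _) (sq_nonneg _)) (by positivity)
          rw [hV, Finset.sum_div, ENNReal.ofReal_sum_of_nonneg fun i _ => by
            rw [Finset.sum_div]; exact Finset.sum_nonneg fun j _ => h0 i j]
          refine Finset.sum_congr rfl fun i _ => ?_
          rw [Finset.sum_div, ENNReal.ofReal_sum_of_nonneg fun j _ => h0 i j]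
      _ ≤ ENNReal.ofReal (1 / 2) := ENNReal.ofReal_le_ofReal hVn
  have h1 := prob_add_prob_compl (μ := P) hM
  have h2 : ENNReal.ofReal (1 / 2) + ENNReal.ofReal (1 / 2) = 1 := by
    rw [← ENNReal.ofReal_add (by norm_num) (by norm_num)]; norm_num
  by_contra hlt
  push Not at hlt
  have := ENNReal.add_lt_add_of_lt_of_le (measure_ne_top P _) hlt hbad
  rw [h1, h2] at this
  exact lt_irrefl _ this

/-! ### Exponents of the spherical ensemble -/

/-- A bound for the sensitivity of the exponent of `gramRatio` to the empirical correlations. -/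
def gramConst {L : ℕ} (Λ : Matrix (Fin (L + 1)) (Fin (L + 1)) ℝ) : ℝ :=
  (L + 1) + ∑ i, ∑ j, |Λ⁻¹ i j|

lemma gramConst_pos {L : ℕ} (Λ : Matrix (Fin (L + 1)) (Fin (L + 1)) ℝ) : 0 < gramConst Λ := by
  have : 0 ≤ ∑ i, ∑ j, |Λ⁻¹ i j| :=
    Finset.sum_nonneg fun i _ => Finset.sum_nonneg fun j _ => abs_nonneg _
  unfold gramConst; positivity

/-- The expression is linear in the empirical correlations and vanishes when they equal `Λ`, since
`tr (Λ⁻¹ Λ) = L + 1 = tr Λ`. -/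
lemma abs_gram_exponent_le {L : ℕ} {S η : ℝ} {Λ : Matrix (Fin (L + 1)) (Fin (L + 1)) ℝ}
    (hΛ : IsCorr Λ) {n : ℕ} {x : Fin (L + 1) → Fin n → ℝ} (hx : x ∈ corrSet S η Λ n) :
    |∑ i, empCorr S (x i) (x i) - ∑ i, ∑ j, Λ⁻¹ i j * empCorr S (x i) (x j)| ≤
      gramConst Λ * η := by
  have h0 : ∑ i, ∑ j, Λ⁻¹ i j * Λ i j = ∑ i, Λ i i := by
    refine Finset.sum_congr rfl fun i _ => ?_
    have h := congrFun (congrFun (Matrix.nonsing_inv_mul Λ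
      (isUnit_iff_ne_zero.2 hΛ.1.det_pos.ne')) i) i
    rw [Matrix.mul_apply, Matrix.one_apply_eq] at h
    rw [hΛ.2, ← h]
    exact Finset.sum_congr rfl fun j _ => by rw [hΛ.symm i j]
  have e : ∑ i, empCorr S (x i) (x i) - ∑ i, ∑ j, Λ⁻¹ i j * empCorr S (x i) (x j) =
      ∑ i, (empCorr S (x i) (x i) - Λ i i) -
        ∑ i, ∑ j, Λ⁻¹ i j * (empCorr S (x i) (x j) - Λ i j) := by
    simp only [mul_sub, Finset.sum_sub_distrib, h0]
    ring
  rw [e, gramConst, add_mul]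
  refine (abs_sub _ _).trans (add_le_add ?_ ?_)
  · refine (Finset.abs_sum_le_sum_abs _ _).trans ?_
    refine (Finset.sum_le_sum fun i _ => hx i i).trans ?_
    simp
  · refine (Finset.abs_sum_le_sum_abs _ _).trans ?_
    rw [Finset.sum_mul]
    refine Finset.sum_le_sum fun i _ => (Finset.abs_sum_le_sum_abs _ _).trans ?_
    rw [Finset.sum_mul]
    refine Finset.sum_le_sum fun j _ => ?_
    rw [abs_mul]
    exact mul_le_mul_of_nonneg_left (hx i j) (abs_nonneg _)

lemma measure_swap_corrSet {L : ℕ} {S : ℝ} (hS : 0 < S) (η : ℝ)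
    {Λ Λ' : Matrix (Fin (L + 1)) (Fin (L + 1)) ℝ} (hΛ : Λ.PosDef) {n : ℕ} (hn : 1 ≤ n) :
    (Measure.pi fun _ : Fin n => gaussLaw S Λ) {y | Function.swap y ∈ corrSet S η Λ' n} =
      ∫⁻ x in corrSet S η Λ' n, ENNReal.ofReal (gramRatio S Λ x)
        ∂(Measure.pi fun _ : Fin (L + 1) => gaussVec S n) := by
  have hM := measurableSet_corrSet S η Λ' n
  have h := lintegral_gramRatio hS hΛ hn (f := (corrSet S η Λ' n).indicator 1)
    (measurable_one.indicator hM)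
  have hsw : Measurable (Function.swap : (Fin n → Fin (L + 1) → ℝ) → _) := by fun_prop
  have hsM : MeasurableSet {y : Fin n → Fin (L + 1) → ℝ | Function.swap y ∈ corrSet S η Λ' n} :=
    hsw hM
  rw [← lintegral_indicator_one hsM, ← lintegral_indicator hM]
  refine Eq.trans (lintegral_congr fun y => rfl) (h.trans ?_)
  refine lintegral_congr fun x => ?_
  by_cases hx : x ∈ corrSet S η Λ' n <;> simp [hx]

/-- On this set `gramRatio` is at least `e^{n(I - Kη)}`, where `I = -½ ln |Λ|` and `K = gramConst
Λ`, yet its integral is a probability. The companion lower bound uses the opposite estimate and mass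
at least `1/2`. -/
lemma pi_gaussVec_corrSet_le {L : ℕ} {S : ℝ} (hS : 0 < S) {η : ℝ} (hη : 0 < η)
    {Λ : Matrix (Fin (L + 1)) (Fin (L + 1)) ℝ} (hΛ : IsCorr Λ) {n : ℕ} (hn : 1 ≤ n) :
    (Measure.pi fun _ : Fin (L + 1) => gaussVec S n) (corrSet S η Λ n) ≤
      ENNReal.ofReal (Real.exp (-(n * (-(1 / 2) * Real.log Λ.det - gramConst Λ * η)))) := by
  have hn' : (0 : ℝ) < n := by exact_mod_cast hn
  have hM := measurableSet_corrSet S η Λ n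
  set c := Real.exp (n * (-(1 / 2) * Real.log Λ.det - gramConst Λ * η)) with hc
  have hle : ENNReal.ofReal c * (Measure.pi fun _ : Fin (L + 1) => gaussVec S n)
      (corrSet S η Λ n) ≤ 1 := by
    calc _ = ∫⁻ _ in corrSet S η Λ n, ENNReal.ofReal c
          ∂(Measure.pi fun _ : Fin (L + 1) => gaussVec S n) := by rw [setLIntegral_const]
      _ ≤ ∫⁻ x in corrSet S η Λ n, ENNReal.ofReal (gramRatio S Λ x)
          ∂(Measure.pi fun _ : Fin (L + 1) => gaussVec S n) := by
          refine setLIntegral_mono' hM fun x hx => ENNReal.ofReal_le_ofReal ?_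
          rw [hc, gramRatio, Real.exp_le_exp]
          have h := (abs_le.1 (abs_gram_exponent_le hΛ hx)).1
          have hk := mul_pos (gramConst_pos Λ) hη
          nlinarith
      _ = _ := (measure_swap_corrSet hS η hΛ.1 hn).symm
      _ ≤ 1 := prob_le_one
  rw [Real.exp_neg, ENNReal.ofReal_inv_of_pos (Real.exp_pos _)]
  rw [mul_comm] at hle
  exact ENNReal.le_inv_iff_mul_le.2 hle

lemma eventually_le_pi_gaussVec_corrSet {L : ℕ} {S : ℝ} (hS : 0 < S) {η : ℝ} (hη : 0 < η)
    {Λ : Matrix (Fin (L + 1)) (Fin (L + 1)) ℝ} (hΛ : IsCorr Λ) :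
    ∀ᶠ n : ℕ in atTop,
      ENNReal.ofReal (1 / 2 * Real.exp (-(n * (-(1 / 2) * Real.log Λ.det + gramConst Λ * η)))) ≤
        (Measure.pi fun _ : Fin (L + 1) => gaussVec S n) (corrSet S η Λ n) := by
  filter_upwards [eventually_half_le_corrSet hS hΛ hη, eventually_ge_atTop 1] with n h hn
  have hn' : (0 : ℝ) < n := by exact_mod_cast hn
  have hM := measurableSet_corrSet S η Λ n
  set c := Real.exp (n * (-(1 / 2) * Real.log Λ.det + gramConst Λ * η)) with hc
  have hle : ENNReal.ofReal (1 / 2) ≤ ENNReal.ofReal c *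
      (Measure.pi fun _ : Fin (L + 1) => gaussVec S n) (corrSet S η Λ n) := by
    refine h.trans ?_
    rw [measure_swap_corrSet hS η hΛ.1 hn, ← setLIntegral_const]
    refine setLIntegral_mono' hM fun x hx => ENNReal.ofReal_le_ofReal ?_
    rw [hc, gramRatio, Real.exp_le_exp]
    have h := (abs_le.1 (abs_gram_exponent_le hΛ hx)).2
    have hk := mul_pos (gramConst_pos Λ) hη
    nlinarith
  rw [Real.exp_neg, ← div_eq_mul_inv, ENNReal.ofReal_div_of_pos (Real.exp_pos _)]
  exact ENNReal.div_le_of_le_mul' hle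

lemma isCorr_one {L : ℕ} : IsCorr (1 : Matrix (Fin (L + 1)) (Fin (L + 1)) ℝ) :=
  ⟨Matrix.PosDef.one, fun i => Matrix.one_apply_eq i⟩

lemma gramRatio_one {L : ℕ} (S : ℝ) {n : ℕ} (x : Fin (L + 1) → Fin n → ℝ) :
    gramRatio S 1 x = 1 := by
  simp [gramRatio, Matrix.one_apply]

/-- The case `Λ = 1` of the law of large numbers, where no change of measure takes place, read on
the diagonal entries. -/
lemma eventually_half_le_shell {S : ℝ} (hS : 0 < S) {η : ℝ} (hη : 0 < η) (L : ℕ) :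
    ∀ᶠ n : ℕ in atTop, ENNReal.ofReal (1 / 2) ≤ gaussVec S n (shell S η n) ^ (L + 1) := by
  filter_upwards [eventually_half_le_corrSet hS (isCorr_one (L := L)) hη, eventually_ge_atTop 1]
    with n h hn
  rw [measure_swap_corrSet hS η Matrix.PosDef.one hn] at h
  simp only [gramRatio_one, ENNReal.ofReal_one, setLIntegral_one] at h
  refine h.trans ?_
  have e : gaussVec S n (shell S η n) ^ (L + 1) = (Measure.pi fun _ : Fin (L + 1) => gaussVec S n)
      (univ.pi fun _ => shell S η n) := by
    rw [Measure.pi_pi]; simp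
  rw [e]
  refine measure_mono fun x hx i _ => ?_
  have := hx i i
  rwa [Matrix.one_apply_eq] at this

/-- Correlation is the product of the two norms and the cosine. For a zero word both sides vanish,
so no nondegeneracy is required. -/
lemma empCorr_eq_mul_toSph {S : ℝ} (hS : 0 < S) {n : ℕ} (hn : 1 ≤ n) (x y : Fin n → ℝ) :
    empCorr S x y =
      √(empCorr S x x) * √(empCorr S y y) * empCorr S (toSph S x) (toSph S y) := by
  have hn' : (0 : ℝ) < n := by exact_mod_cast hn
  have hz : ∀ z : Fin n → ℝ, √(∑ t, z t ^ 2) = 0 → ∀ t, z t = 0 := by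
    intro z h t
    rw [Real.sqrt_eq_zero (Finset.sum_nonneg fun t _ => sq_nonneg _),
      Finset.sum_eq_zero_iff_of_nonneg fun t _ => sq_nonneg _] at h
    simpa using h t (Finset.mem_univ t)
  have hs : ∀ z : Fin n → ℝ, √(empCorr S z z) = √(∑ t, z t ^ 2) / √(n * S) := by
    intro z
    rw [← Real.sqrt_div (Finset.sum_nonneg fun t _ => sq_nonneg _)]
    simp only [empCorr, sq]
  by_cases hx : √(∑ t, x t ^ 2) = 0
  · simp [empCorr, hz x hx]
  by_cases hy : √(∑ t, y t ^ 2) = 0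
  · simp [empCorr, hz y hy]
  rw [hs, hs]
  have e : ∑ t, toSph S x t * toSph S y t =
      n * S * (∑ t, x t * y t) / (√(∑ t, x t ^ 2) * √(∑ t, y t ^ 2)) := by
    rw [Finset.mul_sum, Finset.sum_div]
    refine Finset.sum_congr rfl fun t _ => ?_
    have hq : √(n * S) * √(n * S) = n * S := Real.mul_self_sqrt (by positivity)
    have e2 : toSph S x t * toSph S y t = (√(n * S) * √(n * S)) *
        (x t / √(∑ t, x t ^ 2) * (y t / √(∑ t, y t ^ 2))) := by unfold toSph; ring
    rw [e2, hq]
    field_simp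
  have hq : √(n * S) * √(n * S) = n * S := Real.mul_self_sqrt (by positivity)
  have hq0 : 0 < √(n * S) := by positivity
  unfold empCorr
  rw [e, div_mul_div_comm, hq]
  field_simp

lemma abs_sqrt_mul_sqrt_sub_one_le {a b η : ℝ} (hη0 : 0 ≤ η) (hη1 : η ≤ 1) (ha : |a - 1| ≤ η)
    (hb : |b - 1| ≤ η) : |√a * √b - 1| ≤ η := by
  obtain ⟨a1, a2⟩ := abs_le.1 ha
  obtain ⟨b1, b2⟩ := abs_le.1 hb
  rw [← Real.sqrt_mul (by linarith), abs_le]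
  constructor
  · have : 1 - η ≤ √(a * b) := by
      apply Real.le_sqrt_of_sq_le
      nlinarith [mul_le_mul (show 1 - η ≤ a by linarith) (show 1 - η ≤ b by linarith)
        (by linarith) (by linarith)]
    linarith
  · have : √(a * b) ≤ 1 + η := by
      apply Real.sqrt_le_iff.2
      refine ⟨by linarith, ?_⟩
      nlinarith [mul_le_mul (show a ≤ 1 + η by linarith) (show b ≤ 1 + η by linarith)
        (by linarith) (by linarith)]
    linarith

lemma corrSet_of_toSph {L : ℕ} {S : ℝ} (hS : 0 < S) {ε : ℝ} (hε0 : 0 < ε) (hε1 : ε ≤ 1)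
    {Λ : Matrix (Fin (L + 1)) (Fin (L + 1)) ℝ} (hΛ : IsCorr Λ) {n : ℕ} (hn : 1 ≤ n)
    {x : Fin (L + 1) → Fin n → ℝ} (hx : ∀ i, x i ∈ shell S ε n)
    (h : (fun i => toSph S (x i)) ∈ corrSet S ε Λ n) : x ∈ corrSet S (3 * ε) Λ n := by
  intro i j
  have hp := abs_sqrt_mul_sqrt_sub_one_le hε0.le hε1 (hx i) (hx j)
  have hc := h i j
  have hl := hΛ.abs_le_one i j
  rw [empCorr_eq_mul_toSph hS hn (x i) (x j)]
  set p := √(empCorr S (x i) (x i)) * √(empCorr S (x j) (x j))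
  set c := empCorr S (toSph S (x i)) (toSph S (x j))
  have hp2 : |p| ≤ 2 := by
    calc |p| = |(p - 1) + 1| := by ring_nf
      _ ≤ |p - 1| + |1| := abs_add_le _ _
      _ ≤ 2 := by rw [abs_one]; linarith
  calc |p * c - Λ i j| = |p * (c - Λ i j) + (p - 1) * Λ i j| := by ring_nf
    _ ≤ |p| * |c - Λ i j| + |p - 1| * |Λ i j| := by
        rw [← abs_mul, ← abs_mul]; exact abs_add_le _ _
    -- The factor `3` arises here: the norm factor `p` is at most `2` and differs from `1` by at
    -- most `ε`.
    _ ≤ 2 * ε + ε * 1 := by gcongr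
    _ = 3 * ε := by ring

lemma toSph_mem_corrSet {L : ℕ} {S : ℝ} (hS : 0 < S) {ε : ℝ} (hε0 : 0 < ε) (hε1 : ε ≤ 1)
    {Λ : Matrix (Fin (L + 1)) (Fin (L + 1)) ℝ} (hΛ : IsCorr Λ) {n : ℕ} (hn : 1 ≤ n)
    {x : Fin (L + 1) → Fin n → ℝ} (h : x ∈ corrSet S (ε / 4) Λ n) :
    (fun i => toSph S (x i)) ∈ corrSet S ε Λ n := by
  intro i j
  have hs : ∀ i, |empCorr S (x i) (x i) - 1| ≤ ε / 4 := fun i => by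
    have := h i i; rwa [hΛ.2] at this
  have hp := abs_sqrt_mul_sqrt_sub_one_le (by linarith) (by linarith) (hs i) (hs j)
  have hc := h i j
  have hl := hΛ.abs_le_one i j
  rw [empCorr_eq_mul_toSph hS hn (x i) (x j)] at hc
  show |empCorr S (toSph S (x i)) (toSph S (x j)) - Λ i j| ≤ ε
  set p := √(empCorr S (x i) (x i)) * √(empCorr S (x j) (x j))
  set c := empCorr S (toSph S (x i)) (toSph S (x j))
  have hp1 : 3 / 4 ≤ p := by linarith [(abs_le.1 hp).1]
  have h1 : p * |c - Λ i j| ≤ ε / 2 := by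
    calc p * |c - Λ i j| = |p * (c - Λ i j)| := by rw [abs_mul, abs_of_pos (by linarith : 0 < p)]
      _ = |(p * c - Λ i j) - (p - 1) * Λ i j| := by ring_nf
      _ ≤ |p * c - Λ i j| + |p - 1| * |Λ i j| := by rw [← abs_mul]; exact abs_sub _ _
      _ ≤ ε / 4 + ε / 4 * 1 := by gcongr
      _ = ε / 2 := by ring
  -- Tolerance `ε / 4` suffices: `p ≥ 3/4` turns the bound `ε / 2` into at most `2ε / 3`.
  nlinarith [abs_nonneg (c - Λ i j)]

lemma corrProb_eq {L n : ℕ} (S ε : ℝ) (Λ : Matrix (Fin (L + 1)) (Fin (L + 1)) ℝ) :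
    corrProb L n S ε Λ = (Measure.pi fun _ : Fin (L + 1) => uniformSphere n S) (corrSet S ε Λ n) :=
  rfl

lemma measurable_toSph_pi (S : ℝ) (k n : ℕ) :
    Measurable fun (x : Fin k → Fin n → ℝ) i => toSph S (x i) :=
  measurable_pi_lambda _ fun i => (measurable_toSph S).comp (measurable_pi_apply i)

lemma eventually_le_corrProb {L : ℕ} {S : ℝ} (hS : 0 < S) {ε : ℝ} (hε0 : 0 < ε) (hε1 : ε ≤ 1)
    {Λ : Matrix (Fin (L + 1)) (Fin (L + 1)) ℝ} (hΛ : IsCorr Λ) :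
    ∀ᶠ n : ℕ in atTop,
      ENNReal.ofReal (1 / 2 * Real.exp (-(n * (-(1 / 2) * Real.log Λ.det + gramConst Λ * ε)))) ≤
        corrProb L n S ε Λ := by
  filter_upwards [eventually_le_pi_gaussVec_corrSet hS (show 0 < ε / 4 by positivity) hΛ,
    eventually_ge_atTop 1] with n h hn
  have hk := (gramConst_pos Λ).le
  refine (ENNReal.ofReal_le_ofReal ?_).trans (h.trans ?_)
  · gcongr
    linarith
  · rw [corrProb_eq, ← map_toSph_pi_gaussVec hS hn,
      Measure.map_apply (measurable_toSph_pi S _ n) (measurableSet_corrSet S ε Λ n)]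
    exact measure_mono fun x hx => toSph_mem_corrSet hS hε0 hε1 hΛ hn hx

/-- Restricting the Gaussian words to the shell costs at most a factor `2`, and there closeness of
the directions implies closeness of the words themselves. -/
lemma eventually_corrProb_le {L : ℕ} {S : ℝ} (hS : 0 < S) {ε : ℝ} (hε0 : 0 < ε) (hε1 : ε ≤ 1)
    {Λ : Matrix (Fin (L + 1)) (Fin (L + 1)) ℝ} (hΛ : IsCorr Λ) :
    ∀ᶠ n : ℕ in atTop, corrProb L n S ε Λ ≤
      ENNReal.ofReal (2 * Real.exp (-(n * (-(1 / 2) * Real.log Λ.det - gramConst Λ * (3 * ε))))) := by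
  filter_upwards [eventually_half_le_shell hS hε0 L, eventually_ge_atTop 1] with n h hn
  have hM := measurableSet_corrSet S ε Λ n
  have e := lintegral_toSph_shell hS hn (L + 1) ε (f := (corrSet S ε Λ n).indicator 1)
    (measurable_one.indicator hM)
  rw [lintegral_indicator_one hM, ← corrProb_eq] at e
  have hle : ENNReal.ofReal (1 / 2) * corrProb L n S ε Λ ≤
      ENNReal.ofReal (Real.exp (-(n * (-(1 / 2) * Real.log Λ.det - gramConst Λ * (3 * ε))))) := by
    calc _ ≤ gaussVec S n (shell S ε n) ^ (L + 1) * corrProb L n S ε Λ := by gcongr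
      _ = _ := e.symm
      _ ≤ (Measure.pi fun _ : Fin (L + 1) => gaussVec S n) (corrSet S (3 * ε) Λ n) := by
          have hT : MeasurableSet (univ.pi fun _ : Fin (L + 1) => shell S ε n) :=
            MeasurableSet.univ_pi fun _ => measurableSet_shell S ε n
          rw [← lintegral_indicator_one (measurableSet_corrSet S (3 * ε) Λ n),
            ← lintegral_indicator hT]
          refine lintegral_mono fun x => ?_
          by_cases hx : x ∈ univ.pi fun _ : Fin (L + 1) => shell S ε n
          · rw [indicator_of_mem hx]
            by_cases hx2 : (fun i => toSph S (x i)) ∈ corrSet S ε Λ n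
            · rw [indicator_of_mem hx2, indicator_of_mem
                (corrSet_of_toSph hS hε0 hε1 hΛ hn (fun i => hx i (mem_univ i)) hx2)]
              exact le_rfl
            · rw [indicator_of_notMem hx2]; exact zero_le
          · rw [indicator_of_notMem hx]; exact zero_le
      _ ≤ _ := pi_gaussVec_corrSet_le hS (by positivity) hΛ hn
  rw [ENNReal.ofReal_mul (by norm_num)]
  calc corrProb L n S ε Λ = ENNReal.ofReal 2 * (ENNReal.ofReal (1 / 2) * corrProb L n S ε Λ) := by
        rw [← mul_assoc, ← ENNReal.ofReal_mul (by norm_num)]; norm_num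
    _ ≤ _ := by gcongr

lemma eventually_const_le_exp {c δ : ℝ} (hδ : 0 < δ) :
    ∀ᶠ n : ℕ in atTop, c ≤ Real.exp (n * δ) := by
  have h : Tendsto (fun n : ℕ => Real.exp (n * δ)) atTop atTop :=
    Real.tendsto_exp_atTop.comp (tendsto_natCast_atTop_atTop.atTop_mul_const hδ)
  exact h.eventually_ge_atTop c

/-- The probability of empirical correlations near `Λ` has exponential order `-½ ln |Λ|`. -/
lemma corrProb_exponent {L : ℕ} {S : ℝ} (hS : 0 < S)
    {Λ : Matrix (Fin (L + 1)) (Fin (L + 1)) ℝ} (hΛ : IsCorr Λ) {δ : ℝ} (hδ : 0 < δ) :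
    ∃ ε₀ > 0, ∀ ε, 0 < ε → ε < ε₀ → ∀ᶠ n : ℕ in atTop,
      ENNReal.ofReal (Real.exp (-(n * (-(1 / 2) * Real.log Λ.det + δ)))) ≤ corrProb L n S ε Λ ∧
      corrProb L n S ε Λ ≤ ENNReal.ofReal (Real.exp (-(n * (-(1 / 2) * Real.log Λ.det - δ)))) := by
  have hK := gramConst_pos Λ
  -- The larger loss `3 K ε`, with `K = gramConst Λ`, stays below `δ / 2`; the other half of `δ`
  -- absorbs the factors `2` and `1/2`.
  refine ⟨min 1 (δ / (6 * gramConst Λ)), by positivity, fun ε hε0 hε => ?_⟩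
  have hε1 : ε ≤ 1 := (hε.trans_le (min_le_left _ _)).le
  have hε2 : gramConst Λ * (3 * ε) ≤ δ / 2 := by
    have := hε.trans_le (min_le_right _ _)
    rw [lt_div_iff₀ (by positivity)] at this
    linarith
  have hε3 : gramConst Λ * ε ≤ δ / 2 := by
    have := mul_pos hK hε0
    linarith
  filter_upwards [eventually_le_corrProb hS hε0 hε1 hΛ, eventually_corrProb_le hS hε0 hε1 hΛ,
    eventually_const_le_exp (c := 2) (half_pos hδ)] with n h1 h2 h3
  have hn : (0 : ℝ) ≤ n := by positivity
  set I := -(1 / 2) * Real.log Λ.det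
  constructor
  · refine le_trans (ENNReal.ofReal_le_ofReal ?_) h1
    have e : Real.exp (-(n * (I + gramConst Λ * ε))) =
        Real.exp (-(n * (I + δ))) * Real.exp (n * (δ - gramConst Λ * ε)) := by
      rw [← Real.exp_add]; ring_nf
    have h4 : (2 : ℝ) ≤ Real.exp (n * (δ - gramConst Λ * ε)) :=
      h3.trans (Real.exp_le_exp.2 (mul_le_mul_of_nonneg_left (by linarith) hn))
    rw [e]
    nlinarith [Real.exp_pos (-(n * (I + δ)))]
  · refine h2.trans (ENNReal.ofReal_le_ofReal ?_)
    have e : Real.exp (-(n * (I - δ))) =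
        Real.exp (-(n * (I - gramConst Λ * (3 * ε)))) * Real.exp (n * (δ - gramConst Λ * (3 * ε))) := by
      rw [← Real.exp_add]; ring_nf
    have h4 : (2 : ℝ) ≤ Real.exp (n * (δ - gramConst Λ * (3 * ε))) :=
      h3.trans (Real.exp_le_exp.2 (mul_le_mul_of_nonneg_left (by linarith) hn))
    rw [e]
    nlinarith [Real.exp_pos (-(n * (I - gramConst Λ * (3 * ε))))]

/-! ### The union bound for maximum likelihood list decoding -/

/-- The distance of `L + 1` words, summed over the letters. -/
def wordDist (σ : ℝ) {L n : ℕ} (x : Fin (L + 1) → Fin n → ℝ) : ℝ := ∑ t, bhatt σ fun i => x i t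

lemma measurable_wordDist {σ : ℝ} (hσ : 0 < σ) (L n : ℕ) :
    Measurable (wordDist σ (L := L) (n := n)) := by
  unfold wordDist
  simp only [bhatt_eq_variance hσ]
  fun_prop

/-- Injective choices of `L + 1` messages, the first one being `m`. -/
def listTuples (L : ℕ) {M : ℕ} (m : Fin M) : Finset (Fin (L + 1) → Fin M) :=
  open scoped Classical in Finset.univ.filter fun e => Function.Injective e ∧ e 0 = m

lemma mem_listTuples {L M : ℕ} {m : Fin M} {e : Fin (L + 1) → Fin M} :
    e ∈ listTuples L m ↔ Function.Injective e ∧ e 0 = m := by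
  simp [listTuples]

lemma likelihood_pos {σ : ℝ} (hσ : 0 < σ) {n : ℕ} (x y : Fin n → ℝ) : 0 < likelihood σ x y :=
  Finset.prod_pos fun t _ => gaussianPDFReal_pos _ _ _ (toNNReal_ne_zero (by positivity))

@[fun_prop]
lemma measurable_likelihood (σ : ℝ) {n : ℕ} (x : Fin n → ℝ) : Measurable (likelihood σ x) := by
  unfold likelihood; fun_prop

/-- A message is left out only if at least `L` others precede it in likelihood, ties included.
Choose `L` of them and put `m` in front. -/
lemma exists_listTuples_of_notMem_mlList {σ : ℝ} {L n M : ℕ} {C : Fin M → Fin n → ℝ} {m : Fin M}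
    {y : Fin n → ℝ} (h : m ∉ mlList σ L C y) :
    ∃ e ∈ listTuples L m, ∀ i, likelihood σ (C m) y ≤ likelihood σ (C (e i)) y := by
  classical
  simp only [mlList, Finset.mem_filter, Finset.mem_univ, true_and, not_lt] at h
  obtain ⟨t, hts, htc⟩ := Finset.exists_subset_card_eq h
  have hb : ∀ i, likelihood σ (C m) y ≤ likelihood σ (C (t.orderEmbOfFin htc i)) y ∧
      t.orderEmbOfFin htc i ≠ m := by
    intro i
    have hi := hts (t.orderEmbOfFin_mem htc i)
    simp only [Finset.mem_filter, Finset.mem_univ, true_and] at hi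
    rcases hi with hi | ⟨hi, hlt⟩
    · exact ⟨hi.le, fun e => by rw [e] at hi; exact lt_irrefl _ hi⟩
    · exact ⟨hi.le, hlt.ne⟩
  refine ⟨Fin.cons m (t.orderEmbOfFin htc), mem_listTuples.2 ⟨?_, by simp⟩, ?_⟩
  · rw [Fin.cons_injective_iff]
    refine ⟨?_, (t.orderEmbOfFin htc).injective⟩
    rintro ⟨i, hi⟩
    exact (hb i).2 hi
  · intro i
    refine Fin.cases ?_ (fun i => ?_) i
    · simp
    · simpa using (hb i).1

/-- On the event the likelihood of `x₀` is at most the geometric mean of the `L + 1` likelihoods,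
whose integral factors over letters into `∏ exp (-bhatt)`. -/
lemma outputLaw_le_exp_wordDist {σ : ℝ} (hσ : 0 < σ) {L n : ℕ} (x₀ : Fin n → ℝ)
    (x : Fin (L + 1) → Fin n → ℝ) :
    outputLaw σ x₀ {y | ∀ i, likelihood σ x₀ y ≤ likelihood σ (x i) y} ≤
      ENNReal.ofReal (Real.exp (-wordDist σ x)) := by
  have hv : 0 < σ ^ 2 := by positivity
  have hL : (0 : ℝ) < L + 1 := by positivity
  have hM : MeasurableSet {y | ∀ i, likelihood σ x₀ y ≤ likelihood σ (x i) y} := by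
    have : {y | ∀ i, likelihood σ x₀ y ≤ likelihood σ (x i) y} =
        ⋂ i, {y | likelihood σ x₀ y ≤ likelihood σ (x i) y} := by ext; simp
    rw [this]
    exact MeasurableSet.iInter fun i => measurableSet_le (by fun_prop) (by fun_prop)
  unfold outputLaw
  rw [pi_gaussianReal hv, withDensity_apply _ hM]
  set g : Fin n → ℝ → ENNReal := fun t y =>
    ENNReal.ofReal (∏ i, gaussianPDFReal (x i t) (σ ^ 2).toNNReal y ^ ((1 : ℝ) / (L + 1))) with hg
  have hg0 : ∀ t y, 0 ≤ ∏ i, gaussianPDFReal (x i t) (σ ^ 2).toNNReal y ^ ((1 : ℝ) / (L + 1)) :=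
    fun t y => Finset.prod_nonneg fun i _ => Real.rpow_nonneg (gaussianPDFReal_nonneg _ _ _) _
  calc _ ≤ ∫⁻ y in {y | ∀ i, likelihood σ x₀ y ≤ likelihood σ (x i) y}, ∏ t, g t (y t) := by
        refine setLIntegral_mono' hM fun y hy => ?_
        rw [hg, ← ENNReal.ofReal_prod_of_nonneg fun t _ => hg0 t _]
        refine ENNReal.ofReal_le_ofReal ?_
        have e1 : likelihood σ x₀ y =
            ∏ _i : Fin (L + 1), likelihood σ x₀ y ^ ((1 : ℝ) / (L + 1)) := by
          rw [Finset.prod_const, Finset.card_univ, Fintype.card_fin,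
            ← Real.rpow_mul_natCast (likelihood_pos hσ _ _).le]
          have : (1 : ℝ) / (L + 1) * ((L + 1 : ℕ) : ℝ) = 1 := by push_cast; field_simp
          rw [this, Real.rpow_one]
        have e2 : ∏ t, ∏ i, gaussianPDFReal (x i t) (σ ^ 2).toNNReal (y t) ^ ((1 : ℝ) / (L + 1)) =
            ∏ i, likelihood σ (x i) y ^ ((1 : ℝ) / (L + 1)) := by
          rw [Finset.prod_comm]
          exact Finset.prod_congr rfl fun i _ =>
            Real.finsetProd_rpow _ _ (fun t _ => gaussianPDFReal_nonneg _ _ _) _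
        change likelihood σ x₀ y ≤ _
        rw [e2, e1]
        exact Finset.prod_le_prod (fun i _ => Real.rpow_nonneg (likelihood_pos hσ _ _).le _)
          fun i _ => Real.rpow_le_rpow (likelihood_pos hσ _ _).le (hy i) (by positivity)
    _ ≤ ∫⁻ y : Fin n → ℝ, ∏ t, g t (y t) := setLIntegral_le_lintegral _ _
    _ = ∏ t, ∫⁻ y, g t y := by
        rw [volume_pi, lintegral_fin_prod_eq_prod fun t => by fun_prop]
    _ = ∏ t, ENNReal.ofReal (Real.exp (-bhatt σ fun i => x i t)) := by
        refine Finset.prod_congr rfl fun t _ => ?_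
        rw [← integral_prod_gaussianPDFReal_rpow_eq_exp_bhatt hσ,
          ofReal_integral_eq_lintegral_ofReal _ (ae_of_all _ (hg0 t))]
        simp only [prod_gaussianPDFReal_rpow hv]
        exact (integrable_gaussianPDFReal _ _).const_mul _
    _ = _ := by
        rw [← ENNReal.ofReal_prod_of_nonneg fun t _ => (Real.exp_pos _).le, ← Real.exp_sum,
          Finset.sum_neg_distrib, wordDist]

lemma listErrorProb_le {σ : ℝ} (hσ : 0 < σ) {L n M : ℕ} (C : Fin M → Fin n → ℝ) (m : Fin M) :
    listErrorProb σ L C m ≤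
      ∑ e ∈ listTuples L m, ENNReal.ofReal (Real.exp (-wordDist σ fun i => C (e i))) := by
  unfold listErrorProb
  calc _ ≤ outputLaw σ (C m) (⋃ e ∈ listTuples L m,
        {y | ∀ i, likelihood σ (C m) y ≤ likelihood σ (C (e i)) y}) := by
        refine measure_mono fun y hy => ?_
        obtain ⟨e, he, h⟩ := exists_listTuples_of_notMem_mlList hy
        exact mem_iUnion₂.2 ⟨e, he, h⟩
    _ ≤ _ := (measure_biUnion_finset_le _ _).trans
        (Finset.sum_le_sum fun e _ => outputLaw_le_exp_wordDist hσ _ _)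

/-! ### The moment generating function of the distance over the spherical ensemble -/

lemma abs_empCorr_toSph_le {S : ℝ} (hS : 0 < S) {n : ℕ} {x y : Fin n → ℝ} (hx : OnSphere S x)
    (hy : OnSphere S y) : |empCorr S x y| ≤ 1 := by
  unfold OnSphere at hx hy
  have h := Finset.sum_mul_sq_le_sq_mul_sq Finset.univ x y
  rw [hx, hy] at h
  have hn : (0 : ℝ) ≤ n * S := by positivity
  have h2 : |∑ t, x t * y t| ≤ n * S := abs_le_of_sq_le_sq (by nlinarith) hn
  unfold empCorr
  rw [abs_div, abs_of_nonneg hn]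
  exact div_le_one_of_le₀ h2 hn

lemma onSphere_toSph {S : ℝ} (hS : 0 < S) {n : ℕ} {x : Fin n → ℝ} (hx : 0 < empCorr S x x) :
    OnSphere S (toSph S x) := by
  have h : 0 < ∑ t, x t ^ 2 := by
    by_contra h
    have h0 : ∑ t, x t ^ 2 = 0 :=
      le_antisymm (not_lt.1 h) (Finset.sum_nonneg fun t _ => sq_nonneg _)
    simp only [sq] at h0
    simp [empCorr, h0] at hx
  unfold OnSphere toSph
  simp only [mul_pow, div_pow, ← Finset.mul_sum, ← Finset.sum_div]
  rw [Real.sq_sqrt (by positivity), Real.sq_sqrt h.le, div_self h.ne', mul_one]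

lemma symSlope_eq_invCoeff (L : ℕ) (ρ : ℝ) : symSlope L ρ = L * (L + 1) / 2 * invCoeff L ρ := by
  unfold symSlope invCoeff
  rw [div_mul_div_comm, mul_comm (1 - ρ)]

lemma gramRatio_symMatrix {L : ℕ} (hL : 1 ≤ L) (S : ℝ) {ρ : ℝ} (h0 : 0 ≤ ρ) (h1 : ρ < 1) {n : ℕ}
    (x : Fin (L + 1) → Fin n → ℝ) :
    gramRatio S (symMatrix L ρ) x = Real.exp (n * (symInfo L ρ -
      L * ρ * invCoeff L ρ / 2 * ∑ i, empCorr S (x i) (x i) +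
      invCoeff L ρ * ∑ i, ∑ j ∈ Finset.Ioi i, empCorr S (x i) (x j))) := by
  have hL' : (0 : ℝ) < L := by exact_mod_cast hL
  have hneg : -1 / (L : ℝ) < 0 := div_neg_of_neg_of_pos (by norm_num) hL'
  have hc : ∀ i j, empCorr S (x i) (x j) = empCorr S (x j) (x i) := fun i j => by
    simp only [empCorr, mul_comm]
  rw [gramRatio, ← symInfo_eq_log_det hL (hneg.trans_le h0) h1,
    inv_symMatrix (one_add_mul_pos h0) h1]
  simp only [Matrix.of_apply]
  rw [sum_sum_eq_diag_add_two_mul _ fun i j => by rw [hc i j]; simp only [eq_comm]]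
  have e : ∑ i : Fin (L + 1), ∑ j ∈ Finset.Ioi i,
      (if i = j then 1 + L * ρ * invCoeff L ρ else -invCoeff L ρ) * empCorr S (x i) (x j) =
      -invCoeff L ρ * ∑ i, ∑ j ∈ Finset.Ioi i, empCorr S (x i) (x j) := by
    simp only [Finset.mul_sum]
    exact Finset.sum_congr rfl fun i _ => Finset.sum_congr rfl fun j hj => by
      rw [if_neg (Finset.mem_Ioi.1 hj).ne]
  rw [e]
  simp only [if_true, ← Finset.mul_sum]
  congr 1
  ring

/-- Both exponents are affine in the mean correlation, and `hs` matches their slopes: weighting by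
`exp (-s · wordDist)` is, up to a constant, tilting to the symmetric law with parameter `ρ`.
Replacing words by their directions and unit energies by shell energies costs `L (L + 1) / 2 ·
invCoeff L ρ · η` each per letter. -/
lemma exp_wordDist_toSph_le {S σ : ℝ} (hS : 0 < S) (hσ : 0 < σ) {L : ℕ} (hL : 1 ≤ L) {ρ s η : ℝ}
    (h0 : 0 ≤ ρ) (h1 : ρ < 1) (hs : s * distSlope S σ L = symSlope L ρ)
    (hη0 : 0 < η) (hη1 : η < 1) {n : ℕ} (hn : 1 ≤ n) {x : Fin (L + 1) → Fin n → ℝ}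
    (hx : ∀ i, x i ∈ shell S η n) :
    Real.exp (-(s * wordDist σ fun i => toSph S (x i))) ≤
      Real.exp (-(n * (s * symDist S σ L ρ + symInfo L ρ - L * (L + 1) * invCoeff L ρ * η))) *
        gramRatio S (symMatrix L ρ) x := by
  have hL' : (0 : ℝ) < L := by exact_mod_cast hL
  have hn' : (0 : ℝ) < n := by exact_mod_cast hn
  have hsph : ∀ i, OnSphere S (toSph S (x i)) := fun i =>
    onSphere_toSph hS (by have := (abs_le.1 (show |empCorr S (x i) (x i) - 1| ≤ η from hx i)).1; linarith)
  have ha : 0 ≤ invCoeff L ρ := by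
    have := one_add_mul_pos (L := L) h0
    have : 0 < 1 - ρ := by linarith
    unfold invCoeff; positivity
  rw [gramRatio_symMatrix hL S h0 h1, ← Real.exp_add, Real.exp_le_exp, wordDist,
    sum_bhatt_eq hS hσ hL hn _ hsph, distForm_eq_symDist S σ hL, symDist_eq, symDist_eq]
  set c := fun i j => empCorr S (x i) (x j) with hc
  set d := fun i j => empCorr S (toSph S (x i)) (toSph S (x j)) with hd
  set a := invCoeff L ρ with haa
  have hslope := symSlope_eq_invCoeff L ρ
  have hmean : symSlope L ρ * offMean (Matrix.of d) = a * ∑ i, ∑ j ∈ Finset.Ioi i, d i j := by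
    have := two_mul_sum_Ioi_eq hL (Matrix.of d)
    simp only [Matrix.of_apply] at this
    rw [hslope]
    linear_combination (-a / 2) * this
  have hdiff : ∑ i, ∑ j ∈ Finset.Ioi i, d i j - ∑ i, ∑ j ∈ Finset.Ioi i, c i j ≤
      L * (L + 1) / 2 * η := by
    have e := two_mul_sum_Ioi_one L
    calc _ = ∑ i, ∑ j ∈ Finset.Ioi i, (d i j - c i j) := by simp only [Finset.sum_sub_distrib]
      _ ≤ ∑ i : Fin (L + 1), ∑ _j ∈ Finset.Ioi i, 1 * η := by
          refine Finset.sum_le_sum fun i _ => Finset.sum_le_sum fun j _ => ?_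
          have hp := abs_sqrt_mul_sqrt_sub_one_le hη0.le hη1.le (hx i) (hx j)
          have hd1 := abs_empCorr_toSph_le hS (hsph i) (hsph j)
          have e := empCorr_eq_mul_toSph hS hn (x i) (x j)
          have e2 : d i j - c i j =
              -((√(empCorr S (x i) (x i)) * √(empCorr S (x j) (x j)) - 1) * d i j) := by
            simp only [hc, hd]; rw [e]; ring
          rw [e2]
          refine (le_abs_self _).trans ?_
          rw [abs_neg, abs_mul, mul_comm]
          exact mul_le_mul hd1 hp (abs_nonneg _) zero_le_one
      _ = L * (L + 1) / 2 * η := by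
          simp only [← Finset.sum_mul]
          linear_combination (η / 2) * e
  have hdiag : ∑ i, c i i ≤ (L + 1) * (1 + η) := by
    calc ∑ i, c i i ≤ ∑ _i : Fin (L + 1), (1 + η) :=
          Finset.sum_le_sum fun i _ => by
            have := (abs_le.1 (show |empCorr S (x i) (x i) - 1| ≤ η from hx i)).2
            simp only [hc]; linarith
      _ = _ := by simp; ring
  have hkey : -(s * (distSlope S σ L * (1 - offMean (Matrix.of d)))) ≤
      -(s * (distSlope S σ L * (1 - ρ)) + symInfo L ρ - L * (L + 1) * a * η) +
        (symInfo L ρ - L * ρ * a / 2 * ∑ i, c i i + a * ∑ i, ∑ j ∈ Finset.Ioi i, c i j) := by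
    rw [← mul_assoc, ← mul_assoc, hs]
    have m1 := mul_le_mul_of_nonneg_left hdiff ha
    have m2 := mul_le_mul_of_nonneg_left hdiag (by positivity : 0 ≤ L * ρ * a / 2)
    have m3 : L * ρ * a / 2 * ((L + 1) * η) ≤ L * 1 * a / 2 * ((L + 1) * η) := by gcongr
    have e3 : symSlope L ρ * ρ = L * ρ * a / 2 * (L + 1) := by rw [hslope]; ring
    nlinarith
  have := mul_le_mul_of_nonneg_left hkey hn'.le
  linarith

/-- The exponent of the moment generating function of the distance. -/
lemma eventually_lintegral_exp_wordDist_le {S σ : ℝ} (hS : 0 < S) (hσ : 0 < σ) {L : ℕ}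
    (hL : 1 ≤ L) {ρ s δ : ℝ} (h0 : 0 ≤ ρ) (h1 : ρ < 1)
    (hs : s * distSlope S σ L = symSlope L ρ) (hδ : 0 < δ) :
    ∀ᶠ n : ℕ in atTop, ∫⁻ u, ENNReal.ofReal (Real.exp (-(s * wordDist σ u)))
        ∂(Measure.pi fun _ : Fin (L + 1) => uniformSphere n S) ≤
      ENNReal.ofReal (Real.exp (-(n * (s * symDist S σ L ρ + symInfo L ρ - δ)))) := by
  have hL' : (0 : ℝ) < L := by exact_mod_cast hL
  have hneg : -1 / (L : ℝ) < 0 := div_neg_of_neg_of_pos (by norm_num) hL'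
  have hP := ((isCorr_symMatrix_iff hL ρ).2 ⟨hneg.trans_le h0, h1⟩).1
  have ha : 0 ≤ invCoeff L ρ := by
    have := one_add_mul_pos (L := L) h0
    have : 0 < 1 - ρ := by linarith
    unfold invCoeff; positivity
  set b := L * (L + 1) * invCoeff L ρ with hb
  have hb0 : 0 ≤ b := by positivity
  -- This gives `b η ≤ δ / 2`; the `+ 1` covers `b = 0`, which happens at `ρ = 0`.
  set η := min (1 / 2) (δ / (2 * (b + 1))) with hη
  have hη0 : 0 < η := by positivity
  have hη1 : η < 1 := (min_le_left _ _).trans_lt (by norm_num)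
  have hη2 : b * η ≤ δ / 2 := by
    have := min_le_right (1 / 2) (δ / (2 * (b + 1)))
    rw [← hη, le_div_iff₀ (by positivity)] at this
    nlinarith
  filter_upwards [eventually_half_le_shell hS hη0 L, eventually_ge_atTop 1,
    eventually_const_le_exp (c := 2) (half_pos hδ)] with n hsh hn h2
  have hn' : (0 : ℝ) ≤ n := by positivity
  have hmw := measurable_wordDist hσ L n
  have e := lintegral_toSph_shell hS hn (L + 1) η
    (f := fun u => ENNReal.ofReal (Real.exp (-(s * wordDist σ u)))) (by fun_prop)
  set J := ∫⁻ u, ENNReal.ofReal (Real.exp (-(s * wordDist σ u)))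
        ∂(Measure.pi fun _ : Fin (L + 1) => uniformSphere n S) with hJ
  set c := Real.exp (-(n * (s * symDist S σ L ρ + symInfo L ρ - b * η))) with hc
  have hle : ENNReal.ofReal (1 / 2) * J ≤ ENNReal.ofReal c := by
    calc _ ≤ gaussVec S n (shell S η n) ^ (L + 1) * J := by gcongr
      _ = _ := e.symm
      _ ≤ ∫⁻ x in univ.pi fun _ => shell S η n,
            ENNReal.ofReal c * (ENNReal.ofReal (gramRatio S (symMatrix L ρ) x) * 1)
            ∂(Measure.pi fun _ : Fin (L + 1) => gaussVec S n) := by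
          refine setLIntegral_mono' (MeasurableSet.univ_pi fun _ => measurableSet_shell S η n)
            fun x hx => ?_
          rw [mul_one, ← ENNReal.ofReal_mul (Real.exp_pos _).le]
          exact ENNReal.ofReal_le_ofReal (exp_wordDist_toSph_le hS hσ hL h0 h1 hs hη0 hη1 hn
            fun i => hx i (mem_univ i))
      _ ≤ _ := setLIntegral_le_lintegral _ _
      -- The tilting density `gramRatio` integrates to one.
      _ = ENNReal.ofReal c := by
          rw [lintegral_const_mul _ (by fun_prop), ← lintegral_gramRatio hS hP hn
            (f := fun _ => 1) measurable_const]
          simp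
  calc J = ENNReal.ofReal 2 * (ENNReal.ofReal (1 / 2) * J) := by
        rw [← mul_assoc, ← ENNReal.ofReal_mul (by norm_num)]; norm_num
    _ ≤ ENNReal.ofReal 2 * ENNReal.ofReal c := by gcongr
    _ = ENNReal.ofReal (2 * c) := (ENNReal.ofReal_mul (by norm_num)).symm
    _ ≤ _ := by
        refine ENNReal.ofReal_le_ofReal ?_
        have e : Real.exp (-(n * (s * symDist S σ L ρ + symInfo L ρ - δ))) =
            c * Real.exp (n * (δ - b * η)) := by
          rw [hc, ← Real.exp_add]; ring_nf
        have h4 : (2 : ℝ) ≤ Real.exp (n * (δ - b * η)) :=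
          h2.trans (Real.exp_le_exp.2 (mul_le_mul_of_nonneg_left (by linarith) hn'))
        rw [e]
        nlinarith [Real.exp_pos (-(n * (s * symDist S σ L ρ + symInfo L ρ - b * η)))]

/-! ### Expurgation -/

/-- Distinct messages carry independent codewords, so every injective tuple has the law of the `L +
1` independent words. -/
lemma pi_map_comp_injective {ι κ X : Type*} [Fintype ι] [Fintype κ] [MeasurableSpace X]
    (μ : Measure X) [IsProbabilityMeasure μ] {φ : κ → ι} (hφ : Function.Injective φ) :
    (Measure.pi fun _ : ι => μ).map (fun x i => x (φ i)) = Measure.pi fun _ : κ => μ := by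
  have h := (iIndepFun_pi (μ := fun _ : ι => μ) (X := fun _ x => x)
    fun _ => aemeasurable_id).precomp hφ
  rw [iIndepFun_iff_map_fun_eq_pi_map fun i => (measurable_pi_apply _).aemeasurable] at h
  rw [h]
  congr 1
  ext1 i
  exact (measurePreserving_eval (fun _ : ι => μ) (φ i)).map_eq

/-- If the average of `G` over `2M` indices is at most `b`, then `M` of the values are at most
`2b`. -/
lemma exists_embedding_le_two_mul {M : ℕ} {G : Fin (2 * M) → ENNReal} {b : ENNReal} (hb0 : b ≠ 0)
    (hb : b ≠ ⊤) (h : ∑ m, G m ≤ (2 * M : ℕ) * b) :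
    ∃ φ : Fin M → Fin (2 * M), Function.Injective φ ∧ ∀ m, G (φ m) ≤ 2 * b := by
  classical
  set bad := Finset.univ.filter fun m => 2 * b < G m with hbad
  -- Markov's inequality: at most half of the `2M` values exceed twice the average bound.
  have h1 : (bad.card : ENNReal) * (2 * b) ≤ M * (2 * b) := by
    calc (bad.card : ENNReal) * (2 * b) = ∑ _m ∈ bad, 2 * b := by simp
      _ ≤ ∑ m ∈ bad, G m := Finset.sum_le_sum fun m hm => (Finset.mem_filter.1 hm).2.le
      _ ≤ ∑ m, G m := Finset.sum_le_sum_of_subset (Finset.subset_univ _)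
      _ ≤ _ := h
      _ = M * (2 * b) := by push_cast; ring
  have h2 : bad.card ≤ M := by
    rw [ENNReal.mul_le_mul_iff_left (by simpa using hb0)
      (ENNReal.mul_ne_top (by simp) hb)] at h1
    exact_mod_cast h1
  have h3 : M ≤ badᶜ.card := by
    rw [Finset.card_compl, Fintype.card_fin]; omega
  obtain ⟨t, ht, htc⟩ := Finset.exists_subset_card_eq h3
  refine ⟨t.orderEmbOfFin htc, (t.orderEmbOfFin htc).injective, fun m => ?_⟩
  have := ht (t.orderEmbOfFin_mem htc m)
  simpa [hbad] using this

lemma sum_rpow_le {ι : Type*} (t : Finset ι) (w : ι → ENNReal) {s : ℝ} (hs0 : 0 < s) (hs1 : s ≤ 1) :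
    (∑ i ∈ t, w i) ^ s ≤ ∑ i ∈ t, w i ^ s :=
  Finset.le_sum_of_subadditive (fun x : ENNReal => x ^ s) (ENNReal.zero_rpow_of_pos hs0).le
    (fun x y => ENNReal.rpow_add_le_add_rpow x y hs0.le hs1) t w

/-- The first coordinate determines `m`, so these are disjoint sets of functions from `Fin (L + 1)`
to `Fin N`. -/
lemma card_sigma_listTuples_le (L N : ℕ) : ∑ m : Fin N, (listTuples L m).card ≤ N ^ (L + 1) := by
  classical
  have : ∑ m : Fin N, (listTuples L m).card =
      ((Finset.univ : Finset (Fin N)).biUnion fun m => listTuples L m).card := by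
    rw [Finset.card_biUnion]
    intro a _ b _ hab
    rw [Function.onFun, Finset.disjoint_left]
    intro e ha hb
    exact hab ((mem_listTuples.1 ha).2.symm.trans (mem_listTuples.1 hb).2)
  rw [this]
  exact (Finset.card_le_univ _).trans (by simp)

/-- Passing to a subcode only removes competing tuples, so the union bound survives expurgation. -/
lemma sum_listTuples_comp_le {L M N : ℕ} {φ : Fin M → Fin N} (hφ : Function.Injective φ)
    (w : (Fin (L + 1) → Fin N) → ENNReal) (m : Fin M) :
    ∑ e ∈ listTuples L m, w (φ ∘ e) ≤ ∑ e ∈ listTuples L (φ m), w e := by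
  classical
  rw [← Finset.sum_image (g := fun e : Fin (L + 1) → Fin M => φ ∘ e)
    fun a _ b _ hab => hφ.comp_left hab]
  refine Finset.sum_le_sum_of_subset fun e he => ?_
  obtain ⟨e', he', rfl⟩ := Finset.mem_image.1 he
  obtain ⟨hi, h0⟩ := mem_listTuples.1 he'
  exact mem_listTuples.2 ⟨hφ.comp hi, by simp [h0]⟩

lemma listErrorProb_rpow_le {σ : ℝ} (hσ : 0 < σ) {L n M : ℕ} (C : Fin M → Fin n → ℝ) (m : Fin M)
    {s : ℝ} (hs0 : 0 < s) (hs1 : s ≤ 1) :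
    listErrorProb σ L C m ^ s ≤ ∑ e ∈ listTuples L m,
      ENNReal.ofReal (Real.exp (-(s * wordDist σ fun i => C (e i)))) := by
  refine (ENNReal.rpow_le_rpow (listErrorProb_le hσ C m) hs0.le).trans
    ((sum_rpow_le _ _ hs0 hs1).trans_eq (Finset.sum_congr rfl fun e _ => ?_))
  rw [ENNReal.ofReal_rpow_of_pos (Real.exp_pos _), ← Real.exp_mul, neg_mul, mul_comm s]

/-- Random coding with expurgation. -/
lemma exists_code_listErrorProb_le {S σ : ℝ} (hS : 0 < S) (hσ : 0 < σ) {L n : ℕ} (hn : 1 ≤ n)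
    {s t : ℝ} (hs0 : 0 < s) (hs1 : s ≤ 1) (ht : 0 < t)
    (hJ : ∫⁻ u, ENNReal.ofReal (Real.exp (-(s * wordDist σ u)))
        ∂(Measure.pi fun _ : Fin (L + 1) => uniformSphere n S) ≤ ENNReal.ofReal t)
    {M : ℕ} (hM : 1 ≤ M) :
    ∃ C : Fin M → Fin n → ℝ, (∀ m, OnSphere S (C m)) ∧
      ∀ m, listErrorProb σ L C m ≤ ENNReal.ofReal ((2 * ((2 * M) ^ L * t)) ^ s⁻¹) := by
  have := isProbabilityMeasure_uniformSphere hn S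
  set N := 2 * M with hN
  set U := uniformSphere n S
  set W : (Fin (L + 1) → Fin n → ℝ) → ENNReal :=
    fun u => ENNReal.ofReal (Real.exp (-(s * wordDist σ u))) with hW
  have hmw := measurable_wordDist hσ L n
  have hWm : Measurable W := by fun_prop
  set F : (Fin N → Fin n → ℝ) → ENNReal :=
    fun X => ∑ m, ∑ e ∈ listTuples L m, W fun i => X (e i) with hF
  have hFm : Measurable F := by
    refine Finset.measurable_fun_sum _ fun m _ => Finset.measurable_fun_sum _ fun e _ => ?_
    exact hWm.comp (by fun_prop)
  have hFint : ∫⁻ X, F X ∂(Measure.pi fun _ : Fin N => U) ≤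
      (N : ENNReal) * ENNReal.ofReal ((2 * M) ^ L * t) := by
    have e1 : ∀ m, ∀ e ∈ listTuples L m,
        ∫⁻ X, W (fun i => X (e i)) ∂(Measure.pi fun _ : Fin N => U) ≤ ENNReal.ofReal t := by
      intro m e he
      rw [← lintegral_map (f := W) (g := fun (X : Fin N → Fin n → ℝ) i => X (e i)) hWm
        (by fun_prop), pi_map_comp_injective U (mem_listTuples.1 he).1]
      exact hJ
    have hm : ∀ e : Fin (L + 1) → Fin N,
        Measurable fun X : Fin N → Fin n → ℝ => W fun i => X (e i) := fun e =>
      hWm.comp (by fun_prop)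
    rw [hF, lintegral_finsetSum _ fun m _ => Finset.measurable_fun_sum _ fun e _ => hm e]
    calc _ ≤ ∑ m : Fin N, ((listTuples L m).card : ENNReal) * ENNReal.ofReal t := by
          refine Finset.sum_le_sum fun m _ => ?_
          rw [lintegral_finsetSum _ fun e _ => hm e]
          exact (Finset.sum_le_sum (e1 m)).trans (by simp)
      _ = ((∑ m : Fin N, (listTuples L m).card : ℕ) : ENNReal) * ENNReal.ofReal t := by
          rw [← Finset.sum_mul]; push_cast; rfl
      _ ≤ ((N ^ (L + 1) : ℕ) : ENNReal) * ENNReal.ofReal t := by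
          gcongr
          exact card_sigma_listTuples_le L N
      _ = _ := by
          have : (2 * (M : ℝ)) ^ L = ((N ^ L : ℕ) : ℝ) := by rw [hN]; push_cast; ring
          rw [this, ENNReal.ofReal_mul (by positivity), ENNReal.ofReal_natCast]
          push_cast
          ring
  have hnull : (Measure.pi fun _ : Fin N => U) {X | ¬ ∀ m, OnSphere S (X m)} = 0 := by
    rw [← ae_iff, ae_all_iff]
    intro m
    exact (measurePreserving_eval (fun _ : Fin N => U) m).quasiMeasurePreserving.ae
      (ae_onSphere_uniformSphere hS)
  -- Some sample has all its words on the sphere and a total no larger than the mean.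
  obtain ⟨X, hX, hXle⟩ := exists_notMem_null_le_lintegral hFm.aemeasurable hnull
  simp only [mem_ofPred_eq, not_not] at hX
  have hMpos : (0 : ℝ) < M := by exact_mod_cast hM
  have hb : 0 < (2 * (M : ℝ)) ^ L * t := by positivity
  obtain ⟨φ, hφ, hφle⟩ := exists_embedding_le_two_mul
    (G := fun m => ∑ e ∈ listTuples L m, W fun i => X (e i))
    (b := ENNReal.ofReal ((2 * M) ^ L * t)) (by simpa using hb) ENNReal.ofReal_ne_top
    (hXle.trans hFint)
  refine ⟨fun m => X (φ m), fun m => hX _, fun m => ?_⟩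
  have h1 : listErrorProb σ L (fun m => X (φ m)) m ^ s ≤
      ENNReal.ofReal (2 * ((2 * M) ^ L * t)) := by
    rw [ENNReal.ofReal_mul (p := 2) (by norm_num), ENNReal.ofReal_ofNat]
    exact (listErrorProb_rpow_le hσ (fun m => X (φ m)) m hs0 hs1).trans
      ((sum_listTuples_comp_le hφ (fun e => W fun i => X (e i)) m).trans (hφle m))
  have h2 := ENNReal.rpow_le_rpow h1 (inv_nonneg.2 hs0.le)
  rwa [← ENNReal.rpow_mul, mul_inv_cancel₀ hs0.ne', ENNReal.rpow_one,
    ENNReal.ofReal_rpow_of_pos (by positivity)] at h2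

/-- A diagonal choice: witnesses for each tolerance give one sequence good for all of them. -/
lemma exists_diagonal {α : ℕ → Type*} {Q : (n : ℕ) → α n → ℝ → Prop} (d : ∀ n, α n)
    (hmono : ∀ n a δ δ', δ ≤ δ' → Q n a δ → Q n a δ')
    (h : ∀ δ > 0, ∀ᶠ n in atTop, ∃ a, Q n a δ) :
    ∃ a : ∀ n, α n, ∀ δ > 0, ∀ᶠ n in atTop, Q n (a n) δ := by
  classical
  set P : ℕ → ℕ → Prop := fun n k => ∃ a, Q n a (1 / ((k : ℝ) + 1)) with hP
  -- At length `n` take the best tolerance `1/(k + 1)` with `k ≤ n` that has a witness. Each fixed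
  -- `k` is eventually available, so `K n` eventually exceeds it and the default is not used.
  set K : ℕ → ℕ := fun n => Nat.findGreatest (P n) n with hK
  refine ⟨fun n => if hn : P n (K n) then hn.choose else d n, fun δ hδ => ?_⟩
  obtain ⟨k, hk⟩ := exists_nat_one_div_lt hδ
  filter_upwards [h (1 / ((k : ℝ) + 1)) (by positivity), eventually_ge_atTop k] with n hn hkn
  have hspec : P n (K n) := Nat.findGreatest_spec hkn hn
  have hle : k ≤ K n := Nat.le_findGreatest hkn hn
  rw [dif_pos hspec]
  refine hmono n _ _ _ ?_ hspec.choose_spec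
  refine le_trans ?_ hk.le
  gcongr

lemma ceil_exp_add_one_le {x : ℝ} (hx : 0 ≤ x) :
    ((⌈Real.exp x⌉₊ + 1 : ℕ) : ℝ) ≤ 3 * Real.exp x := by
  have h1 := Nat.ceil_lt_add_one (Real.exp_pos x).le
  have h2 := Real.one_le_exp hx
  push_cast
  linarith

/-- Codes on the sphere attaining the exponent `D(ρ) + (I(ρ) - LR) / s`. -/
lemma eventually_exists_code {S σ : ℝ} (hS : 0 < S) (hσ : 0 < σ) {L : ℕ} (hL : 1 ≤ L)
    {ρ s R δ : ℝ} (h0 : 0 ≤ ρ) (h1 : ρ < 1) (hs0 : 0 < s) (hs1 : s ≤ 1)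
    (hs : s * distSlope S σ L = symSlope L ρ) (hR : 0 < R) (hδ : 0 < δ) :
    ∀ᶠ n : ℕ in atTop, ∃ C : Fin (⌈Real.exp (n * R)⌉₊ + 1) → Fin n → ℝ, (∀ m, OnSphere S (C m)) ∧
      ∀ m, listErrorProb σ L C m ≤ ENNReal.ofReal
        (Real.exp (-(n * (symDist S σ L ρ + (symInfo L ρ - L * R) / s - δ)))) := by
  -- Taking the power `1/s` divides slacks by `s`, so the budget is `s δ`: half for the moment
  -- generating function, half for the constant `2 · 6 ^ L` that comes from `2M ≤ 6 e^{nR}`.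
  filter_upwards [eventually_lintegral_exp_wordDist_le hS hσ hL h0 h1 hs
      (show 0 < s * δ / 2 by positivity), eventually_ge_atTop 1,
    eventually_const_le_exp (c := 2 * 6 ^ L) (show 0 < s * δ / 2 by positivity)] with n hn hn1 hc
  have hn0 : (0 : ℝ) ≤ n := by positivity
  obtain ⟨C, hC, hle⟩ := exists_code_listErrorProb_le hS hσ hn1 hs0 hs1 (Real.exp_pos _) hn
    (M := ⌈Real.exp (n * R)⌉₊ + 1) (by omega)
  refine ⟨C, hC, fun m => (hle m).trans (ENNReal.ofReal_le_ofReal ?_)⟩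
  have hM := ceil_exp_add_one_le (show 0 ≤ n * R by positivity)
  have hbase : 2 * ((2 * ((⌈Real.exp (n * R)⌉₊ + 1 : ℕ) : ℝ)) ^ L *
      Real.exp (-(n * (s * symDist S σ L ρ + symInfo L ρ - s * δ / 2)))) ≤
      Real.exp (-(n * (s * symDist S σ L ρ + symInfo L ρ - L * R - s * δ))) := by
    calc _ ≤ 2 * ((2 * (3 * Real.exp (n * R))) ^ L *
          Real.exp (-(n * (s * symDist S σ L ρ + symInfo L ρ - s * δ / 2)))) := by gcongr
      _ = 2 * 6 ^ L * Real.exp (L * (n * R) +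
          -(n * (s * symDist S σ L ρ + symInfo L ρ - s * δ / 2))) := by
          rw [Real.exp_add, Real.exp_nat_mul _ L, show ∀ x : ℝ, 2 * (3 * x) = 6 * x by intro x; ring,
            mul_pow, mul_assoc, mul_assoc]
      _ ≤ Real.exp (n * (s * δ / 2)) * Real.exp (L * (n * R) +
          -(n * (s * symDist S σ L ρ + symInfo L ρ - s * δ / 2))) := by gcongr
      _ = _ := by rw [← Real.exp_add]; ring_nf
  refine (Real.rpow_le_rpow (by positivity) hbase (by positivity)).trans (le_of_eq ?_)
  rw [← Real.exp_mul]
  congr 1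
  field_simp
  ring

lemma onSphere_const {S : ℝ} (hS : 0 < S) (n : ℕ) : OnSphere S (fun _ : Fin n => √S) := by
  simp [OnSphere, Real.sq_sqrt hS.le]

/-- The expurgated exponent is achievable. -/
lemma exists_codes_ckmExponent {S σ : ℝ} (hS : 0 < S) (hσ : 0 < σ) {L : ℕ} (hL : 1 ≤ L)
    {ρ₀ : ℝ} (h0 : 0 < ρ₀) (h1 : ρ₀ < 1) (h : symSlope L ρ₀ = distSlope S σ L)
    {R : ℝ} (hR : 0 < R) :
    ∃ C : (n : ℕ) → Fin (⌈Real.exp (n * R)⌉₊ + 1) → Fin n → ℝ,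
      (∀ n m, OnSphere S (C n m)) ∧
      ∀ δ > 0, ∀ᶠ n : ℕ in atTop, ∀ m,
        listErrorProb σ L (C n) m ≤
          ENNReal.ofReal (Real.exp (-(n * (ckmExponent S σ L R - δ)))) := by
  obtain ⟨a, b, c⟩ := symRho_spec hL hR.le
  have hk := distSlope_pos hS hσ hL
  set ρ := min (symRho L R) ρ₀ with hρ
  have hρ0 : 0 < ρ := lt_min (symRho_pos hL hR) h0
  have hρ1 : ρ < 1 := (min_le_right _ _).trans_lt h1
  -- The tilting relation forces this `s`. It is positive because `R > 0` makes `ρ > 0`, and at most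
  -- one because `ρ ≤ ρ₀`.
  set s := symSlope L ρ / distSlope S σ L with hs
  have hs0 : 0 < s := div_pos (symSlope_pos hL hρ0 hρ1) hk
  have hs1 : s ≤ 1 := by
    rw [hs, div_le_one hk, ← h]
    exact (strictMonoOn_symSlope hL).monotoneOn ⟨hρ0.le, hρ1⟩ ⟨h0.le, h1⟩ (min_le_right _ _)
  have hE : ckmExponent S σ L R = symDist S σ L ρ + (symInfo L ρ - L * R) / s := by
    rw [ckmExponent_eq hS hσ hL h0 h1 h hR, ← hρ]
    -- On the curved part the rate term `I(ρ) - L R` vanishes; on the affine part `s = 1`.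
    rcases le_total (symRho L R) ρ₀ with hle | hle
    · have : symInfo L ρ = L * R := by rw [hρ, min_eq_left hle, c]
      rw [this]; simp
    · have : s = 1 := by rw [hs, hρ, min_eq_right hle, h, div_self hk.ne']
      rw [this]; ring
  obtain ⟨C, hC⟩ := exists_diagonal
    (α := fun n => {C : Fin (⌈Real.exp (n * R)⌉₊ + 1) → Fin n → ℝ // ∀ m, OnSphere S (C m)})
    (Q := fun n C δ => ∀ m, listErrorProb σ L C.1 m ≤
      ENNReal.ofReal (Real.exp (-(n * (ckmExponent S σ L R - δ)))))
    (fun n => ⟨fun _ _ => √S, fun _ => onSphere_const hS n⟩)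
    (fun n C δ δ' hδ hQ m => (hQ m).trans (ENNReal.ofReal_le_ofReal (by gcongr)))
    (fun δ hδ => by
      filter_upwards [eventually_exists_code hS hσ hL hρ0.le hρ1 hs0 hs1
        (div_mul_cancel₀ _ hk.ne') hR hδ] with n hn
      obtain ⟨C, hC, hle⟩ := hn
      exact ⟨⟨C, hC⟩, fun m => by rw [hE]; exact hle m⟩)
  exact ⟨fun n => (C n).1, fun n => (C n).2, hC⟩

end GaussianList

end

/-! ### Assembly of the statement -/

open GaussianList in
theorem mainTheorem5 (L : ℕ) (hL : 1 ≤ L) (S σ : ℝ) (hS : 0 < S) (hσ : 0 < σ) :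
    -- the distance of the Gaussian channel, for letters and for words on the sphere
    (∀ x : Fin (L + 1) → ℝ, bhatt σ x =
      L / (2 * σ ^ 2 * (L + 1) ^ 2) *
        (∑ i, x i ^ 2 - 2 / L * ∑ i, ∑ j ∈ Finset.Ioi i, x i * x j)) ∧
    (∀ (n : ℕ), 1 ≤ n → ∀ x : Fin (L + 1) → Fin n → ℝ, (∀ i, OnSphere S (x i)) →
      ∑ t, bhatt σ (fun i => x i t) =
        n * distForm S σ (Matrix.of fun i j => empCorr S (x i) (x j))) ∧
    -- Gaussian multi-information, mean distance, and the exponent of the spherical ensemble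
    (∀ Λ : Matrix (Fin (L + 1)) (Fin (L + 1)) ℝ, IsCorr Λ →
      multiInfo (gaussLaw S Λ) = ENNReal.ofReal (-(1 / 2) * Real.log Λ.det) ∧
      ∫ x, bhatt σ x ∂gaussLaw S Λ = distForm S σ Λ ∧
      ∀ δ > 0, ∃ ε₀ > 0, ∀ ε, 0 < ε → ε < ε₀ → ∀ᶠ n : ℕ in atTop,
        ENNReal.ofReal (Real.exp (-(n * (-(1 / 2) * Real.log Λ.det + δ)))) ≤ corrProb L n S ε Λ ∧
        corrProb L n S ε Λ ≤ ENNReal.ofReal (Real.exp (-(n * (-(1 / 2) * Real.log Λ.det - δ))))) ∧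
    -- the exponent is achievable by codes on the sphere, for the maximal list error probability
    (∀ R > 0, ∃ C : (n : ℕ) → Fin (⌈Real.exp (n * R)⌉₊ + 1) → Fin n → ℝ,
      (∀ n m, OnSphere S (C n m)) ∧
      ∀ δ > 0, ∀ᶠ n : ℕ in atTop, ∀ m,
        listErrorProb σ L (C n) m ≤
          ENNReal.ofReal (Real.exp (-(n * (ckmExponent S σ L R - δ))))) ∧
    -- the infimum over correlation matrices; it is attained
    (∀ R > 0, IsLeast
      {e | ∃ Λ : Matrix (Fin (L + 1)) (Fin (L + 1)) ℝ, IsCorr Λ ∧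
        -(1 / 2) * Real.log Λ.det ≤ L * R ∧
        e = distForm S σ Λ - 1 / 2 * Real.log Λ.det - L * R}
      (ckmExponent S σ L R)) ∧
    -- totally symmetric matrices
    (∀ ρ : ℝ, (IsCorr (symMatrix L ρ) ↔ -1 / (L : ℝ) < ρ ∧ ρ < 1) ∧
      (symMatrix L ρ).det = (1 + ρ * L) * (1 - ρ) ^ L) ∧
    -- it is attained at a totally symmetric matrix
    (∀ R > 0, ∃ ρ : ℝ, IsCorr (symMatrix L ρ) ∧
      -(1 / 2) * Real.log (symMatrix L ρ).det ≤ L * R ∧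
      ckmExponent S σ L R =
        distForm S σ (symMatrix L ρ) - 1 / 2 * Real.log (symMatrix L ρ).det - L * R) ∧
    -- the reduction to one variable
    (∀ R > 0, IsLeast
      {e | ∃ ρ : ℝ, -1 / (L : ℝ) < ρ ∧ ρ < 1 ∧ symInfo L ρ ≤ L * R ∧
        e = symDist S σ L ρ + symInfo L ρ - L * R}
      (ckmExponent S σ L R)) ∧
    -- the curved part and the affine part
    ∃ (ρ₀ : ℝ) (ϱ : ℝ → ℝ) (R₀ : ℝ),
      0 < ρ₀ ∧ ρ₀ < 1 ∧
      (∀ ρ, 0 ≤ ρ → ρ < 1 → ρ ≠ ρ₀ →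
        symDist S σ L ρ₀ + symInfo L ρ₀ < symDist S σ L ρ + symInfo L ρ) ∧
      (∀ R, 0 ≤ R → 0 ≤ ϱ R ∧ ϱ R < 1 ∧
        ∀ ρ, 0 ≤ ρ → ρ < 1 → (symInfo L ρ = L * R ↔ ρ = ϱ R)) ∧
      0 < R₀ ∧ (∀ R, 0 ≤ R → (ϱ R = ρ₀ ↔ R = R₀)) ∧
      (∀ R, 0 < R → R < R₀ → ckmExponent S σ L R = symDist S σ L (ϱ R)) ∧
      (∀ R, R₀ ≤ R → ckmExponent S σ L R = symDist S σ L ρ₀ + symInfo L ρ₀ - L * R) ∧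
      -- the affine part is tangential to the curve at `R₀`, and `R₀` is the only such point
      (∀ R > 0, DifferentiableAt ℝ (fun r => symDist S σ L (ϱ r)) R) ∧
      (∀ R > 0, deriv (fun r => symDist S σ L (ϱ r)) R = -L ↔ R = R₀) ∧
      StrictMonoOn (deriv fun r => symDist S σ L (ϱ r)) (Ioi 0) ∧
      Tendsto (deriv fun r => symDist S σ L (ϱ r)) (𝓝[>] 0) atBot ∧
      -- closed forms for `L = 1` and `L = 2`
      (L = 1 →
        (∀ R > 0, IsLeast
          {e | ∃ ρ : ℝ, |ρ| < 1 ∧ -(1 / 2) * Real.log (1 - ρ ^ 2) ≤ R ∧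
            e = S / (4 * σ ^ 2) * (1 - ρ) - 1 / 2 * Real.log (1 - ρ ^ 2) - R}
          (ckmExponent S σ 1 R)) ∧
        (∀ R, 0 ≤ R → ϱ R = √(1 - Real.exp (-2 * R))) ∧
        (∀ R, 0 < R → R < R₀ →
          ckmExponent S σ 1 R = S * (1 - √(1 - Real.exp (-2 * R))) / (4 * σ ^ 2)) ∧
        (∀ R, R₀ ≤ R → ckmExponent S σ 1 R =
          S * (1 - √(1 - Real.exp (-2 * R₀))) / (4 * σ ^ 2) - (R - R₀))) ∧
      (L = 2 → ∀ R, 0 ≤ R → ϱ R =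
        √(1 - Real.exp (-4 * R)) /
          (2 * Real.cos (1 / 3 * Real.arccos (-√(1 - Real.exp (-4 * R)))))) := by
  obtain ⟨ρ₀, h0, h1, h⟩ := exists_symSlope_eq hL (distSlope_pos hS hσ hL)
  have hL' : (0 : ℝ) < L := by exact_mod_cast hL
  have hleast : ∀ R > 0, IsLeast
      {e | ∃ ρ : ℝ, -1 / (L : ℝ) < ρ ∧ ρ < 1 ∧ symInfo L ρ ≤ L * R ∧
        e = symDist S σ L ρ + symInfo L ρ - L * R} (ckmExponent S σ L R) := fun R hR => by
    rw [ckmExponent_eq hS hσ hL h0 h1 h hR]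
    exact isLeast_symmetric hS hσ hL h0 h1 h hR
  have hinfo0 : 0 < symInfo L ρ₀ := by
    simpa [symInfo_zero] using strictMonoOn_symInfo hL ⟨le_rfl, one_pos⟩ ⟨h0.le, h1⟩ h0
  -- The critical rate is `R₀ = I(ρ₀) / L`, at which the constraint `I(ρ) ≤ L R` ceases to exclude
  -- `ρ₀`.
  have hR₀ : 0 < symInfo L ρ₀ / L := by positivity
  have hϱ₀ := (symRho_image hL h0.le h1).2
  have hiff : ∀ R, 0 ≤ R → (symRho L R = ρ₀ ↔ R = symInfo L ρ₀ / L) := fun R hR =>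
    ⟨fun e => (strictMonoOn_symRho hL).injOn hR hR₀.le (e.trans hϱ₀.symm), fun e => e ▸ hϱ₀⟩
  have hlow : ∀ R, 0 < R → R < symInfo L ρ₀ / L →
      ckmExponent S σ L R = symDist S σ L (symRho L R) := fun R hR hlt => by
    have := strictMonoOn_symRho hL hR.le hR₀.le hlt
    rw [hϱ₀] at this
    rw [ckmExponent_eq hS hσ hL h0 h1 h hR, min_eq_left this.le, (symRho_spec hL hR.le).2.2]
    ring
  have hhigh : ∀ R, symInfo L ρ₀ / L ≤ R →
      ckmExponent S σ L R = symDist S σ L ρ₀ + symInfo L ρ₀ - L * R := fun R hle => by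
    have hR := hR₀.trans_le hle
    have := (strictMonoOn_symRho hL).monotoneOn hR₀.le hR.le hle
    rw [hϱ₀] at this
    rw [ckmExponent_eq hS hσ hL h0 h1 h hR, min_eq_right this]
  refine ⟨bhatt_eq hσ hL, fun n hn x hx => sum_bhatt_eq hS hσ hL hn x hx,
    fun Λ hΛ => ⟨multiInfo_gaussLaw hS hΛ, integral_bhatt_gaussLaw hS hσ hL hΛ,
      fun δ hδ => corrProb_exponent hS hΛ hδ⟩,
    fun R hR => exists_codes_ckmExponent hS hσ hL h0 h1 h hR,
    fun R hR => isLeast_corr_of_isLeast_symmetric hL (hleast R hR),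
    fun ρ => ⟨isCorr_symMatrix_iff hL ρ, det_symMatrix hL ρ⟩, fun R hR => ?_, hleast,
    ρ₀, symRho L, symInfo L ρ₀ / L, h0, h1,
    fun ρ => symDist_add_symInfo_lt hL h0.le h1 h,
    fun R hR => ⟨(symRho_spec hL hR).1, (symRho_spec hL hR).2.1, fun ρ => symInfo_eq_iff hL hR⟩,
    hR₀, hiff, hlow, hhigh,
    fun R hR => (hasDerivAt_symDist_symRho S σ hL hR).differentiableAt,
    fun R hR => (deriv_symDist_symRho_eq_iff hL h0 h1 h hR).trans (hiff R hR.le),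
    strictMonoOn_deriv_symDist_symRho hS hσ hL, tendsto_deriv_symDist_symRho hS hσ hL, ?_, ?_⟩
  · obtain ⟨ρ, ha, hb, hc, he⟩ := (hleast R hR).1
    refine ⟨ρ, (isCorr_symMatrix_iff hL ρ).2 ⟨ha, hb⟩, ?_, ?_⟩
    · rwa [← symInfo_eq_log_det hL ha hb]
    · rw [he, symInfo_eq_log_det hL ha hb, distForm_eq_symDist S σ hL, offMean_symMatrix hL]
      ring
  · rintro rfl
    have hd : ∀ ρ, symDist S σ 1 ρ = S / (4 * σ ^ 2) * (1 - ρ) := fun ρ => by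
      unfold symDist; push_cast; field_simp; ring
    refine ⟨fun R hR => ?_, fun R hR => symRho_one hR, fun R hR hlt => ?_, fun R hle => ?_⟩
    · convert hleast R hR using 1
      ext e
      refine exists_congr fun ρ => ?_
      rw [← and_assoc (a := _ < ρ), Nat.cast_one, div_one, ← abs_lt, one_mul]
      refine and_congr_right fun hρ => ?_
      rw [symInfo_one hρ, hd, show S / (4 * σ ^ 2) * (1 - ρ) + -(1 / 2) * Real.log (1 - ρ ^ 2) - R =
        S / (4 * σ ^ 2) * (1 - ρ) - 1 / 2 * Real.log (1 - ρ ^ 2) - R by ring]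
    · rw [hlow R hR hlt, hd, symRho_one hR.le]
      ring
    · rw [hhigh R hle, hd, ← symRho_one hR₀.le, hϱ₀]
      push_cast
      ring
  · rintro rfl R hR
    exact symRho_two hR
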